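/- **Setting.** Let $\mathfrak H,\mathfrak H_*$ be complex Hilbert spaces, $X_0:\mathfrak H\to\mathfrak H_*$ a densely defined closed operator, $X_1:\mathfrak H\to\mathfrak H_*$ a bounded operator, $X(t)=X_0+tX_1$ on $\operatorname{Dom}X_0$ and $A(t)=X(t)^*X(t)$, $t\in\mathbb R$. Let $\mathfrak N=\operatorname{Ker}X_0$, $\mathfrak N_*=\operatorname{Ker}X_0^*$, and let $P$, $P_*$ be the orthogonal projections onto $\mathfrak N$, $\mathfrak N_*$. Assume that $0$ is an isolated point of the spectrum of $A(0)$ and $0<n:=\dim\mathfrak N<\infty$; let $d^0\in(0,\infty]$ be the distance from $0$ to the rest of the spectrum of $A(0)$. Fix $\delta>0$ with $8\delta<d^0$ and $0<t^0\le\delta^{1/2}\|X_1\|^{-1}$, and assume that, for some $c_*>0$, $A(t)\ge c_*t^2I$ for $|t|\le t^0$. Let $F(t)$ be the spectral projection of $A(t)$ for $[0,\delta]$. For $\omega\in\mathfrak N$ let $\phi(\omega)\in\operatorname{Dom}X_0\cap\mathfrak N^\perp$ be the weak solution of $X_0^*(X_0\phi+X_1\omega)=0$, and put $Zu=\phi(Pu)$,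 $R=(X_0Z+X_1)|_{\mathfrak N}=P_*X_1|_{\mathfrak N}$, $S=R^*R:\mathfrak N\to\mathfrak N$ (the germ), $N=Z^*X_1^*RP+(RP)^*X_1Z$. Let $\gamma_1^\circ<\dots<\gamma_p^\circ$ be the different eigenvalues of $S$, $P_j$ the orthogonal projection onto $\operatorname{Ker}(S-\gamma_j^\circ)$, and $$N_0=\sum_jP_jNP_j,\qquad N_*=N-N_0=\sum_{j\ne l}P_jNP_l .$$ With $\Xi(s)=(SP+sI)^{-1}P$ put $$\mathcal I_*=-\frac1\pi\int_0^\infty s^{-1/2}\bigl(\Xi(s)N_*+N_*\Xi(s)-s\,\Xi(s)N_*\Xi(s)\bigr)ds,$$ $$G=ZS^{1/2}P+S^{1/2}PZ^*+\tfrac12N_0S^{-1/2}P+S^{-1/2}N_*P+N_*S^{-1/2}P+\mathcal I_* .$$ **Theorem.** There are absolute constants $\beta_1,\beta_2,\beta_{10},\beta_{11},\beta_{12},\beta_{13},\beta_{14}\ge1$ (independent of all the data above) such that the following holds, where $C_1=\beta_1\delta^{-1/2}\|X_1\|$, $$C_{10}=\beta_{10}\|X_1\|^4\delta^{-1}c_*^{-1/2}+\beta_{11}\|X_1\|^6\delta^{-1}c_*^{-3/2}+\beta_{12}\|X_1\|^8\delta^{-1}c_*^{-5/2},\qquad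 C_{11}=8^{-1/2}\beta_1\|X_1\|^3\delta^{-1}+C_{10}.$$ (a) For $|t|\le t^0$ one has $A(t)^{1/2}F(t)=|t|S^{1/2}P+t|t|G+\Phi(t)$ with $\|\Phi(t)\|\le C_{10}|t|^3$; moreover $\|\mathcal I_*\|\le\frac52(2\delta)^{-1/2}c_*^{-1/2}\|X_1\|^3$. (b) If, for $|t|\le r$ with some $0<r\le t^0$, $\lambda_l(t)=\gamma_lt^2+\mu_lt^3+\dots$ and $\varphi_l(t)=\omega_l+t\psi_l+\dots$ ($l=1,\dots,n$) are real-analytic branches of eigenvalues and eigenvectors of $A(t)$ with $\{\varphi_l(t)\}$ an orthonormal basis of $F(t)\mathfrak H$, then, with $\widetilde\omega_l=\psi_l-Z\omega_l$, $$N_0=\sum_l\mu_l(\cdot,\omega_l)\omega_l,\qquad N_*=\sum_l\gamma_l\bigl((\cdot,\widetilde\omega_l)\omega_l+(\cdot,\omega_l)\widetilde\omega_l\bigr).$$ (c) If $N=0$, then for all $\varepsilon>0$, $\tau\in\mathbb R$, $|t|\le t^0$, $$\bigl\|\cos(\varepsilon^{-1}\tau A(t)^{1/2})P-\cos(\varepsilon^{-1}\tau(t^2S)^{1/2}P)P\bigr\|\,\varepsilon^{3/2}(t^2+\varepsilon^2)^{-3/4}\le(C_1'+C_{11}|\tau|)\varepsilon,\qquad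 C_1'=\max\{2,2C_1\}.$$ (d) Let $N_0=0$. Put $c^\circ_{jl}=\min\{c_*,n^{-1}|\gamma_l^\circ-\gamma_j^\circ|\}$ and let $c^\circ$ be the minimum of $c^\circ_{jl}$ over all pairs $j\ne l$ with $P_jNP_l\ne0$ (if there is no such pair, let $c^\circ$ be any positive number). Let $t^{00}\le t^0$ and $t^{00}\le(4\beta_2)^{-1}\delta^{1/2}\|X_1\|^{-3}c^\circ$. Then for all $\varepsilon>0$, $\tau\in\mathbb R$, $|t|\le t^{00}$, $$\bigl\|\cos(\varepsilon^{-1}\tau A(t)^{1/2})P-\cos(\varepsilon^{-1}\tau(t^2S)^{1/2}P)P\bigr\|\,\varepsilon^{3/2}(t^2+\varepsilon^2)^{-3/4}\le(C_{15}'+C_{16}|\tau|)\varepsilon,$$ where $C_{15}'=\max\{2,2C_1+C_{14}\}$, $C_{16}=C_{11}+C_{13}$, $C_{13}=\beta_{13}n^2\delta^{-1}c_*^{-1/2}\|X_1\|^8(c^\circ)^{-2}$, $C_{14}=\beta_{14}n^2\delta^{-1/2}c_*^{-1/2}\|X_1\|^4(c^\circ)^{-1}$. -/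

import Mathlib

open MeasureTheory

open scoped InnerProductSpace LinearPMap ENNReal

noncomputable section

/-! ## Unbounded operators: composition, kernel, spectrum -/

section Unbounded

variable {H : Type*} [NormedAddCommGroup H] [InnerProductSpace ℂ H]
variable {K : Type*} [NormedAddCommGroup K] [InnerProductSpace ℂ K]

/-- The product `T ∘ X` of two partially defined operators, on its natural domain
`{u ∈ Dom X | X u ∈ Dom T}`. -/
def unboundedComp (T : K →ₗ.[ℂ] H) (X : H →ₗ.[ℂ] K) : H →ₗ.[ℂ] H :=
  T.comp (X.domRestrict ((T.domain.comap X.toFun).map X.domain.subtype)) (by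
    intro x
    obtain ⟨y, hy, hyx⟩ := x.2.1
    have h := LinearPMap.domRestrict_apply (f := X) (x := x) (y := y) hyx.symm
    exact h ▸ hy)

/-- The kernel of a partially defined operator, as a subspace of the whole space. -/
def unboundedKer (X : H →ₗ.[ℂ] K) : Submodule ℂ H :=
  (LinearMap.ker X.toFun).map X.domain.subtype

/-- The spectrum of a partially defined operator: the complement of the set of those `z` for
which `A - z` has a bounded everywhere defined two-sided inverse. -/
def unboundedSpectrum (A : H →ₗ.[ℂ] H) : Set ℂ :=
  {z | ¬ ∃ B : H →L[ℂ] H,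
    (∀ u : A.domain, B (A u - z • (u : H)) = u) ∧
    (∀ v : H, ∃ h : B v ∈ A.domain, A ⟨B v, h⟩ - z • B v = v)}

/-- The orthogonal projection of a Hilbert space onto the closure of the subspace `L`
(onto `L` itself if `L` is closed). -/
def orthProj [CompleteSpace H] (L : Submodule ℂ H) : H →L[ℂ] H :=
  L.topologicalClosure.starProjection

end Unbounded

/-! ## Spectral measures of selfadjoint operators and bounded Borel functions of them -/

/-- Projection-valued Borel measures on `ℝ` (resolutions of the identity). -/
structure ProjMeasure (H : Type*) [NormedAddCommGroup H] [InnerProductSpace ℂ H]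
    [CompleteSpace H] where
  /-- the projection attached to a Borel set; it is set to `0` on non-Borel sets -/
  E : Set ℝ → H →L[ℂ] H
  not_measurable : ∀ s, ¬ MeasurableSet s → E s = 0
  isStarProjection : ∀ s, MeasurableSet s → IsStarProjection (E s)
  univ : E Set.univ = 1
  inter : ∀ s t, MeasurableSet s → MeasurableSet t → E (s ∩ t) = E s * E t
  hasSum_iUnion : ∀ s : ℕ → Set ℝ, (∀ i, MeasurableSet (s i)) →
    Pairwise (Function.onFun Disjoint s) →
    ∀ u : H, HasSum (fun i => E (s i) u) (E (⋃ i, s i) u)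

namespace ProjMeasure

variable {H : Type*} [NormedAddCommGroup H] [InnerProductSpace ℂ H] [CompleteSpace H]

theorem E_empty (e : ProjMeasure H) : e.E ∅ = 0 := by
  ext u
  have h := (e.hasSum_iUnion (fun _ => ∅) (fun _ => MeasurableSet.empty)
    (fun _ _ _ => by simp [Function.onFun]) u).summable
  simpa using (summable_const_iff _).1 h

theorem inner_E (e : ProjMeasure H) {s : Set ℝ} (hs : MeasurableSet s) (u : H) :
    ⟪u, e.E s u⟫_ℂ = ((‖e.E s u‖ ^ 2 : ℝ) : ℂ) := by
  have h := e.isStarProjection s hs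
  have h1 : e.E s (e.E s u) = e.E s u := by
    have := congrArg (fun T : H →L[ℂ] H => T u) h.isIdempotentElem.eq
    simpa using this
  have h2 : ContinuousLinearMap.adjoint (e.E s) = e.E s := h.isSelfAdjoint.adjoint_eq
  have h3 : ⟪u, e.E s (e.E s u)⟫_ℂ = ⟪e.E s u, e.E s u⟫_ℂ := by
    rw [← ContinuousLinearMap.adjoint_inner_left, h2]
  rw [h1] at h3
  rw [h3, inner_self_eq_norm_sq_to_K]
  push_cast
  rfl

/-- The scalar measure `s ↦ (E(s) u, u) = ‖E(s) u‖²` of a vector `u`. -/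
def scalarMeasure (e : ProjMeasure H) (u : H) : Measure ℝ :=
  Measure.ofMeasurable (fun s _ => ENNReal.ofReal (‖e.E s u‖ ^ 2))
    (by simp [e.E_empty])
    (by
      intro f hf hd
      have h := (e.hasSum_iUnion f hf hd u).mapL (innerSL ℂ u)
      simp only [innerSL_apply_apply] at h
      rw [e.inner_E (MeasurableSet.iUnion hf)] at h
      simp only [e.inner_E (hf _)] at h
      have h' := Complex.hasSum_ofReal.1 h
      rw [← h'.tsum_eq, ENNReal.ofReal_tsum_of_nonneg (fun _ => by positivity) h'.summable])

/-- `e` is the spectral measure of `A`, i.e. `A = ∫ x dE(x)`: the domain of `A` consists of the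
vectors `u` with `∫ x² d(E(x)u,u) < ∞`, and `(A u, u) = ∫ x d(E(x)u,u)` for such `u`. -/
structure IsSpectralMeasureOf (e : ProjMeasure H) (A : H →ₗ.[ℂ] H) : Prop where
  mem_domain_iff : ∀ u : H,
    u ∈ A.domain ↔ ∫⁻ x, ENNReal.ofReal (x ^ 2) ∂(e.scalarMeasure u) < ∞
  inner_apply : ∀ u : A.domain,
    ⟪(u : H), A u⟫_ℂ = ((∫ x, x ∂(e.scalarMeasure (u : H)) : ℝ) : ℂ)

/-- The bounded operator `T` is `∫ f dE`: one has `(T u, u) = ∫ f(x) d(E(x)u,u)` for all `u`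
(which determines `T`, by polarization). -/
def IsIntegral (e : ProjMeasure H) (f : ℝ → ℝ) (T : H →L[ℂ] H) : Prop :=
  ∀ u : H, Integrable f (e.scalarMeasure u) ∧
    ⟪u, T u⟫_ℂ = ((∫ x, f x ∂(e.scalarMeasure u) : ℝ) : ℂ)

open Classical in
/-- The bounded operator `∫ f dE`; it exists for every bounded Borel function `f`. -/
def integral (e : ProjMeasure H) (f : ℝ → ℝ) : H →L[ℂ] H :=
  if h : ∃ T, e.IsIntegral f T then h.choose else 0

open Classical in
/-- The unit mass at `0`. -/
def unitMass (H : Type*) [NormedAddCommGroup H] [InnerProductSpace ℂ H] [CompleteSpace H] :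
    ProjMeasure H where
  E s := if MeasurableSet s ∧ (0 : ℝ) ∈ s then 1 else 0
  not_measurable s hs := by simp [hs]
  isStarProjection s _ := by
    split_ifs
    · exact ⟨by simp [IsIdempotentElem], by simp⟩
    · exact ⟨by simp [IsIdempotentElem], by simp⟩
  univ := by simp
  inter s t hs ht := by
    by_cases h1 : (0 : ℝ) ∈ s <;> by_cases h2 : (0 : ℝ) ∈ t <;> simp [h1, h2, hs, ht]
  hasSum_iUnion s hs hd u := by
    by_cases h : ∃ i, (0 : ℝ) ∈ s i
    · obtain ⟨i, hi⟩ := h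
      have hU : (0 : ℝ) ∈ ⋃ i, s i := Set.mem_iUnion.2 ⟨i, hi⟩
      have := hasSum_single (f := fun j => (if MeasurableSet (s j) ∧ (0 : ℝ) ∈ s j
        then (1 : H →L[ℂ] H) else 0) u) i (by
          intro j hj
          have : (0 : ℝ) ∉ s j := fun h0 => Set.disjoint_left.1 (hd hj) h0 hi
          simp [this])
      simpa [hi, hs i, hU, MeasurableSet.iUnion hs] using this
    · push Not at h
      have hU : (0 : ℝ) ∉ ⋃ i, s i := by simpa using h
      simp only [h, hU, and_false, if_false]
      simp

end ProjMeasure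

open Classical in
/-- The spectral measure of an operator `A`. It exists, and is unique, for every selfadjoint `A`
(the spectral theorem); the unit mass at `0` is the value for operators without one. -/
def spectralMeasure {H : Type*} [NormedAddCommGroup H] [InnerProductSpace ℂ H] [CompleteSpace H]
    (A : H →ₗ.[ℂ] H) : ProjMeasure H :=
  if h : ∃ e : ProjMeasure H, e.IsSpectralMeasureOf A then h.choose else ProjMeasure.unitMass H

/-! ## The abstract operator family -/

/-- The data `X(t) = X₀ + t X₁`: `X₀` densely defined and closed, `X₁` bounded. -/
structure OperatorPencil (H K : Type*) [NormedAddCommGroup H] [InnerProductSpace ℂ H]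
    [NormedAddCommGroup K] [InnerProductSpace ℂ K] where
  X₀ : H →ₗ.[ℂ] K
  X₁ : H →L[ℂ] K
  dense_domain : Dense (X₀.domain : Set H)
  isClosed : X₀.IsClosed

namespace OperatorPencil

variable {H : Type*} [NormedAddCommGroup H] [InnerProductSpace ℂ H] [CompleteSpace H]
variable {K : Type*} [NormedAddCommGroup K] [InnerProductSpace ℂ K] [CompleteSpace K]

/-- `X(t) = X₀ + t X₁` on `Dom X₀`. -/
def X (p : OperatorPencil H K) (t : ℝ) : H →ₗ.[ℂ] K :=
  (((t : ℂ) • p.X₁ : H →L[ℂ] K) : H →ₗ[ℂ] K) +ᵥ p.X₀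

/-- `A(t) = X(t)^* X(t)`. -/
def A (p : OperatorPencil H K) (t : ℝ) : H →ₗ.[ℂ] H :=
  unboundedComp (p.X t)† (p.X t)

/-- `𝔑 = Ker X₀ (= Ker A(0))`. -/
def 𝔑 (p : OperatorPencil H K) : Submodule ℂ H := unboundedKer p.X₀

/-- `𝔑_* = Ker X₀^*`. -/
def 𝔑star (p : OperatorPencil H K) : Submodule ℂ K := unboundedKer p.X₀†

/-- The orthogonal projection `P` onto `𝔑`. -/
def P (p : OperatorPencil H K) : H →L[ℂ] H := orthProj p.𝔑

/-- The orthogonal projection `P_*` onto `𝔑_*`. -/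
def Pstar (p : OperatorPencil H K) : K →L[ℂ] K := orthProj p.𝔑star

/-- `n = dim 𝔑`. -/
def n (p : OperatorPencil H K) : ℕ := Module.finrank ℂ p.𝔑

/-- `d⁰`, the distance from `0` to the rest of the spectrum of `A(0)` (`∞` if there is no
rest). -/
def d₀ (p : OperatorPencil H K) : ℝ≥0∞ :=
  Metric.infEDist (0 : ℂ) (unboundedSpectrum (p.A 0) \ {0})

/-- The spectral projection `F(t) = F(t; [0, δ])` of `A(t)` for the interval `[0, δ]`. -/
def F (p : OperatorPencil H K) (δ t : ℝ) : H →L[ℂ] H :=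
  (spectralMeasure (p.A t)).E (Set.Icc 0 δ)

/-- The bounded operator `A(t)^{1/2} F(t)`. -/
def sqrtAF (p : OperatorPencil H K) (δ t : ℝ) : H →L[ℂ] H :=
  (spectralMeasure (p.A t)).integral ((Set.Icc 0 δ).indicator Real.sqrt)

/-- The bounded operator `cos(s A(t)^{1/2})`. -/
def cosSqrtA (p : OperatorPencil H K) (s t : ℝ) : H →L[ℂ] H :=
  (spectralMeasure (p.A t)).integral (fun x => Real.cos (s * Real.sqrt x))

/-- `Z u = φ(P u)`, where `φ(ω) ∈ Dom X₀ ∩ 𝔑^⊥` is the weak solution of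
`X₀^* (X₀ φ + X₁ ω) = 0`. -/
structure IsCorrector (p : OperatorPencil H K) (Z : H →L[ℂ] H) : Prop where
  mem_domain : ∀ u, Z u ∈ p.X₀.domain
  mem_orthogonal : ∀ u, Z u ∈ p.𝔑ᗮ
  weak : ∀ (u : H) (ζ : p.X₀.domain), (ζ : H) ∈ p.𝔑ᗮ →
    ⟪p.X₀ ζ, p.X₀ ⟨Z u, mem_domain u⟩⟫_ℂ = - ⟪p.X₀ ζ, p.X₁ (p.P u)⟫_ℂ

open Classical in
/-- The operator `Z`; it exists and is unique when `0` is an isolated point of the spectrum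
of `A(0)`. -/
def Z (p : OperatorPencil H K) : H →L[ℂ] H :=
  if h : ∃ Z, p.IsCorrector Z then h.choose else 0

/-- The operator `R P`, where `R = P_* X₁ |_𝔑 = (X₀ Z + X₁)|_𝔑`
(see `IsCorrector.RP_apply` for the second expression). -/
def RP (p : OperatorPencil H K) : H →L[ℂ] K := p.Pstar ∘L p.X₁ ∘L p.P

/-- The operator `S P`, where `S = R^* R : 𝔑 → 𝔑` is the spectral germ. -/
def SP (p : OperatorPencil H K) : H →L[ℂ] H := ContinuousLinearMap.adjoint p.RP ∘L p.RP

/-- `(t² S)^{1/2} P`. -/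
def sqrtGerm (p : OperatorPencil H K) (t : ℝ) : H →L[ℂ] H := CFC.sqrt (((t : ℂ) ^ 2) • p.SP)

/-- `cos(s (t² S)^{1/2} P)`. -/
def cosSqrtGerm (p : OperatorPencil H K) (s t : ℝ) : H →L[ℂ] H :=
  cfc (fun x : ℝ => Real.cos (s * x)) (p.sqrtGerm t)

/-- `S^{1/2} P`. -/
def sqrtSP (p : OperatorPencil H K) : H →L[ℂ] H := CFC.sqrt p.SP

/-- `S^{-1/2} P` for a nondegenerate germ: the function equal to `x^{-1/2}` for `x > 0` and to `0`
at `x = 0`, applied to `S P`. -/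
def invSqrtSP (p : OperatorPencil H K) : H →L[ℂ] H :=
  cfc (fun x : ℝ => (Real.sqrt x)⁻¹) p.SP

/-- `N = Z^* X₁^* R P + (R P)^* X₁ Z`. -/
def N (p : OperatorPencil H K) : H →L[ℂ] H :=
  ContinuousLinearMap.adjoint p.Z ∘L ContinuousLinearMap.adjoint p.X₁ ∘L p.RP +
    ContinuousLinearMap.adjoint p.RP ∘L p.X₁ ∘L p.Z

/-- The eigenspace `Ker (S - γ I_𝔑)` of the germ. -/
def germEigenspace (p : OperatorPencil H K) (γ : ℝ) : Submodule ℂ H :=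
  p.𝔑 ⊓ LinearMap.ker ((p.SP - (γ : ℂ) • (1 : H →L[ℂ] H) : H →L[ℂ] H) : H →ₗ[ℂ] H)

/-- The set of the (different) eigenvalues `γ_1°, …, γ_p°` of the germ `S`. -/
def germEigenvalues (p : OperatorPencil H K) : Set ℝ := {γ | p.germEigenspace γ ≠ ⊥}

/-- The orthogonal projection `P_j` onto the eigenspace of the germ for the eigenvalue `γ = γ_j°`
(and `0` if `γ` is not an eigenvalue). -/
def germProj (p : OperatorPencil H K) (γ : ℝ) : H →L[ℂ] H := orthProj (p.germEigenspace γ)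

/-- `N₀ = ∑_j P_j N P_j`, the block-diagonal part of `N` with respect to the eigenspaces of the
germ (only finitely many summands are nonzero). -/
def N₀ (p : OperatorPencil H K) : H →L[ℂ] H :=
  ∑ᶠ γ : ℝ, p.germProj γ ∘L p.N ∘L p.germProj γ

/-- `N_* = N - N₀ = ∑_{j ≠ l} P_j N P_l`. -/
def Nstar (p : OperatorPencil H K) : H →L[ℂ] H := p.N - p.N₀

/-- `Ξ(1, s) = (S P + s I)^{-1} P`, for `s > 0`. -/
def Ξ (p : OperatorPencil H K) (s : ℝ) : H →L[ℂ] H :=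
  Ring.inverse (p.SP + (s : ℂ) • (1 : H →L[ℂ] H)) ∘L p.P

/-- `𝓘_*(1) = - π⁻¹ ∫_0^∞ s^{-1/2} (Ξ N_* + N_* Ξ - s Ξ N_* Ξ) ds` with `Ξ = Ξ(1, s)`. -/
def Istar (p : OperatorPencil H K) : H →L[ℂ] H :=
  -((Real.pi : ℂ)⁻¹ • ∫ s in Set.Ioi (0 : ℝ), ((Real.sqrt s : ℂ)⁻¹) •
    (p.Ξ s ∘L p.Nstar + p.Nstar ∘L p.Ξ s - (s : ℂ) • (p.Ξ s ∘L p.Nstar ∘L p.Ξ s)))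

/-- `G = Z S^{1/2} P + S^{1/2} P Z^* + ½ N₀ S^{-1/2} P + S^{-1/2} N_* P + N_* S^{-1/2} P + 𝓘_*(1)`. -/
def G (p : OperatorPencil H K) : H →L[ℂ] H :=
  p.Z ∘L p.sqrtSP + p.sqrtSP ∘L ContinuousLinearMap.adjoint p.Z
    + (2⁻¹ : ℂ) • (p.N₀ ∘L p.invSqrtSP)
    + p.invSqrtSP ∘L p.Nstar ∘L p.P + p.Nstar ∘L p.invSqrtSP + p.Istar

/-- The numbers `c_{jl}° = min {c_*, n⁻¹ |γ_l° - γ_j°|}` for those pairs `j ≠ l`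
with `P_j N P_l ≠ 0`. -/
def gaps (p : OperatorPencil H K) (cstar : ℝ) : Set ℝ :=
  {c | ∃ γ ∈ p.germEigenvalues, ∃ γ' ∈ p.germEigenvalues, γ ≠ γ' ∧
    p.germProj γ ∘L p.N ∘L p.germProj γ' ≠ 0 ∧ c = min cstar ((p.n : ℝ)⁻¹ * |γ' - γ|)}

/-- The standing assumptions: `0` is an isolated point of the spectrum of `A(0)`,
`0 < dim 𝔑 < ∞`, `0 < 8 δ < d⁰`, `0 < t⁰ ≤ δ^{1/2} ‖X₁‖⁻¹`, and the nondegeneracy condition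
`A(t) ≥ c_* t² I` for `|t| ≤ t⁰` with `c_* > 0`. -/
structure Assumptions (p : OperatorPencil H K) (δ t₀ cstar : ℝ) : Prop where
  zero_mem : (0 : ℂ) ∈ unboundedSpectrum (p.A 0)
  isolated : ¬ AccPt (0 : ℂ) (Filter.principal (unboundedSpectrum (p.A 0)))
  ker_ne_bot : p.𝔑 ≠ ⊥
  ker_finite : FiniteDimensional ℂ p.𝔑
  δ_pos : 0 < δ
  δ_lt : ENNReal.ofReal (8 * δ) < p.d₀
  t₀_pos : 0 < t₀
  t₀_le : t₀ ≤ Real.sqrt δ * ‖p.X₁‖⁻¹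
  cstar_pos : 0 < cstar
  nondegenerate : ∀ t : ℝ, |t| ≤ t₀ → ∀ u : (p.A t).domain,
    cstar * t ^ 2 * ‖(u : H)‖ ^ 2 ≤ (⟪(u : H), p.A t u⟫_ℂ).re

/-- Real-analytic branches `λ_l(t)`, `φ_l(t)`, `l = 1, …, n`, of eigenvalues and eigenvectors
of `A(t)` for `|t| ≤ r`, the `φ_l(t)` being an orthonormal basis of the range of `F(t)`. -/
structure IsBranches (p : OperatorPencil H K) (δ r : ℝ) (lam : Fin p.n → ℝ → ℝ)
    (φ : Fin p.n → ℝ → H) : Prop where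
  analytic_lam : ∀ l, AnalyticOnNhd ℝ (lam l) (Set.Icc (-r) r)
  analytic_φ : ∀ l, AnalyticOnNhd ℝ (φ l) (Set.Icc (-r) r)
  eigen : ∀ l, ∀ t ∈ Set.Icc (-r) r,
    ∃ h : φ l t ∈ (p.A t).domain, p.A t ⟨φ l t, h⟩ = (lam l t : ℂ) • φ l t
  orthonormal : ∀ t ∈ Set.Icc (-r) r, Orthonormal ℂ (fun l => φ l t)
  span_eq : ∀ t ∈ Set.Icc (-r) r,
    Submodule.span ℂ (Set.range fun l => φ l t) = LinearMap.range (p.F δ t : H →ₗ[ℂ] H)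

/-- `γ_l`, the coefficient of `t²` in `λ_l(t)`. -/
def γcoeff (lam : ℝ → ℝ) : ℝ := iteratedDeriv 2 lam 0 / 2

/-- `μ_l`, the coefficient of `t³` in `λ_l(t)`. -/
def μcoeff (lam : ℝ → ℝ) : ℝ := iteratedDeriv 3 lam 0 / 6

/-- `ω̃_l = ψ_l - Z ω_l`, where `φ_l(t) = ω_l + t ψ_l + …`. -/
def ωtilde (p : OperatorPencil H K) (φ : ℝ → H) : H := deriv φ 0 - p.Z (φ 0)

end OperatorPencil

/-! ## The constants -/

section Constants

/-- `C₁ = β₁ δ^{-1/2} ‖X₁‖`; in this and the following constants `x = ‖X₁‖`. -/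
def constC1 (β₁ δ x : ℝ) : ℝ := β₁ * (Real.sqrt δ)⁻¹ * x

/-- `C₁₀ = β₁₀ x⁴ δ⁻¹ c_*^{-1/2} + β₁₁ x⁶ δ⁻¹ c_*^{-3/2} + β₁₂ x⁸ δ⁻¹ c_*^{-5/2}`. -/
def constC10 (β₁₀ β₁₁ β₁₂ δ x cstar : ℝ) : ℝ :=
  β₁₀ * x ^ 4 * δ⁻¹ * cstar ^ (-(1 / 2) : ℝ) + β₁₁ * x ^ 6 * δ⁻¹ * cstar ^ (-(3 / 2) : ℝ)
    + β₁₂ * x ^ 8 * δ⁻¹ * cstar ^ (-(5 / 2) : ℝ)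

/-- `C₁₁ = 8^{-1/2} β₁ x³ δ⁻¹ + C₁₀`. -/
def constC11 (β₁ β₁₀ β₁₁ β₁₂ δ x cstar : ℝ) : ℝ :=
  (Real.sqrt 8)⁻¹ * β₁ * x ^ 3 * δ⁻¹ + constC10 β₁₀ β₁₁ β₁₂ δ x cstar

/-- `C₁₃ = β₁₃ n² δ⁻¹ c_*^{-1/2} x⁸ (c°)⁻²`. -/
def constC13 (β₁₃ : ℝ) (n : ℕ) (δ x cstar c : ℝ) : ℝ :=
  β₁₃ * (n : ℝ) ^ 2 * δ⁻¹ * cstar ^ (-(1 / 2) : ℝ) * x ^ 8 * (c ^ 2)⁻¹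

/-- `C₁₄ = β₁₄ n² δ^{-1/2} c_*^{-1/2} x⁴ (c°)⁻¹`. -/
def constC14 (β₁₄ : ℝ) (n : ℕ) (δ x cstar c : ℝ) : ℝ :=
  β₁₄ * (n : ℝ) ^ 2 * (Real.sqrt δ)⁻¹ * cstar ^ (-(1 / 2) : ℝ) * x ^ 4 * c⁻¹

end Constants

/-! ## The two expressions for `R` agree -/

theorem mem_unboundedKer {H K : Type*} [NormedAddCommGroup H] [InnerProductSpace ℂ H]
    [NormedAddCommGroup K] [InnerProductSpace ℂ K] {X : H →ₗ.[ℂ] K} {u : H} :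
    u ∈ unboundedKer X ↔ (u, (0 : K)) ∈ X.graph := by
  simp [unboundedKer, LinearPMap.mem_graph_iff]

theorem isClosed_unboundedKer {H K : Type*} [NormedAddCommGroup H] [InnerProductSpace ℂ H]
    [NormedAddCommGroup K] [InnerProductSpace ℂ K] {X : H →ₗ.[ℂ] K} (hX : X.IsClosed) :
    IsClosed (unboundedKer X : Set H) := by
  have h : (unboundedKer X : Set H) = (fun u : H => (u, (0 : K))) ⁻¹' (X.graph : Set (H × K)) := by
    ext u
    exact mem_unboundedKer
  rw [h]
  exact IsClosed.preimage (by fun_prop) hX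

/-- `R ω = X₀ Z ω + X₁ ω` for `ω ∈ 𝔑`. -/
theorem OperatorPencil.IsCorrector.RP_apply {H : Type*} [NormedAddCommGroup H]
    [InnerProductSpace ℂ H] [CompleteSpace H] {K : Type*} [NormedAddCommGroup K]
    [InnerProductSpace ℂ K] [CompleteSpace K] {p : OperatorPencil H K} {Z : H →L[ℂ] H}
    (h : p.IsCorrector Z) (u : H) :
    p.RP u = p.X₀ ⟨Z u, h.mem_domain u⟩ + p.X₁ (p.P u) := by
  set w : K := p.X₀ ⟨Z u, h.mem_domain u⟩ + p.X₁ (p.P u) with hw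
  have hcl : p.𝔑.topologicalClosure = p.𝔑 :=
    (isClosed_unboundedKer p.isClosed).submodule_topologicalClosure_eq
  -- `w` is orthogonal to the range of `X₀`
  have hperp : ∀ ζ : p.X₀.domain, ⟪p.X₀ ζ, w⟫_ℂ = 0 := by
    intro ζ
    have hP : p.P ζ ∈ p.𝔑 := by
      rw [← hcl]
      exact Submodule.starProjection_apply_mem _ _
    have hP' : (ζ : H) - p.P ζ ∈ p.𝔑ᗮ := by
      rw [← hcl]
      exact Submodule.sub_starProjection_mem_orthogonal _
    obtain ⟨η, hη, hηP⟩ := hP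
    have hη0 : p.X₀ η = 0 := hη
    have hηP' : (η : H) = p.P ζ := hηP
    have hd : ((ζ - η : p.X₀.domain) : H) ∈ p.𝔑ᗮ := by
      simpa [hηP'] using hP'
    have := h.weak u (ζ - η) hd
    rw [LinearPMap.map_sub, hη0, sub_zero] at this
    rw [hw, inner_add_right, this, neg_add_cancel]
  have hwm : w ∈ p.𝔑star := by
    have hmem : w ∈ p.X₀†.domain :=
      LinearPMap.mem_adjoint_domain_of_exists w ⟨0, fun x => by
        rw [inner_zero_left, ← inner_conj_symm, hperp, map_zero]⟩
    refine ⟨⟨w, hmem⟩, ?_, rfl⟩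
    exact LinearPMap.adjoint_apply_eq p.dense_domain _ (fun x => by
      rw [inner_zero_left, ← inner_conj_symm, hperp, map_zero])
  have h1 : p.Pstar w = w :=
    Submodule.starProjection_eq_self_iff.2 (p.𝔑star.le_topologicalClosure hwm)
  have h2 : p.Pstar (p.X₀ ⟨Z u, h.mem_domain u⟩) = 0 := by
    refine (Submodule.starProjection_apply_eq_zero_iff _).2 ?_
    rw [Submodule.orthogonal_closure]
    rintro v ⟨⟨y, hy⟩, hy0, rfl⟩
    have hy0' : p.X₀† ⟨y, hy⟩ = 0 := hy0
    have := LinearPMap.adjoint_isFormalAdjoint p.dense_domain ⟨y, hy⟩ ⟨Z u, h.mem_domain u⟩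
    rw [hy0', inner_zero_left] at this
    exact this.symm
  have h3 : p.RP u = p.Pstar (p.X₁ (p.P u)) := rfl
  have h4 : p.X₁ (p.P u) = w - p.X₀ ⟨Z u, h.mem_domain u⟩ := by rw [hw]; abel
  rw [h3, h4, map_sub, h1, h2, sub_zero]

end

/-! Write F = F(t), U = P + tZ, V = A(t)^{1/2}F, V₀ = |t|S^{1/2}P, m = |t|‖X₁‖, θ = mδ^{-1/2} and κ
= ‖X₁‖c_*^{-1/2}. The choice of δ and t⁰ gives θ ≤ 1, and nondegeneracy gives c_* ≤ ‖X₁‖², so κ ≥ 1.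
The estimates use no contour integrals: they rest on orthogonality in the form ‖X(t)u‖² and on
algebraic identities between bounded operators.

Spectral theory. The measure behind F and V is defined by a choice, so the spectral theorem for T^*T
is proved first. The resolvent (1 + T^*T)⁻¹ is the compression to H of the projection onto the graph
of T (`exists_gram_resolvent`). Its spectral measure comes from the continuous functional calculus,
the Riesz–Markov theorem and monotone classes, and is pushed forward by b ↦ b⁻¹ - 1. The fact used
afterwards is `exists_decomp`: X(t)Fv and X(t)(1 - F)v are orthogonal, the first has norm ‖Vv‖, and
the second is at least √δ‖(1 - F)v‖.

Threshold expansion. For v = Pu this gives (1 - F)P = O(θ), and with the gap F - P = O(θ). For v =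
Uu the image is tRPu + t²X₁Zu, and Ran R is orthogonal to Ran X₀; hence (1 - F)U = O(θ²) and F =
UU^* + O(θ²). The compression U^*V²U equals t²SP + t³N up to O(m²θ²), because the cross term of
‖tRPu + t²X₁Zu‖² is the quadratic form of N. Therefore V² = V₀² + t³N + tZV₀² + V₀²(tZ)^* + O(m²θ²).

Square roots. Both V on Ran F and V₀ on 𝔑 are at least a = c_*^{1/2}|t|, so a solution of VX + XV₀ =
Y satisfies 2a‖X‖ ≤ ‖Y‖ (`norm_le_of_sylvester`). Applied to F(V - V₀)P and then to F(V - L)P, with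
L = V₀ + tZV₀ + V₀(tZ)^* + g, it gives V = L + O(mθ²κ³) (`norm_sqrt_sub_sub_le`). Here g = t|t|Y,
where √S Y + Y√S = N; the solution is Y = ½N₀S^{-1/2} + ∑_{j≠l}(√γ_j + √γ_l)⁻¹P_jNP_l. The integral
𝓘_* is an elementary integral on each block P_jNP_l and produces exactly this kernel, so L is
|t|S^{1/2}P + t|t|G. The error is the β₁₁ term of C₁₀.

Branches. F(t) and A(t)F(t) are sums of rank-one operators built from the branches. Comparing their
first-order expansions (after division by t² for the second) with the threshold expansions gives
∑(ω_l ⊗ ω̃_l + ω̃_l ⊗ ω_l) = 0 and N = ∑μ_l ω_l ⊗ ω_l + ∑γ_l(ω_l ⊗ ω̃_l + ω̃_l ⊗ ω_l). On one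
eigenspace of S the factor γ_l is constant, so the second sum has no diagonal blocks.

Cosines. If N₀ = 0, then M = ∑_{j≠l}(γ_j - γ_l)⁻¹P_jNP_l satisfies √S M - M√S = Y. Hence J = F(P -
tM) intertwines V and V₀ up to O(|t|³), while P - J = O(|t|) (`norm_intertwining_le`). Duhamel's
formula makes the cosines differ by O(|t| + |τ|ε⁻¹|t|³), and the smoothing factor turns this, with
the trivial bound 2, into O((1 + |τ|)ε). If N = 0, then M = 0. -/

noncomputable section

set_option linter.unusedSectionVars false
set_option linter.unusedSimpArgs false

/-! ## Weak integrals against families of scalar measures -/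

section QuadFamily

open Filter Topology

variable {H : Type*} [NormedAddCommGroup H] [InnerProductSpace ℂ H] [CompleteSpace H]

/-- The bounded Borel functions on `ℝ`. -/
def BddMeas (f : ℝ → ℝ) : Prop := Measurable f ∧ ∃ C, ∀ x, |f x| ≤ C

namespace BddMeas

theorem add {f g : ℝ → ℝ} (hf : BddMeas f) (hg : BddMeas g) : BddMeas (f + g) := by
  obtain ⟨hf, C, hC⟩ := hf
  obtain ⟨hg, D, hD⟩ := hg
  exact ⟨hf.add hg, C + D, fun x => (abs_add_le _ _).trans (add_le_add (hC x) (hD x))⟩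

theorem mul {f g : ℝ → ℝ} (hf : BddMeas f) (hg : BddMeas g) : BddMeas (f * g) := by
  obtain ⟨hf, C, hC⟩ := hf
  obtain ⟨hg, D, hD⟩ := hg
  refine ⟨hf.mul hg, C * D, fun x => ?_⟩
  rw [Pi.mul_apply, abs_mul]
  exact mul_le_mul (hC x) (hD x) (abs_nonneg _) ((abs_nonneg _).trans (hC x))

theorem const (c : ℝ) : BddMeas (fun _ => c) := ⟨measurable_const, |c|, fun _ => le_rfl⟩

theorem smul {f : ℝ → ℝ} (c : ℝ) (hf : BddMeas f) : BddMeas (c • f) :=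
  (const c).mul hf

theorem indicator {f : ℝ → ℝ} (hf : BddMeas f) {s : Set ℝ} (hs : MeasurableSet s) :
    BddMeas (s.indicator f) := by
  obtain ⟨hf, C, hC⟩ := hf
  refine ⟨hf.indicator hs, C, fun x => ?_⟩
  by_cases hx : x ∈ s
  · simpa [hx] using hC x
  · simpa [hx] using (abs_nonneg _).trans (hC x)

theorem one_indicator {s : Set ℝ} (hs : MeasurableSet s) :
    BddMeas (s.indicator (fun _ => (1 : ℝ))) := (const 1).indicator hs

theorem of_tendsto {f : ℝ → ℝ} {F : ℕ → ℝ → ℝ} {C : ℝ} (hF : ∀ n, Measurable (F n))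
    (hC : ∀ n x, |F n x| ≤ C) (h : ∀ x, Tendsto (fun n => F n x) atTop (𝓝 (f x))) :
    BddMeas f :=
  ⟨measurable_of_tendsto_metrizable hF (tendsto_pi_nhds.2 h), C, fun x =>
    le_of_tendsto (h x).abs (Eventually.of_forall fun n => hC n x)⟩

/-- Monotone class principle: a class of functions containing the indicators of Borel sets, and
stable under linear combinations and bounded pointwise limits, contains all bounded Borel
functions. -/
theorem induction {p : (ℝ → ℝ) → Prop}
    (ind : ∀ s, MeasurableSet s → p (s.indicator fun _ => 1))
    (add : ∀ f g, BddMeas f → BddMeas g → p f → p g → p (f + g))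
    (smul : ∀ (c : ℝ) f, BddMeas f → p f → p (c • f))
    (lim : ∀ (F : ℕ → ℝ → ℝ) f C, (∀ n, Measurable (F n)) → (∀ n x, |F n x| ≤ C) →
      (∀ x, Tendsto (fun n => F n x) atTop (𝓝 (f x))) → (∀ n, p (F n)) → p f)
    {f : ℝ → ℝ} (hf : BddMeas f) : p f := by
  have simple : ∀ g : SimpleFunc ℝ ℝ, BddMeas g ∧ p g := by
    intro g
    induction g using SimpleFunc.induction with
    | const c hs =>
      rename_i s
      have : (SimpleFunc.piecewise s hs (SimpleFunc.const ℝ c) (SimpleFunc.const ℝ 0) : ℝ → ℝ)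
          = c • s.indicator fun _ => 1 := by
        ext x
        by_cases hx : x ∈ s <;> simp [hx]
      rw [this]
      exact ⟨(one_indicator hs).smul c, smul c _ (one_indicator hs) (ind s hs)⟩
    | add _ hf hg =>
      rw [SimpleFunc.coe_add]
      exact ⟨hf.1.add hg.1, add _ _ hf.1 hg.1 hf.2 hg.2⟩
  obtain ⟨hm, C, hC⟩ := hf
  have hsm := hm.stronglyMeasurable
  -- The simple approximants are truncated at C, which makes the convergence bounded.
  exact lim (fun n => hsm.approxBounded C n) f C (fun n => (hsm.approxBounded C n).measurable)
    (fun n x => hsm.norm_approxBounded_le ((abs_nonneg _).trans (hC 0)) n x)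
    (fun x => hsm.tendsto_approxBounded_of_norm_le (hC x)) (fun n => (simple _).2)

/-- Monotone class principle: a class of functions containing the bounded continuous functions, and
stable under linear combinations and bounded pointwise limits, contains all bounded Borel
functions. -/
theorem induction_continuous {p : (ℝ → ℝ) → Prop}
    (cont : ∀ f, Continuous f → BddMeas f → p f)
    (add : ∀ f g, BddMeas f → BddMeas g → p f → p g → p (f + g))
    (smul : ∀ (c : ℝ) f, BddMeas f → p f → p (c • f))
    (lim : ∀ (F : ℕ → ℝ → ℝ) f C, (∀ n, Measurable (F n)) → (∀ n x, |F n x| ≤ C) →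
      (∀ x, Tendsto (fun n => F n x) atTop (𝓝 (f x))) → (∀ n, p (F n)) → p f)
    {f : ℝ → ℝ} (hf : BddMeas f) : p f := by
  have h1 : p (fun _ => 1) := cont _ continuous_const (const 1)
  -- Only indicators remain. Closed sets are a generating π-system, and the indicator of a closed
  -- set is the bounded limit of its continuous thickened indicators.
  refine induction (fun s hs => ?_) add smul lim hf
  induction s, hs using MeasurableSpace.induction_on_inter
    (BorelSpace.measurable_eq.trans (borel_eq_generateFrom_isClosed (α := ℝ))) (isPiSystem_isClosed (α := ℝ)) with
  | empty =>
    have := smul 0 _ (const 1) h1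
    convert this using 1
    ext x; simp
  | basic s hs =>
    have hs : IsClosed s := hs
    have hpos : ∀ n : ℕ, (0 : ℝ) < 1 / ((n : ℝ) + 1) := fun n => Nat.one_div_pos_of_nat
    have hb : ∀ n x, |((thickenedIndicator (hpos n) s x : NNReal) : ℝ)| ≤ 1 := fun n x => by
      rw [NNReal.abs_eq]
      exact_mod_cast thickenedIndicator_le_one (hpos n) s x
    have hc : ∀ n, Continuous fun x => ((thickenedIndicator (hpos n) s x : NNReal) : ℝ) :=
      fun n => by fun_prop
    refine lim (fun n x => (thickenedIndicator (hpos n) s x : ℝ)) _ 1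
      (fun n => (hc n).measurable) hb (fun x => ?_)
      (fun n => cont _ (hc n) ⟨(hc n).measurable, 1, hb n⟩)
    have := tendsto_pi_nhds.1 (thickenedIndicator_tendsto_indicator_closure hpos
      tendsto_one_div_add_atTop_nhds_zero_nat s) x
    have := (NNReal.continuous_coe.tendsto _).comp this
    rw [hs.closure_eq] at this
    have e : ((s.indicator (fun _ => (1 : NNReal)) x : NNReal) : ℝ)
        = s.indicator (fun _ => (1 : ℝ)) x := by
      by_cases hx : x ∈ s <;> simp [hx]
    rwa [e] at this
  | compl t ht hp =>
    have := add _ _ (const 1) ((one_indicator ht).smul (-1)) h1 (smul (-1) _ (one_indicator ht) hp)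
    convert this using 1
    ext x
    by_cases hx : x ∈ t <;> simp [hx]
  | iUnion s hd hs hp =>
    have hsum : ∀ n, BddMeas (∑ i ∈ Finset.range n, (s i).indicator fun _ => (1 : ℝ)) ∧
        p (∑ i ∈ Finset.range n, (s i).indicator fun _ => (1 : ℝ)) := by
      intro n
      induction n with
      | zero =>
        have := smul 0 _ (const 1) h1
        have h0 : ((0 : ℝ) • fun _ : ℝ => (1 : ℝ)) = 0 := by ext; simp
        rw [Finset.sum_range_zero, ← h0]
        exact ⟨(const 1).smul 0, this⟩
      | succ n ih =>
        rw [Finset.sum_range_succ]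
        exact ⟨ih.1.add (one_indicator (hs n)), add _ _ ih.1 (one_indicator (hs n)) ih.2 (hp n)⟩
    have key : ∀ n, (∑ i ∈ Finset.range n, (s i).indicator fun _ => (1 : ℝ)) =
        (⋃ i ∈ Finset.range n, s i).indicator fun _ => (1 : ℝ) := by
      intro n
      ext x
      rw [Finset.indicator_biUnion _ _ (fun i _ j _ hij => hd hij), Finset.sum_apply]
    refine lim (fun n => ∑ i ∈ Finset.range n, (s i).indicator fun _ => (1 : ℝ)) _ 1
      (fun n => (hsum n).1.1) (fun n x => ?_) (fun x => ?_) (fun n => (hsum n).2)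
    · simp only [key]
      rcases Set.indicator_eq_zero_or_self (⋃ i ∈ Finset.range n, s i) (fun _ => (1 : ℝ)) x
        with h | h <;> rw [h] <;> norm_num
    · simp only [key]
      by_cases hx : x ∈ ⋃ i, s i
      · obtain ⟨i, hi⟩ := Set.mem_iUnion.1 hx
        refine tendsto_const_nhds.congr' ?_
        filter_upwards [eventually_gt_atTop i] with n hn
        rw [Set.indicator_of_mem hx, Set.indicator_of_mem]
        exact Set.mem_biUnion (Finset.mem_coe.2 (Finset.mem_range.2 hn)) hi
      · refine tendsto_const_nhds.congr' (Eventually.of_forall fun n => ?_)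
        change _ = (⋃ i ∈ Finset.range n, s i).indicator (fun _ => (1 : ℝ)) x
        rw [Set.indicator_of_notMem hx, Set.indicator_of_notMem]
        intro h
        simp only [Set.mem_iUnion] at h hx
        obtain ⟨i, _, hi⟩ := h
        exact hx ⟨i, hi⟩

end BddMeas

/-- Families of finite measures `μ u` on `ℝ`, of mass `‖u‖²`. -/
structure QuadFamily (μ : H → Measure ℝ) : Prop where
  finite : ∀ u, IsFiniteMeasure (μ u)
  mass : ∀ u, (μ u).real Set.univ = ‖u‖ ^ 2

/-- `T = ∫ f dμ` in the weak sense. -/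
def WeakIntegral (μ : H → Measure ℝ) (f : ℝ → ℝ) (T : H →L[ℂ] H) : Prop :=
  ∀ u, ⟪u, T u⟫_ℂ = ((∫ x, f x ∂(μ u) : ℝ) : ℂ)

theorem ContinuousLinearMap.ext_inner_self {S T : H →L[ℂ] H}
    (h : ∀ u, ⟪u, S u⟫_ℂ = ⟪u, T u⟫_ℂ) : S = T := by
  have : (S : H →ₗ[ℂ] H) = T := (ext_inner_map _ _).1 fun u => by
    have := congrArg (starRingEnd ℂ) (h u)
    rwa [inner_conj_symm, inner_conj_symm] at this
  exact ContinuousLinearMap.coe_injective this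

theorem inner_polarization_right (T : H →L[ℂ] H) (u v : H) :
    ⟪u, T v⟫_ℂ = (⟪u + v, T (u + v)⟫_ℂ - ⟪u - v, T (u - v)⟫_ℂ
      - Complex.I * ⟪u + Complex.I • v, T (u + Complex.I • v)⟫_ℂ
      + Complex.I * ⟪u - Complex.I • v, T (u - Complex.I • v)⟫_ℂ) / 4 := by
  simp only [map_add, map_sub, inner_add_left, inner_add_right, map_smul, inner_smul_left,
    inner_smul_right, Complex.conj_I, inner_sub_left, inner_sub_right]
  linear_combination (1 / 2 * ⟪u, T v⟫_ℂ - 1 / 2 * ⟪v, T u⟫_ℂ) * Complex.I_sq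

theorem isSelfAdjoint_of_inner_real {T : H →L[ℂ] H} (h : ∀ u, ∃ r : ℝ, ⟪u, T u⟫_ℂ = r) :
    IsSelfAdjoint T := by
  rw [ContinuousLinearMap.isSelfAdjoint_iff']
  refine ContinuousLinearMap.ext_inner_self fun u => ?_
  obtain ⟨r, hr⟩ := h u
  rw [ContinuousLinearMap.adjoint_inner_right, ← inner_conj_symm, hr, Complex.conj_ofReal]

/-- The norm of a selfadjoint operator is bounded by a bound on its quadratic form. -/
theorem IsSelfAdjoint.norm_le_of_inner {T : H →L[ℂ] H} (hT : IsSelfAdjoint T) {C : ℝ}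
    (hC : 0 ≤ C) (h : ∀ u, ‖⟪u, T u⟫_ℂ‖ ≤ C * ‖u‖ ^ 2) : ‖T‖ ≤ C := by
  rw [ContinuousLinearMap.norm_eq_iSup_rayleighQuotient T hT.isSymmetric]
  refine ciSup_le fun u => ?_
  by_cases hu : u = 0
  · simpa [hu] using hC
  · rw [ContinuousLinearMap.rayleighQuotient, ContinuousLinearMap.reApplyInnerSelf_apply, abs_div,
      abs_sq, div_le_iff₀ (by positivity)]
    refine (Complex.abs_re_le_norm _).trans ?_
    rw [norm_inner_symm]
    exact h u

namespace WeakIntegral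

variable {μ : H → Measure ℝ}

theorem unique {f : ℝ → ℝ} {S T : H →L[ℂ] H} (hS : WeakIntegral μ f S)
    (hT : WeakIntegral μ f T) : S = T :=
  ContinuousLinearMap.ext_inner_self fun u => (hS u).trans (hT u).symm

theorem isSelfAdjoint {f : ℝ → ℝ} {T : H →L[ℂ] H} (hT : WeakIntegral μ f T) : IsSelfAdjoint T :=
  isSelfAdjoint_of_inner_real fun u => ⟨_, hT u⟩

theorem smul {f : ℝ → ℝ} {T : H →L[ℂ] H} (c : ℝ) (hT : WeakIntegral μ f T) :
    WeakIntegral μ (c • f) ((c : ℂ) • T) := by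
  intro u
  simp [hT u, integral_const_mul]

end WeakIntegral

/-! ### Weak limits, existence and multiplicativity of weak integrals. -/

namespace QuadFamily

variable {μ : H → Measure ℝ}

theorem integrable (hμ : QuadFamily μ) {f : ℝ → ℝ} (hf : BddMeas f) (u : H) :
    Integrable f (μ u) := by
  have := hμ.finite u
  obtain ⟨hm, C, hC⟩ := hf
  exact Integrable.of_bound hm.aestronglyMeasurable C (Eventually.of_forall fun x => hC x)

theorem abs_integral_le (hμ : QuadFamily μ) {f : ℝ → ℝ} {C : ℝ} (hC : ∀ x, |f x| ≤ C)
    (u : H) : |∫ x, f x ∂(μ u)| ≤ C * ‖u‖ ^ 2 := by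
  have := hμ.finite u
  rw [← hμ.mass]
  have := norm_integral_le_of_norm_le_const (μ := μ u) (f := f)
    (Eventually.of_forall fun x => (hC x : ‖f x‖ ≤ C))
  exact this

theorem add (hμ : QuadFamily μ) {f g : ℝ → ℝ} (hf : BddMeas f) (hg : BddMeas g)
    {S T : H →L[ℂ] H} (hS : WeakIntegral μ f S) (hT : WeakIntegral μ g T) :
    WeakIntegral μ (f + g) (S + T) := by
  intro u
  simp only [add_apply, inner_add_right, hS u, hT u, Pi.add_apply]
  rw [integral_add (hμ.integrable hf u) (hμ.integrable hg u)]
  push_cast; rfl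

theorem norm_le (hμ : QuadFamily μ) {f : ℝ → ℝ} {C : ℝ} (hC : ∀ x, |f x| ≤ C)
    {T : H →L[ℂ] H} (hT : WeakIntegral μ f T) : ‖T‖ ≤ C :=
  hT.isSelfAdjoint.norm_le_of_inner ((abs_nonneg _).trans (hC 0)) fun u => by
    rw [hT u, Complex.norm_real]
    exact hμ.abs_integral_le hC u

theorem tendsto_integral (hμ : QuadFamily μ) {f : ℝ → ℝ} {F : ℕ → ℝ → ℝ} {C : ℝ}
    (hF : ∀ n, Measurable (F n)) (hC : ∀ n x, |F n x| ≤ C)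
    (h : ∀ x, Tendsto (fun n => F n x) atTop (𝓝 (f x))) (u : H) :
    Tendsto (fun n => ∫ x, F n x ∂(μ u)) atTop (𝓝 (∫ x, f x ∂(μ u))) := by
  have := hμ.finite u
  exact tendsto_integral_of_dominated_convergence (fun _ => C)
    (fun n => (hF n).aestronglyMeasurable) (integrable_const C)
    (fun n => Eventually.of_forall (hC n)) (Eventually.of_forall h)

/-- Weak integrals are stable under bounded pointwise limits. -/
theorem exists_limit (hμ : QuadFamily μ) {f : ℝ → ℝ} {F : ℕ → ℝ → ℝ} {C : ℝ}
    (hF : ∀ n, Measurable (F n)) (hC : ∀ n x, |F n x| ≤ C)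
    (h : ∀ x, Tendsto (fun n => F n x) atTop (𝓝 (f x))) {T : ℕ → H →L[ℂ] H}
    (hT : ∀ n, WeakIntegral μ (F n) (T n)) : ∃ S, WeakIntegral μ f S := by
  -- Dominated convergence gives the limits of the quadratic forms; polarization turns them into a
  -- sesquilinear form, which is bounded and hence represented by an operator.
  have hq : ∀ u, Tendsto (fun n => ⟪u, T n u⟫_ℂ) atTop (𝓝 ((∫ x, f x ∂(μ u) : ℝ) : ℂ)) := by
    intro u
    simp only [hT _ u]
    exact (Complex.continuous_ofReal.tendsto _).comp (hμ.tendsto_integral hF hC h u)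
  have hex : ∀ u v, ∃ l, Tendsto (fun n => ⟪T n u, v⟫_ℂ) atTop (𝓝 l) := by
    intro u v
    have hs : ∀ n, ⟪T n u, v⟫_ℂ = ⟪u, T n v⟫_ℂ := fun n =>
      (hT n).isSelfAdjoint.isSymmetric u v
    simp only [hs, fun n => inner_polarization_right (T n) u v]
    exact ⟨_, ((((hq _).sub (hq _)).sub ((hq _).const_mul _)).add ((hq _).const_mul _)).div_const _⟩
  choose b hb using hex
  have hbound : ∀ u v, ‖b u v‖ ≤ C * ‖u‖ * ‖v‖ := by
    intro u v
    refine le_of_tendsto (hb u v).norm (Eventually.of_forall fun n => ?_)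
    refine (norm_inner_le_norm _ _).trans (mul_le_mul_of_nonneg_right ?_ (norm_nonneg _))
    exact (T n).le_of_opNorm_le (hμ.norm_le (hC n) (hT n)) u
  let L : H →ₗ⋆[ℂ] H →ₗ[ℂ] ℂ := LinearMap.mk₂'ₛₗ (starRingEnd ℂ) (RingHom.id ℂ) b
    (fun u u' v => tendsto_nhds_unique (hb _ _) (by
      simpa only [map_add, inner_add_left] using (hb u v).add (hb u' v)))
    (fun c u v => tendsto_nhds_unique (hb _ _) (by
      simpa only [map_smul, inner_smul_left, smul_eq_mul] using
        (hb u v).const_mul (starRingEnd ℂ c)))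
    (fun u v v' => tendsto_nhds_unique (hb _ _) (by
      simpa only [inner_add_right] using (hb u v).add (hb u v')))
    (fun c u v => tendsto_nhds_unique (hb _ _) (by
      simpa only [inner_smul_right, smul_eq_mul, RingHom.id_apply] using (hb u v).const_mul c))
  refine ⟨InnerProductSpace.continuousLinearMapOfBilin (L.mkContinuous₂ C hbound), fun u => ?_⟩
  rw [← inner_conj_symm, InnerProductSpace.continuousLinearMapOfBilin_apply]
  have h1 : b u u = ((∫ x, f x ∂(μ u) : ℝ) : ℂ) := by
    refine tendsto_nhds_unique (hb u u) ((hq u).congr fun n => ?_)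
    exact ((hT n).isSelfAdjoint.isSymmetric u u).symm
  change starRingEnd ℂ (b u u) = _
  rw [h1, Complex.conj_ofReal]

theorem tendsto_inner (hμ : QuadFamily μ) {f : ℝ → ℝ} {F : ℕ → ℝ → ℝ} {C : ℝ}
    (hF : ∀ n, Measurable (F n)) (hC : ∀ n x, |F n x| ≤ C)
    (h : ∀ x, Tendsto (fun n => F n x) atTop (𝓝 (f x))) {T : ℕ → H →L[ℂ] H} {S : H →L[ℂ] H}
    (hT : ∀ n, WeakIntegral μ (F n) (T n)) (hS : WeakIntegral μ f S) (u v : H) :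
    Tendsto (fun n => ⟪u, T n v⟫_ℂ) atTop (𝓝 ⟪u, S v⟫_ℂ) := by
  have hq : ∀ u, Tendsto (fun n => ⟪u, T n u⟫_ℂ) atTop (𝓝 ⟪u, S u⟫_ℂ) := by
    intro u
    simp only [hT _ u, hS u]
    exact (Complex.continuous_ofReal.tendsto _).comp (hμ.tendsto_integral hF hC h u)
  simp only [fun n => inner_polarization_right (T n) u v]
  rw [inner_polarization_right S u v]
  exact ((((hq _).sub (hq _)).sub ((hq _).const_mul _)).add ((hq _).const_mul _)).div_const _

theorem exists_of_indicator (hμ : QuadFamily μ)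
    (hi : ∀ s, MeasurableSet s → ∃ T, WeakIntegral μ (s.indicator fun _ => 1) T)
    {f : ℝ → ℝ} (hf : BddMeas f) : ∃ T, WeakIntegral μ f T := by
  refine BddMeas.induction (p := fun f => ∃ T, WeakIntegral μ f T) hi ?_ ?_ ?_ hf
  · rintro f g hf hg ⟨S, hS⟩ ⟨T, hT⟩
    exact ⟨_, hμ.add hf hg hS hT⟩
  · rintro c f hf ⟨S, hS⟩
    exact ⟨_, hS.smul c⟩
  · intro F f C hF hC h hp
    choose T hT using hp
    exact hμ.exists_limit hF hC h hT

theorem exists_of_continuous (hμ : QuadFamily μ)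
    (hi : ∀ f, Continuous f → BddMeas f → ∃ T, WeakIntegral μ f T)
    {f : ℝ → ℝ} (hf : BddMeas f) : ∃ T, WeakIntegral μ f T := by
  refine BddMeas.induction_continuous (p := fun f => ∃ T, WeakIntegral μ f T) hi ?_ ?_ ?_ hf
  · rintro f g hf hg ⟨S, hS⟩ ⟨T, hT⟩
    exact ⟨_, hμ.add hf hg hS hT⟩
  · rintro c f hf ⟨S, hS⟩
    exact ⟨_, hS.smul c⟩
  · intro F f C hF hC h hp
    choose T hT using hp
    exact hμ.exists_limit hF hC h hT

/-- Multiplicativity in one factor is stable under the operations of the monotone class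
principle. -/
theorem mul_limit (hμ : QuadFamily μ) {g : ℝ → ℝ} (hg : BddMeas g)
    {Φ : (ℝ → ℝ) → H →L[ℂ] H} (hΦ : ∀ f, BddMeas f → WeakIntegral μ f (Φ f)) :
    (∀ f₁ f₂, BddMeas f₁ → BddMeas f₂ → Φ (g * f₁) = Φ g * Φ f₁ → Φ (g * f₂) = Φ g * Φ f₂ →
      Φ (g * (f₁ + f₂)) = Φ g * Φ (f₁ + f₂)) ∧
    (∀ (c : ℝ) f, BddMeas f → Φ (g * f) = Φ g * Φ f → Φ (g * (c • f)) = Φ g * Φ (c • f)) ∧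
    (∀ (F : ℕ → ℝ → ℝ) f C, (∀ n, Measurable (F n)) → (∀ n x, |F n x| ≤ C) →
      (∀ x, Tendsto (fun n => F n x) atTop (𝓝 (f x))) → (∀ n, Φ (g * F n) = Φ g * Φ (F n)) →
      Φ (g * f) = Φ g * Φ f) := by
  refine ⟨fun f₁ f₂ h₁ h₂ e₁ e₂ => ?_, fun c f hf e => ?_, fun F f C hF hC h e => ?_⟩
  · have a := (hμ.add (hg.mul h₁) (hg.mul h₂) (hΦ _ (hg.mul h₁)) (hΦ _ (hg.mul h₂)))
    rw [← mul_add] at a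
    rw [(hΦ _ (hg.mul (h₁.add h₂))).unique a,
      (hΦ _ (h₁.add h₂)).unique (hμ.add h₁ h₂ (hΦ _ h₁) (hΦ _ h₂)), e₁, e₂, mul_add]
  · have a := (hΦ _ (hg.mul hf)).smul c
    rw [← mul_smul_comm] at a
    rw [(hΦ _ (hg.mul (hf.smul c))).unique a, (hΦ _ (hf.smul c)).unique ((hΦ _ hf).smul c), e,
      mul_smul_comm]
  · have hf := BddMeas.of_tendsto hF hC h
    obtain ⟨hgm, D, hD⟩ := id hg
    have hFb : ∀ n, BddMeas (F n) := fun n => ⟨hF n, C, hC n⟩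
    ext v
    refine ext_inner_left ℂ fun u => ?_
    have t1 := hμ.tendsto_inner (F := fun n => g * F n) (C := D * C) (fun n => hgm.mul (hF n))
      (fun n x => by
        rw [Pi.mul_apply, abs_mul]
        exact mul_le_mul (hD x) (hC n x) (abs_nonneg _) ((abs_nonneg _).trans (hD x)))
      (fun x => (h x).const_mul (g x)) (fun n => hΦ _ (hg.mul (hFb n))) (hΦ _ (hg.mul hf)) u v
    have t2 := hμ.tendsto_inner hF hC h (fun n => hΦ _ (hFb n)) (hΦ _ hf) (Φ g u) v
    refine tendsto_nhds_unique t1 ?_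
    have hs := (hΦ g hg).isSelfAdjoint.isSymmetric
    -- Only weak convergence is available, so the fixed selfadjoint factor is moved to the left
    -- argument before passing to the limit.
    have e1 : ⟪u, (Φ g * Φ f) v⟫_ℂ = ⟪Φ g u, Φ f v⟫_ℂ := (hs u (Φ f v)).symm
    rw [e1]
    refine t2.congr fun n => ?_
    rw [e n]
    exact hs u (Φ (F n) v)

end QuadFamily

end QuadFamily

theorem inner_self_eq_ofReal {H : Type*} [NormedAddCommGroup H] [InnerProductSpace ℂ H] (u : H) :
    ⟪u, u⟫_ℂ = ((‖u‖ ^ 2 : ℝ) : ℂ) := by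
  rw [inner_self_eq_norm_sq_to_K]
  push_cast
  rfl

/-! ## Bounded Borel functional calculus of a resolution of the identity -/

namespace ProjMeasure

open Filter Topology

variable {H : Type*} [NormedAddCommGroup H] [InnerProductSpace ℂ H] [CompleteSpace H]
variable (e : ProjMeasure H)

theorem scalarMeasure_apply {s : Set ℝ} (hs : MeasurableSet s) (u : H) :
    e.scalarMeasure u s = ENNReal.ofReal (‖e.E s u‖ ^ 2) :=
  Measure.ofMeasurable_apply s hs

theorem scalarMeasure_real {s : Set ℝ} (hs : MeasurableSet s) (u : H) :
    (e.scalarMeasure u).real s = ‖e.E s u‖ ^ 2 := by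
  rw [measureReal_def, e.scalarMeasure_apply hs, ENNReal.toReal_ofReal (by positivity)]

theorem quadFamily : QuadFamily e.scalarMeasure where
  finite u := ⟨by rw [e.scalarMeasure_apply .univ]; exact ENNReal.ofReal_lt_top⟩
  mass u := by rw [e.scalarMeasure_real .univ, e.univ]; rfl

instance (u : H) : IsFiniteMeasure (e.scalarMeasure u) := e.quadFamily.finite u

theorem weakIntegral_indicator {s : Set ℝ} (hs : MeasurableSet s) :
    WeakIntegral e.scalarMeasure (s.indicator fun _ => 1) (e.E s) := by
  intro u
  rw [e.inner_E hs, integral_indicator_const _ hs, e.scalarMeasure_real hs]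
  simp

theorem weakIntegral_integral {f : ℝ → ℝ} (hf : BddMeas f) :
    WeakIntegral e.scalarMeasure f (e.integral f) := by
  obtain ⟨T, hT⟩ := e.quadFamily.exists_of_indicator (fun s hs => ⟨_, e.weakIntegral_indicator hs⟩) hf
  have h : ∃ T, e.IsIntegral f T := ⟨T, fun u => ⟨e.quadFamily.integrable hf u, hT u⟩⟩
  intro u
  rw [integral, dif_pos h]
  exact (h.choose_spec u).2

theorem integral_eq {f : ℝ → ℝ} (hf : BddMeas f) {T : H →L[ℂ] H}
    (hT : WeakIntegral e.scalarMeasure f T) : e.integral f = T :=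
  (e.weakIntegral_integral hf).unique hT

theorem integral_indicator_one {s : Set ℝ} (hs : MeasurableSet s) :
    e.integral (s.indicator fun _ => 1) = e.E s :=
  e.integral_eq (.one_indicator hs) (e.weakIntegral_indicator hs)

theorem integral_one : e.integral (fun _ => 1) = 1 := by
  rw [← e.univ, ← e.integral_indicator_one .univ, Set.indicator_univ]

theorem isSelfAdjoint_integral {f : ℝ → ℝ} (hf : BddMeas f) : IsSelfAdjoint (e.integral f) :=
  (e.weakIntegral_integral hf).isSelfAdjoint

theorem integral_add {f g : ℝ → ℝ} (hf : BddMeas f) (hg : BddMeas g) :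
    e.integral (f + g) = e.integral f + e.integral g :=
  e.integral_eq (hf.add hg)
    (e.quadFamily.add hf hg (e.weakIntegral_integral hf) (e.weakIntegral_integral hg))

theorem integral_smul {f : ℝ → ℝ} (hf : BddMeas f) (c : ℝ) :
    e.integral (c • f) = (c : ℂ) • e.integral f :=
  e.integral_eq (hf.smul c) ((e.weakIntegral_integral hf).smul c)

theorem norm_integral_le {f : ℝ → ℝ} (hf : BddMeas f) {C : ℝ} (hC : ∀ x, |f x| ≤ C) :
    ‖e.integral f‖ ≤ C :=
  e.quadFamily.norm_le hC (e.weakIntegral_integral hf)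

/-- Indicators multiply because E(s ∩ t) = E(s)E(t). The monotone class principle extends this in
one factor at a time, and adjoints exchange the factors. -/
theorem integral_mul {f g : ℝ → ℝ} (hf : BddMeas f) (hg : BddMeas g) :
    e.integral (f * g) = e.integral f * e.integral g := by
  have h1 : ∀ s, MeasurableSet s → ∀ f, BddMeas f →
      e.integral ((s.indicator fun _ => 1) * f)
        = e.integral (s.indicator fun _ => 1) * e.integral f := by
    intro s hs f hf
    obtain ⟨h1, h2, h3⟩ := e.quadFamily.mul_limit (BddMeas.one_indicator hs)
      (fun f hf => e.weakIntegral_integral hf)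
    refine BddMeas.induction (p := fun f => e.integral ((s.indicator fun _ => 1) * f)
        = e.integral (s.indicator fun _ => 1) * e.integral f) (fun t ht => ?_) h1 h2 h3 hf
    have : ((s.indicator fun _ => 1) * (t.indicator fun _ => 1) : ℝ → ℝ)
        = (s ∩ t).indicator fun _ => 1 := by
      ext x
      by_cases hx : x ∈ s <;> by_cases hy : x ∈ t <;> simp [hx, hy]
    rw [this, e.integral_indicator_one (hs.inter ht), e.integral_indicator_one hs,
      e.integral_indicator_one ht, e.inter s t hs ht]
  obtain ⟨h2, h3, h4⟩ := e.quadFamily.mul_limit hf (fun f hf => e.weakIntegral_integral hf)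
  refine BddMeas.induction (p := fun g => e.integral (f * g) = e.integral f * e.integral g)
    (fun t ht => ?_) h2 h3 h4 hg
  have a := congrArg star (h1 t ht f hf)
  rw [star_mul, (e.isSelfAdjoint_integral hf).star_eq,
    (e.isSelfAdjoint_integral (.one_indicator ht)).star_eq,
    (e.isSelfAdjoint_integral ((BddMeas.one_indicator ht).mul hf)).star_eq, mul_comm _ f] at a
  exact a

theorem integral_indicator_mul {f : ℝ → ℝ} (hf : BddMeas f) {s : Set ℝ} (hs : MeasurableSet s) :
    e.integral (s.indicator f) = e.integral f * e.E s := by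
  rw [← e.integral_indicator_one hs, ← e.integral_mul hf (.one_indicator hs)]
  congr 1
  ext x
  by_cases hx : x ∈ s <;> simp [hx]

theorem E_commute {f : ℝ → ℝ} (hf : BddMeas f) {s : Set ℝ} (hs : MeasurableSet s) :
    e.E s * e.integral f = e.integral f * e.E s := by
  rw [← e.integral_indicator_one hs, ← e.integral_mul hf (.one_indicator hs),
    ← e.integral_mul (.one_indicator hs) hf, mul_comm]

theorem norm_integral_apply_sq {f : ℝ → ℝ} (hf : BddMeas f) (u : H) :
    ‖e.integral f u‖ ^ 2 = ∫ x, f x ^ 2 ∂(e.scalarMeasure u) := by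
  have h := e.weakIntegral_integral (hf.mul hf) u
  rw [e.integral_mul hf hf] at h
  have h2 : ⟪u, (e.integral f * e.integral f) u⟫_ℂ = ⟪e.integral f u, e.integral f u⟫_ℂ :=
    ((e.isSelfAdjoint_integral hf).isSymmetric u (e.integral f u)).symm
  rw [h2, inner_self_eq_ofReal] at h
  have h3 : ‖e.integral f u‖ ^ 2 = ∫ x, (f * f) x ∂(e.scalarMeasure u) :=
    Complex.ofReal_injective h
  rw [h3]
  simp only [Pi.mul_apply, sq]

theorem E_mul_E {s t : Set ℝ} (hs : MeasurableSet s) (ht : MeasurableSet t) (u : H) :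
    e.E s (e.E t u) = e.E (s ∩ t) u := by
  rw [e.inter s t hs ht]; rfl

theorem isSelfAdjoint_E (s : Set ℝ) : IsSelfAdjoint (e.E s) := by
  by_cases hs : MeasurableSet s
  · exact (e.isStarProjection s hs).isSelfAdjoint
  · rw [e.not_measurable s hs]; exact IsSelfAdjoint.zero _

theorem E_union {s t : Set ℝ} (hs : MeasurableSet s) (ht : MeasurableSet t) (hd : Disjoint s t) :
    e.E (s ∪ t) = e.E s + e.E t := by
  rw [← e.integral_indicator_one (hs.union ht), ← e.integral_indicator_one hs,
    ← e.integral_indicator_one ht, ← e.integral_add (.one_indicator hs) (.one_indicator ht),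
    Set.indicator_union_of_disjoint hd]
  rfl

theorem E_compl {s : Set ℝ} (hs : MeasurableSet s) : e.E sᶜ = 1 - e.E s := by
  rw [← e.univ, ← Set.union_compl_self s, e.E_union hs hs.compl disjoint_compl_right]
  abel

theorem E_eq_zero_iff {s : Set ℝ} (hs : MeasurableSet s) (u : H) :
    e.E s u = 0 ↔ e.scalarMeasure u s = 0 := by
  rw [e.scalarMeasure_apply hs, ENNReal.ofReal_eq_zero]
  constructor
  · intro h; simp [h]
  · intro h
    have := le_antisymm h (by positivity)
    simpa using this

theorem scalarMeasure_E {s : Set ℝ} (hs : MeasurableSet s) (u : H) :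
    e.scalarMeasure (e.E s u) = (e.scalarMeasure u).restrict s := by
  ext t ht
  rw [Measure.restrict_apply ht, e.scalarMeasure_apply ht, e.scalarMeasure_apply (ht.inter hs),
    e.E_mul_E ht hs]

theorem tendsto_E_Icc (u : H) : Tendsto (fun n : ℕ => e.E (Set.Icc (-(n : ℝ)) n) u) atTop (𝓝 u) := by
  rw [tendsto_iff_norm_sub_tendsto_zero]
  have h1 : ∀ n : ℕ, ‖e.E (Set.Icc (-(n : ℝ)) n) u - u‖
      = √((e.scalarMeasure u).real (Set.Icc (-(n : ℝ)) n)ᶜ) := by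
    intro n
    rw [e.scalarMeasure_real measurableSet_Icc.compl, Real.sqrt_sq (norm_nonneg _),
      e.E_compl measurableSet_Icc, norm_sub_rev]
    rfl
  simp only [h1]
  have h2 : Tendsto (fun n : ℕ => (e.scalarMeasure u).real (Set.Icc (-(n : ℝ)) n)ᶜ) atTop (𝓝 0) := by
    have := tendsto_measure_iInter_atTop (μ := e.scalarMeasure u)
      (s := fun n : ℕ => (Set.Icc (-(n : ℝ)) n)ᶜ)
      (fun n => measurableSet_Icc.compl.nullMeasurableSet)
      (fun m n hmn => Set.compl_subset_compl.2 (Set.Icc_subset_Icc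
        (neg_le_neg (Nat.cast_le.2 hmn)) (Nat.cast_le.2 hmn)))
      ⟨0, measure_ne_top _ _⟩
    have h0 : ⋂ n : ℕ, (Set.Icc (-(n : ℝ)) n)ᶜ = ∅ := by
      rw [← Set.compl_iUnion, Set.compl_empty_iff, Set.eq_univ_iff_forall]
      intro x
      obtain ⟨n, hn⟩ := exists_nat_ge |x|
      exact Set.mem_iUnion.2 ⟨n, abs_le.1 hn⟩
    rw [h0, measure_empty] at this
    exact (ENNReal.tendsto_toReal ENNReal.zero_ne_top).comp this
  have h3 := (Real.continuous_sqrt.tendsto _).comp h2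
  rwa [Real.sqrt_zero] at h3

/-- Continuous functions of `∫ g dE`. -/
theorem integral_comp {g : ℝ → ℝ} (hg : BddMeas g) {h : ℝ → ℝ} (hh : Continuous h) :
    BddMeas (h ∘ g) ∧ e.integral (h ∘ g) = cfc h (e.integral g) := by
  obtain ⟨hgm, C, hC⟩ := id hg
  have hsa := e.isSelfAdjoint_integral hg
  have hmem : ∀ x, g x ∈ Set.Icc (-C) C := fun x => abs_le.1 (hC x)
  have hb : BddMeas (h ∘ g) := by
    obtain ⟨D, hD⟩ := (isCompact_Icc (a := -C) (b := C)).exists_bound_of_continuousOn hh.continuousOn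
    exact ⟨hh.measurable.comp hgm, D, fun x => hD _ (hmem x)⟩
  refine ⟨hb, ?_⟩
  -- Multiplicativity settles polynomials. Weierstrass approximation on [-C, C], which contains the
  -- range of g and the spectrum of ∫ g dE, settles the rest.
  have hpoly : ∀ q : Polynomial ℝ, BddMeas (q.eval ∘ g) ∧
      e.integral (q.eval ∘ g) = Polynomial.aeval (e.integral g) q := by
    intro q
    induction q using Polynomial.induction_on' with
    | add p q hp hq =>
      have : ((p + q).eval ∘ g) = p.eval ∘ g + q.eval ∘ g := by ext x; simp
      rw [this, map_add, e.integral_add hp.1 hq.1, hp.2, hq.2]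
      exact ⟨hp.1.add hq.1, rfl⟩
    | monomial n a =>
      have hpow : BddMeas (g ^ n) ∧ e.integral (g ^ n) = e.integral g ^ n := by
        induction n with
        | zero => rw [pow_zero, pow_zero]; exact ⟨.const 1, e.integral_one⟩
        | succ n ih =>
          rw [pow_succ, pow_succ, e.integral_mul ih.1 hg, ih.2]
          exact ⟨ih.1.mul hg, rfl⟩
      have : ((Polynomial.monomial n a).eval ∘ g) = a • g ^ n := by ext x; simp
      rw [this, e.integral_smul hpow.1, hpow.2]
      refine ⟨hpow.1.smul a, ?_⟩
      rw [Polynomial.aeval_monomial, Algebra.algebraMap_eq_smul_one, smul_mul_assoc, one_mul]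
      exact (RCLike.real_smul_eq_coe_smul (K := ℂ) a _).symm
  have hspec : ∀ x ∈ spectrum ℝ (e.integral g), x ∈ Set.Icc (-C) C := by
    intro x hx
    by_cases hn : Nontrivial H
    · have h1 := spectrum.norm_le_norm_of_mem hx
      exact abs_le.1 (h1.trans (e.norm_integral_le hg hC))
    · rw [not_nontrivial_iff_subsingleton] at hn
      have : Subsingleton (H →L[ℂ] H) := ⟨fun a b => by ext u; exact Subsingleton.elim _ _⟩
      rw [spectrum.of_subsingleton] at hx
      exact hx.elim
  refine eq_of_forall_dist_le fun ε hε => ?_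
  obtain ⟨q, hq⟩ := exists_polynomial_near_of_continuousOn (-C) C h hh.continuousOn (ε / 2)
    (by positivity)
  have h1 : dist (e.integral (h ∘ g)) (e.integral (q.eval ∘ g)) ≤ ε / 2 := by
    have h2 : e.integral (h ∘ g) - e.integral (q.eval ∘ g)
        = e.integral (h ∘ g + (-1 : ℝ) • (q.eval ∘ g)) := by
      rw [e.integral_add hb ((hpoly q).1.smul _), e.integral_smul (hpoly q).1]
      push_cast
      rw [neg_one_smul, sub_eq_add_neg]
    rw [dist_eq_norm, h2]
    refine e.norm_integral_le (hb.add ((hpoly q).1.smul _)) fun x => ?_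
    have := (hq _ (hmem x)).le
    rw [abs_sub_comm] at this
    simpa [sub_eq_add_neg] using this
  have h3 : dist (e.integral (q.eval ∘ g)) (cfc h (e.integral g)) ≤ ε / 2 := by
    rw [(hpoly q).2, ← cfc_polynomial q (e.integral g) hsa, dist_eq_norm,
      ← cfc_sub _ _ (e.integral g) q.continuousOn hh.continuousOn]
    exact norm_cfc_le (by positivity) fun x hx => (hq x (hspec x hx)).le
  calc _ ≤ _ := dist_triangle _ _ _
    _ ≤ ε / 2 + ε / 2 := add_le_add h1 h3
    _ = ε := by ring

end ProjMeasure

/-! ## Existence of the spectral measure of a bounded selfadjoint operator -/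

section BoundedSpectral

open Filter Topology

variable {H : Type*} [NormedAddCommGroup H] [InnerProductSpace ℂ H] [CompleteSpace H]

/-- A multiplicative calculus for a quadratic family of measures is given by a resolution of
the identity. -/
theorem QuadFamily.exists_projMeasure {μ : H → Measure ℝ} (hμ : QuadFamily μ)
    {Φ : (ℝ → ℝ) → H →L[ℂ] H} (hΦ : ∀ f, BddMeas f → WeakIntegral μ f (Φ f))
    (hmul : ∀ f g, BddMeas f → BddMeas g → Φ (f * g) = Φ f * Φ g) :
    ∃ e : ProjMeasure H, ∀ u, e.scalarMeasure u = μ u := by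
  classical
  have hΦi : ∀ s, MeasurableSet s → WeakIntegral μ (s.indicator fun _ => 1)
      (Φ (s.indicator fun _ => 1)) := fun s hs => hΦ _ (.one_indicator hs)
  have hinter : ∀ s t, MeasurableSet s → MeasurableSet t →
      Φ ((s ∩ t).indicator fun _ => 1) = Φ (s.indicator fun _ => 1) * Φ (t.indicator fun _ => 1) := by
    intro s t hs ht
    rw [← hmul _ _ (.one_indicator hs) (.one_indicator ht)]
    congr 1
    ext x
    by_cases hx : x ∈ s <;> by_cases hy : x ∈ t <;> simp [hx, hy]
  have hunion : ∀ s t, MeasurableSet s → MeasurableSet t → Disjoint s t →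
      Φ ((s ∪ t).indicator fun _ => 1) = Φ (s.indicator fun _ => 1) + Φ (t.indicator fun _ => 1) := by
    intro s t hs ht hd
    refine (hΦi _ (hs.union ht)).unique ?_
    rw [Set.indicator_union_of_disjoint hd]
    exact hμ.add (.one_indicator hs) (.one_indicator ht) (hΦi s hs) (hΦi t ht)
  have hempty : Φ ((∅ : Set ℝ).indicator fun _ => 1) = 0 := by
    refine (hΦi _ .empty).unique fun u => ?_
    simp
  have hnorm : ∀ s, MeasurableSet s → ∀ u, ‖Φ (s.indicator fun _ => 1) u‖ ^ 2 = (μ u).real s := by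
    intro s hs u
    have h1 := hΦi s hs u
    have h2 : ⟪u, Φ (s.indicator fun _ => 1) u⟫_ℂ
        = ⟪Φ (s.indicator fun _ => 1) u, Φ (s.indicator fun _ => 1) u⟫_ℂ := by
      conv_lhs => rw [← Set.inter_self s, hinter s s hs hs]
      exact ((hΦi s hs).isSelfAdjoint.isSymmetric u _).symm
    rw [h2, inner_self_eq_ofReal, integral_indicator_const _ hs, smul_eq_mul, mul_one] at h1
    exact Complex.ofReal_injective h1
  let e : ProjMeasure H :=
    { E := fun s => if MeasurableSet s then Φ (s.indicator fun _ => 1) else 0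
      not_measurable := fun s hs => by simp [hs]
      isStarProjection := fun s hs => by
        rw [if_pos hs]
        exact ⟨by rw [IsIdempotentElem, ← hinter s s hs hs, Set.inter_self],
          (hΦi s hs).isSelfAdjoint⟩
      univ := by
        rw [if_pos .univ]
        refine (hΦi _ .univ).unique fun u => ?_
        rw [integral_indicator_const _ .univ, hμ.mass]
        simp [inner_self_eq_norm_sq_to_K]
      inter := fun s t hs ht => by
        rw [if_pos hs, if_pos ht, if_pos (hs.inter ht), hinter s t hs ht]
      hasSum_iUnion := fun s hs hd u => by
        have := hμ.finite u
        simp only [if_pos (hs _), if_pos (MeasurableSet.iUnion hs)]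
        have hfin : ∀ F : Finset ℕ, (∑ i ∈ F, Φ ((s i).indicator fun _ => 1))
            = Φ ((⋃ i ∈ F, s i).indicator fun _ => 1) := by
          intro F
          induction F using Finset.induction_on with
          | empty => simpa using hempty.symm
          | insert a F ha ih =>
            rw [Finset.sum_insert ha, ih, Finset.set_biUnion_insert, hunion _ _ (hs a)
              (Finset.measurableSet_biUnion _ fun i _ => hs i)]
            refine Set.disjoint_iUnion₂_right.2 fun i hi => hd ?_
            rintro rfl
            exact ha hi
        -- The squared defect of a partial sum is the mass of the sets left out, so strong
        -- σ-additivity reduces to σ-additivity of μ u.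
        have hsub : ∀ F : Finset ℕ, ‖∑ i ∈ F, Φ ((s i).indicator fun _ => 1) u
            - Φ ((⋃ i, s i).indicator fun _ => 1) u‖ ^ 2
            = (μ u).real (⋃ i, s i) - ∑ i ∈ F, (μ u).real (s i) := by
          intro F
          have hm : MeasurableSet (⋃ i ∈ F, s i) := Finset.measurableSet_biUnion _ fun i _ => hs i
          have hsubset : (⋃ i ∈ F, s i) ⊆ ⋃ i, s i :=
            Set.iUnion₂_subset fun i _ => Set.subset_iUnion s i
          have h1 := hunion _ _ hm ((MeasurableSet.iUnion hs).diff hm) Set.disjoint_sdiff_right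
          rw [Set.union_sdiff_cancel hsubset] at h1
          rw [← measureReal_biUnion_finset (fun i _ j _ hij => hd hij) (fun i _ => hs i),
            ← measureReal_sdiff hsubset hm, ← hnorm _ ((MeasurableSet.iUnion hs).diff hm), h1,
            ← sum_apply, hfin, norm_sub_rev]
          simp
        have hs2 : HasSum (fun i => (μ u).real (s i)) ((μ u).real (⋃ i, s i)) := by
          rw [measureReal_def, measure_iUnion hd hs, ENNReal.tsum_toReal_eq (fun i => measure_ne_top _ _)]
          refine (ENNReal.summable_toReal ?_).hasSum
          rw [← measure_iUnion hd hs]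
          exact measure_ne_top _ _
        rw [HasSum, SummationFilter.unconditional_filter, tendsto_iff_norm_sub_tendsto_zero]
        rw [HasSum, SummationFilter.unconditional_filter] at hs2
        have h3 := (Real.continuous_sqrt.tendsto _).comp (hs2.const_sub ((μ u).real (⋃ i, s i)))
        rw [sub_self, Real.sqrt_zero] at h3
        refine h3.congr fun F => ?_
        rw [Function.comp_apply, ← hsub F, Real.sqrt_sq (norm_nonneg _)] }
  refine ⟨e, fun u => ?_⟩
  have := hμ.finite u
  ext s hs
  rw [e.scalarMeasure_apply hs]
  have : e.E s = Φ (s.indicator fun _ => 1) := if_pos hs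
  rw [this, hnorm s hs, measureReal_def, ENNReal.ofReal_toReal (measure_ne_top _ _)]

/-- The positive functional `f ↦ (f(T) u, u)`. -/
def spectralFunctional {T : H →L[ℂ] H} (hT : IsSelfAdjoint T) (u : H) :
    CompactlySupportedContinuousMap (spectrum ℝ T) ℝ →ₚ[ℝ] ℝ :=
  PositiveLinearMap.mk₀
    { toFun := fun f => (⟪u, cfcHom hT f.toContinuousMap u⟫_ℂ).re
      map_add' := fun f g => by
        have : (f + g).toContinuousMap = f.toContinuousMap + g.toContinuousMap := rfl
        rw [this, map_add, add_apply, inner_add_right, Complex.add_re]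
      map_smul' := fun c f => by
        have : (c • f).toContinuousMap = c • f.toContinuousMap := rfl
        rw [this, map_smul, smul_apply, RCLike.real_smul_eq_coe_smul (K := ℂ) c,
          inner_smul_right]
        simp }
    (fun f hf => by
      have h1 : 0 ≤ cfcHom hT f.toContinuousMap := (cfcHom_nonneg_iff hT).2 hf
      rw [ContinuousLinearMap.nonneg_iff_isPositive] at h1
      exact h1.re_inner_nonneg_right u)

/-- The scalar spectral measures of a bounded selfadjoint operator. -/
def boundedScalarMeasure {T : H →L[ℂ] H} (hT : IsSelfAdjoint T) (u : H) : Measure ℝ :=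
  (RealRMK.rieszMeasure (spectralFunctional hT u)).map Subtype.val

theorem integral_boundedScalarMeasure {T : H →L[ℂ] H} (hT : IsSelfAdjoint T) (u : H)
    {f : ℝ → ℝ} (hf : Continuous f) :
    ∫ x, f x ∂(boundedScalarMeasure hT u) = (⟪u, cfc f T u⟫_ℂ).re := by
  rw [boundedScalarMeasure, integral_map (by fun_prop) hf.aestronglyMeasurable]
  let g : CompactlySupportedContinuousMap (spectrum ℝ T) ℝ :=
    ⟨⟨fun x => f x, by fun_prop⟩, HasCompactSupport.of_compactSpace _⟩
  have := RealRMK.integral_rieszMeasure (spectralFunctional hT u) g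
  refine this.trans ?_
  rw [cfc_apply f T hT hf.continuousOn]
  rfl

theorem weakIntegral_boundedScalarMeasure {T : H →L[ℂ] H} (hT : IsSelfAdjoint T)
    {f : ℝ → ℝ} (hf : Continuous f) : WeakIntegral (boundedScalarMeasure hT) f (cfc f T) := by
  intro u
  rw [integral_boundedScalarMeasure hT u hf]
  have hsa : IsSelfAdjoint (cfc f T) := cfc_predicate f T
  refine (Complex.conj_eq_iff_re.1 ?_).symm
  rw [inner_conj_symm]
  exact hsa.isSymmetric u u

theorem quadFamily_boundedScalarMeasure {T : H →L[ℂ] H} (hT : IsSelfAdjoint T) :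
    QuadFamily (boundedScalarMeasure hT) where
  finite u := by unfold boundedScalarMeasure; infer_instance
  mass u := by
    have h := integral_boundedScalarMeasure hT u (f := fun _ => 1) continuous_const
    rw [cfc_const_one ℝ T] at h
    rw [integral_const, smul_eq_mul, mul_one] at h
    rw [h]
    simpa using inner_self_eq_norm_sq (𝕜 := ℂ) u

/-- The spectral theorem for bounded selfadjoint operators. -/
theorem exists_projMeasure_of_isSelfAdjoint {T : H →L[ℂ] H} (hT : IsSelfAdjoint T) :
    ∃ e : ProjMeasure H, ∀ f, Continuous f → WeakIntegral e.scalarMeasure f (cfc f T) := by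
  have hμ := quadFamily_boundedScalarMeasure hT
  have hex : ∀ f, BddMeas f → ∃ S, WeakIntegral (boundedScalarMeasure hT) f S := fun f hf =>
    hμ.exists_of_continuous (fun f hf _ => ⟨_, weakIntegral_boundedScalarMeasure hT hf⟩) hf
  choose! Φ hΦ using hex
  have hcont : ∀ f, Continuous f → BddMeas f → Φ f = cfc f T := fun f hf hb =>
    (hΦ f hb).unique (weakIntegral_boundedScalarMeasure hT hf)
  -- Multiplicativity passes from continuous to Borel functions in one factor at a time.
  have hmul1 : ∀ f g, Continuous f → BddMeas f → BddMeas g → Φ (f * g) = Φ f * Φ g := by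
    intro f g hf hfb hg
    obtain ⟨h1, h2, h3⟩ := hμ.mul_limit hfb hΦ
    refine BddMeas.induction_continuous (p := fun g => Φ (f * g) = Φ f * Φ g)
      (fun g hg hgb => ?_) h1 h2 h3 hg
    rw [hcont _ (hf.mul hg) (hfb.mul hgb), hcont f hf hfb, hcont g hg hgb]
    exact cfc_mul f g T hf.continuousOn hg.continuousOn
  have hmul : ∀ f g, BddMeas f → BddMeas g → Φ (f * g) = Φ f * Φ g := by
    intro f g hf hg
    obtain ⟨h1, h2, h3⟩ := hμ.mul_limit hf hΦ
    refine BddMeas.induction_continuous (p := fun g => Φ (f * g) = Φ f * Φ g)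
      (fun g hg hgb => ?_) h1 h2 h3 hg
    have a := congrArg star (hmul1 g f hg hgb hf)
    rw [star_mul, (hΦ f hf).isSelfAdjoint.star_eq, (hΦ g hgb).isSelfAdjoint.star_eq,
      (hΦ _ (hgb.mul hf)).isSelfAdjoint.star_eq, mul_comm] at a
    exact a
  obtain ⟨e, he⟩ := hμ.exists_projMeasure hΦ hmul
  have he' : e.scalarMeasure = boundedScalarMeasure hT := funext he
  exact ⟨e, fun f hf => he' ▸ weakIntegral_boundedScalarMeasure hT hf⟩

end BoundedSpectral

/-! ## The operator `T^* T` and its resolvent -/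

section Gram

open Filter Topology

variable {H : Type*} [NormedAddCommGroup H] [InnerProductSpace ℂ H] [CompleteSpace H]
variable {K : Type*} [NormedAddCommGroup K] [InnerProductSpace ℂ K] [CompleteSpace K]

theorem LinearPMap.mem_graph_mk (T : H →ₗ.[ℂ] K) {u : H} (hu : u ∈ T.domain) :
    (u, T ⟨u, hu⟩) ∈ T.graph :=
  T.mem_graph ⟨u, hu⟩

theorem LinearPMap.mem_graph_iff_exists {T : H →ₗ.[ℂ] K} {u : H} {y : K} :
    (u, y) ∈ T.graph ↔ ∃ h : u ∈ T.domain, T ⟨u, h⟩ = y := by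
  rw [LinearPMap.mem_graph_iff]
  constructor
  · rintro ⟨v, rfl, rfl⟩; exact ⟨v.2, rfl⟩
  · rintro ⟨h, rfl⟩; exact ⟨⟨u, h⟩, rfl, rfl⟩

theorem unboundedComp_domain_iff {S : K →ₗ.[ℂ] H} {T : H →ₗ.[ℂ] K} {u : H} :
    u ∈ (unboundedComp S T).domain ↔ ∃ h : u ∈ T.domain, T ⟨u, h⟩ ∈ S.domain := by
  change u ∈ (S.domain.comap T.toFun).map T.domain.subtype ⊓ T.domain ↔ _
  constructor
  · rintro ⟨⟨v, hv, rfl⟩, h⟩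
    exact ⟨h, hv⟩
  · rintro ⟨h, h'⟩
    exact ⟨⟨⟨u, h⟩, h', rfl⟩, h⟩

theorem unboundedComp_apply {S : K →ₗ.[ℂ] H} {T : H →ₗ.[ℂ] K} {u : H}
    (hu : u ∈ (unboundedComp S T).domain) (h : u ∈ T.domain) (h' : T ⟨u, h⟩ ∈ S.domain) :
    unboundedComp S T ⟨u, hu⟩ = S ⟨T ⟨u, h⟩, h'⟩ := rfl

/-- The graph of `T^* T`. -/
theorem mem_graph_gram {T : H →ₗ.[ℂ] K} (hd : Dense (T.domain : Set H)) {u f : H} :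
    (u, f) ∈ (unboundedComp T† T).graph ↔
      ∃ y, (u, y) ∈ T.graph ∧ ∀ x z, (x, z) ∈ T.graph → ⟪f, x⟫_ℂ = ⟪y, z⟫_ℂ := by
  rw [LinearPMap.mem_graph_iff_exists]
  constructor
  · rintro ⟨hu, rfl⟩
    obtain ⟨h, h'⟩ := unboundedComp_domain_iff.1 hu
    refine ⟨_, T.mem_graph_mk h, fun x z hxz => ?_⟩
    obtain ⟨hx, rfl⟩ := LinearPMap.mem_graph_iff_exists.1 hxz
    rw [unboundedComp_apply hu h h']
    exact LinearPMap.adjoint_isFormalAdjoint hd ⟨_, h'⟩ ⟨x, hx⟩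
  · rintro ⟨y, hy, hf⟩
    obtain ⟨h, rfl⟩ := LinearPMap.mem_graph_iff_exists.1 hy
    have h' : T ⟨u, h⟩ ∈ T†.domain :=
      LinearPMap.mem_adjoint_domain_of_exists _ ⟨f, fun x => hf _ _ (T.mem_graph x)⟩
    have hu : u ∈ (unboundedComp T† T).domain := unboundedComp_domain_iff.2 ⟨h, h'⟩
    refine ⟨hu, ?_⟩
    rw [unboundedComp_apply hu h h']
    exact LinearPMap.adjoint_apply_eq hd _ fun x => hf _ _ (T.mem_graph x)

/-- The graph of `T` as a closed subspace of the Hilbert space `H ⊕ K`. -/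
def graphL2 (T : H →ₗ.[ℂ] K) : Submodule ℂ (WithLp 2 (H × K)) :=
  T.graph.comap (WithLp.prodContinuousLinearEquiv 2 ℂ H K : WithLp 2 (H × K) →ₗ[ℂ] H × K)

theorem isClosed_graphL2 {T : H →ₗ.[ℂ] K} (hc : T.IsClosed) :
    IsClosed (graphL2 T : Set (WithLp 2 (H × K))) :=
  IsClosed.preimage (WithLp.prodContinuousLinearEquiv 2 ℂ H K).continuous hc

/-- The resolvent `(1 + T^* T)⁻¹`, as the compression of the projection onto the graph of `T`. -/
theorem exists_gram_resolvent {T : H →ₗ.[ℂ] K} (hc : T.IsClosed) :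
    ∃ B : H →L[ℂ] H, ∀ h, ∃ y, (B h, y) ∈ T.graph ∧
      ∀ x z, (x, z) ∈ T.graph → ⟪h - B h, x⟫_ℂ = ⟪y, z⟫_ℂ := by
  have : CompleteSpace (graphL2 T) := (isClosed_graphL2 hc).completeSpace_coe
  let ι : H →L[ℂ] WithLp 2 (H × K) :=
    ((WithLp.prodContinuousLinearEquiv 2 ℂ H K).symm : H × K →L[ℂ] WithLp 2 (H × K)) ∘L
      ContinuousLinearMap.inl ℂ H K
  let Q := (graphL2 T).starProjection
  refine ⟨WithLp.fstL 2 ℂ H K ∘L Q ∘L ι, fun h => ⟨(Q (ι h)).snd, ?_, ?_⟩⟩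
  · exact Submodule.starProjection_apply_mem (graphL2 T) (ι h)
  · intro x z hxz
    have h1 : ι h - Q (ι h) ∈ (graphL2 T)ᗮ := Submodule.sub_starProjection_mem_orthogonal _
    have hm : (WithLp.toLp 2 (x, z) : WithLp 2 (H × K)) ∈ graphL2 T := hxz
    have h2 := (Submodule.mem_orthogonal' _ _).1 h1 _ hm
    rw [WithLp.prod_inner_apply] at h2
    have h3 : ⟪h - (Q (ι h)).fst, x⟫_ℂ + ⟪0 - (Q (ι h)).snd, z⟫_ℂ = 0 := h2
    rw [zero_sub, inner_neg_left] at h3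
    exact (sub_eq_zero.1 ((sub_eq_add_neg _ _).trans h3))

/-- The bounded operator `(1 + A)⁻¹` attached to a nonnegative selfadjoint operator `A`. -/
structure IsResolvent (A : H →ₗ.[ℂ] H) (B : H →L[ℂ] H) : Prop where
  mem_graph : ∀ h, (B h, h - B h) ∈ A.graph
  apply_add : ∀ u f, (u, f) ∈ A.graph → B (u + f) = u
  nonneg : ∀ u f, (u, f) ∈ A.graph → ∃ r : ℝ, 0 ≤ r ∧ ⟪u, f⟫_ℂ = r

/-- The compression B of the graph projection maps into the domain by construction. That it also
inverts 1 + T^*T from the left is uniqueness of weak solutions. -/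
theorem exists_isResolvent_gram {T : H →ₗ.[ℂ] K} (hd : Dense (T.domain : Set H))
    (hc : T.IsClosed) : ∃ B, IsResolvent (unboundedComp T† T) B := by
  obtain ⟨B, hB⟩ := exists_gram_resolvent hc
  have h1 : ∀ h, (B h, h - B h) ∈ (unboundedComp T† T).graph := fun h =>
    (mem_graph_gram hd).2 (hB h)
  refine ⟨B, h1, fun u f huf => ?_, fun u f huf => ?_⟩
  · obtain ⟨y, hy, hyf⟩ := (mem_graph_gram hd).1 huf
    obtain ⟨w, hw, hwf⟩ := hB (u + f)
    have hsub := T.graph.sub_mem hy hw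
    have a := hyf _ _ hsub
    have b := hwf _ _ hsub
    -- Both weak equations are tested on the difference of the two candidates, so its graph norm
    -- vanishes.
    have hc : ⟪u - B (u + f), u - B (u + f)⟫_ℂ + ⟪y - w, y - w⟫_ℂ = 0 := by
      have e : (u + f) - B (u + f) = (u - B (u + f)) + f := by abel
      rw [e, inner_add_left, a] at b
      rw [inner_sub_left y w]
      linear_combination b
    rw [inner_self_eq_ofReal, inner_self_eq_ofReal, ← Complex.ofReal_add] at hc
    have hc' := Complex.ofReal_eq_zero.1 hc
    have : ‖u - B (u + f)‖ ^ 2 = 0 := by nlinarith [sq_nonneg ‖u - B (u + f)‖, sq_nonneg ‖y - w‖]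
    exact (sub_eq_zero.1 (norm_eq_zero.1 (pow_eq_zero_iff (by norm_num) |>.1 this))).symm
  · obtain ⟨y, hy, hyf⟩ := (mem_graph_gram hd).1 huf
    refine ⟨‖y‖ ^ 2, by positivity, ?_⟩
    rw [← inner_conj_symm, hyf _ _ hy, inner_self_eq_ofReal, Complex.conj_ofReal]

namespace IsResolvent

variable {A : H →ₗ.[ℂ] H} {B : H →L[ℂ] H}

theorem inner_eq (hB : IsResolvent A B) (h : H) :
    ∃ r : ℝ, ‖B h‖ ^ 2 ≤ r ∧ ⟪h, B h⟫_ℂ = r := by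
  obtain ⟨r, hr, he⟩ := hB.nonneg _ _ (hB.mem_graph h)
  refine ⟨‖B h‖ ^ 2 + r, by linarith, ?_⟩
  rw [inner_sub_right, inner_self_eq_ofReal] at he
  rw [← inner_conj_symm, eq_add_of_sub_eq he]
  push_cast
  simp only [map_add, map_pow, Complex.conj_ofReal]
  ring

theorem isSelfAdjoint (hB : IsResolvent A B) : IsSelfAdjoint B :=
  isSelfAdjoint_of_inner_real fun u => by
    obtain ⟨r, _, h⟩ := hB.inner_eq u
    exact ⟨r, h⟩

theorem norm_le (hB : IsResolvent A B) : ‖B‖ ≤ 1 := by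
  refine ContinuousLinearMap.opNorm_le_bound _ zero_le_one fun h => ?_
  obtain ⟨r, hr, he⟩ := hB.inner_eq h
  have h1 : r ≤ ‖h‖ * ‖B h‖ := by
    have := norm_inner_le_norm (𝕜 := ℂ) h (B h)
    rw [he, Complex.norm_real] at this
    exact (le_abs_self r).trans this
  rcases eq_or_ne (‖B h‖) 0 with h0 | h0
  · rw [h0]; positivity
  · have : 0 < ‖B h‖ := lt_of_le_of_ne (norm_nonneg _) (Ne.symm h0)
    nlinarith

theorem spectrum_subset (hB : IsResolvent A B) : spectrum ℝ B ⊆ Set.Icc 0 1 := by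
  intro x hx
  have hpos : 0 ≤ B := by
    rw [ContinuousLinearMap.nonneg_iff_isPositive]
    refine ⟨hB.isSelfAdjoint.isSymmetric, fun u => ?_⟩
    obtain ⟨r, hr, he⟩ := hB.inner_eq u
    rw [ContinuousLinearMap.reApplyInnerSelf_apply, ← inner_conj_symm, he]
    simpa using (sq_nonneg _).trans hr
  refine ⟨spectrum_nonneg_of_nonneg hpos hx, ?_⟩
  by_cases hn : Nontrivial H
  · exact (le_abs_self x).trans ((spectrum.norm_le_norm_of_mem hx).trans hB.norm_le)
  · rw [not_nontrivial_iff_subsingleton] at hn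
    have : Subsingleton (H →L[ℂ] H) := ⟨fun a b => by ext u; exact Subsingleton.elim _ _⟩
    rw [spectrum.of_subsingleton] at hx
    exact hx.elim

theorem injective (hB : IsResolvent A B) {h : H} (h0 : B h = 0) : h = 0 := by
  have := hB.mem_graph h
  rw [h0, sub_zero] at this
  have h1 := LinearPMap.mem_graph_snd_inj A this A.graph.zero_mem rfl
  exact h1

end IsResolvent

namespace ProjMeasure

variable (e : ProjMeasure H)

theorem scalarMeasure_integral {g : ℝ → ℝ} (hg : BddMeas g) (u : H) :
    e.scalarMeasure (e.integral g u)
      = (e.scalarMeasure u).withDensity (fun x => ENNReal.ofReal (g x ^ 2)) := by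
  ext s hs
  rw [withDensity_apply _ hs, e.scalarMeasure_apply hs]
  have h1 : e.E s (e.integral g u) = e.integral (s.indicator g) u := by
    rw [e.integral_indicator_mul hg hs, ← e.E_commute hg hs]; rfl
  rw [h1, e.norm_integral_apply_sq (hg.indicator hs), ← lintegral_indicator hs,
    ofReal_integral_eq_lintegral_ofReal]
  · congr 1
    ext x
    by_cases hx : x ∈ s <;> simp [hx]
  · have := (hg.indicator hs).mul (hg.indicator hs)
    have h2 := e.quadFamily.integrable this u
    exact h2.congr (Eventually.of_forall fun x => (sq _).symm)
  · exact Eventually.of_forall fun x => sq_nonneg _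

end ProjMeasure

/-- The function `b ↦ b⁻¹ - 1`, which maps the spectral measure of `(1 + A)⁻¹` to that of `A`. -/
def unresolve (b : ℝ) : ℝ := b⁻¹ - 1

theorem measurable_unresolve : Measurable unresolve := measurable_inv.sub_const 1

/-- A continuous function vanishing on the spectrum of B gives the zero operator, so the measure of
B lives on [0, 1]; injectivity of B removes the atom at 0. The function g is the identity truncated
to [0, 1], which puts B into the bounded calculus. -/
theorem exists_resolvent_projMeasure {A : H →ₗ.[ℂ] H} {B : H →L[ℂ] H} (hB : IsResolvent A B) :
    ∃ (e : ProjMeasure H) (g : ℝ → ℝ), BddMeas g ∧ e.integral g = B ∧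
      ∀ u, ∀ᵐ x ∂(e.scalarMeasure u), 0 < x ∧ x ≤ 1 ∧ g x = x := by
  obtain ⟨e, he⟩ := exists_projMeasure_of_isSelfAdjoint hB.isSelfAdjoint
  let g : ℝ → ℝ := fun x => max 0 (min x 1)
  have hg : Continuous g := by fun_prop
  have hgb : BddMeas g := ⟨hg.measurable, 1, fun x => by
    rw [abs_of_nonneg (le_max_left _ _)]
    exact max_le zero_le_one (min_le_right _ _)⟩
  have hgB : e.integral g = B := by
    refine (e.weakIntegral_integral hgb).unique ?_
    have h1 := he g hg
    have h2 : cfc g B = B := by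
      conv_rhs => rw [← cfc_id ℝ B hB.isSelfAdjoint]
      refine cfc_congr fun x hx => ?_
      obtain ⟨h0, h1⟩ := hB.spectrum_subset hx
      simp [g, h0, h1]
    rwa [h2] at h1
  refine ⟨e, g, hgb, hgB, fun u => ?_⟩
  -- This function is bounded and continuous and vanishes exactly where g x = x, so its zero
  -- integral puts the measure on that set.
  let f : ℝ → ℝ := fun x => min |x - g x| 1
  have hf : Continuous f := by fun_prop
  have hfb : BddMeas f := ⟨hf.measurable, 1, fun x => by
    rw [abs_of_nonneg (le_min (abs_nonneg _) zero_le_one)]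
    exact min_le_right _ _⟩
  have hf0 : cfc f B = 0 := by
    rw [← cfc_const_zero ℝ B]
    refine cfc_congr fun x hx => ?_
    obtain ⟨h0, h1⟩ := hB.spectrum_subset hx
    simp [f, g, h0, h1]
  have hint := he f hf u
  rw [hf0, zero_apply, inner_zero_right] at hint
  have hint' : ∫ x, f x ∂(e.scalarMeasure u) = 0 := by exact_mod_cast hint.symm
  rw [integral_eq_zero_iff_of_nonneg (fun x => le_min (abs_nonneg _) zero_le_one)
    (e.quadFamily.integrable hfb u)] at hint'
  have hzero : e.scalarMeasure u {0} = 0 := by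
    rw [← e.E_eq_zero_iff (measurableSet_singleton 0)]
    refine hB.injective ?_
    rw [← hgB, ← mul_apply_eq_comp, ← e.integral_indicator_mul hgb
      (measurableSet_singleton 0)]
    have : ({0} : Set ℝ).indicator g = (0 : ℝ) • g := by
      ext x
      by_cases hx : x = 0 <;> simp [hx, g]
    rw [this, e.integral_smul hgb]
    simp
  have hne : ∀ᵐ x ∂(e.scalarMeasure u), x ≠ 0 := by
    rw [ae_iff]
    simpa using hzero
  filter_upwards [hint', hne] with x hx hx0
  have hxg : g x = x := by
    have h1 : min |x - g x| 1 = 0 := hx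
    have h2 : |x - g x| = 0 := by
      rcases min_choice |x - g x| 1 with h | h
      · rw [← h, h1]
      · rw [h1] at h; norm_num at h
    linarith [abs_eq_zero.1 h2]
  have h0 : 0 ≤ x := hxg ▸ le_max_left _ _
  have h1 : x ≤ 1 := by
    rw [← hxg]
    exact max_le zero_le_one (min_le_right _ _)
  exact ⟨lt_of_le_of_ne h0 (Ne.symm hx0), h1, hxg⟩

/-- A vector `u` with `∫ x⁻² d(E(x)u,u) < ∞` belongs to the range of `B = ∫ x dE(x)`. -/
theorem ProjMeasure.exists_apply_eq {e : ProjMeasure H} {g : ℝ → ℝ} (hg : BddMeas g) {u : H}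
    (hae : ∀ᵐ x ∂(e.scalarMeasure u), 0 < x ∧ x ≤ 1 ∧ g x = x)
    (hint : Integrable (fun x => (x⁻¹) ^ 2) (e.scalarMeasure u)) : ∃ h, e.integral g h = u := by
  let s : ℕ → Set ℝ := fun n => Set.Ioi (1 / ((n : ℝ) + 1))
  have hs : ∀ n, MeasurableSet (s n) := fun n => measurableSet_Ioi
  have hpos : ∀ n : ℕ, (0 : ℝ) < 1 / ((n : ℝ) + 1) := fun n => Nat.one_div_pos_of_nat
  -- The candidate preimages are ∫ f_n dE u with f_n = x⁻¹ cut off near 0; b n is the tail of ∫ x⁻²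
  -- and controls their Cauchy property.
  let f : ℕ → ℝ → ℝ := fun n => (s n).indicator fun x => x⁻¹
  have hf : ∀ n, BddMeas (f n) := fun n => by
    refine ⟨measurable_inv.indicator (hs n), (n : ℝ) + 1, fun x => ?_⟩
    by_cases hx : x ∈ s n
    · have hx' : 1 / ((n : ℝ) + 1) < x := hx
      have hx0 : 0 < x := (hpos n).trans hx'
      simp only [f, Set.indicator_of_mem hx]
      rw [abs_of_pos (inv_pos.2 hx0)]
      rw [inv_le_comm₀ hx0 (by positivity), ← one_div]
      exact hx'.le
    · simp only [f, Set.indicator_of_notMem hx, abs_zero]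
      positivity
  let b : ℕ → ℝ := fun n => ∫ x, (s n)ᶜ.indicator (fun x => (x⁻¹) ^ 2) x ∂(e.scalarMeasure u)
  have hb : Tendsto b atTop (𝓝 0) := by
    have := tendsto_integral_of_dominated_convergence (μ := e.scalarMeasure u)
      (F := fun n x => (s n)ᶜ.indicator (fun x => (x⁻¹) ^ 2) x) (f := fun _ => 0)
      (fun x => (x⁻¹) ^ 2)
      (fun n => ((measurable_inv.pow_const 2).indicator (hs n).compl).aestronglyMeasurable) hint
      (fun n => Eventually.of_forall fun x => by
        rw [Real.norm_of_nonneg (Set.indicator_nonneg (fun _ _ => sq_nonneg _) _)]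
        exact Set.indicator_le_self' (fun _ _ => sq_nonneg _) x)
      (by
        filter_upwards [hae] with x hx
        refine tendsto_const_nhds.congr' ?_
        have h1 := (tendsto_one_div_add_atTop_nhds_zero_nat (𝕜 := ℝ)).eventually_lt_const hx.1
        filter_upwards [h1] with n hn
        rw [Set.indicator_of_notMem]
        simpa [s] using hn)
    rw [integral_zero] at this
    exact this
  have hcau : CauchySeq fun n => e.integral (f n) u := by
    refine cauchySeq_of_le_tendsto_0 (fun n => √(b n)) (fun n m N hn hm => ?_) (by
      simpa [Function.comp_def] using (Real.continuous_sqrt.tendsto _).comp hb)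
    have h1 : e.integral (f n) u - e.integral (f m) u
        = e.integral (f n + (-1 : ℝ) • f m) u := by
      rw [e.integral_add (hf n) ((hf m).smul _), e.integral_smul (hf m)]
      simp [sub_eq_add_neg]
    rw [dist_eq_norm, h1]
    refine Real.le_sqrt_of_sq_le ?_
    rw [e.norm_integral_apply_sq ((hf n).add ((hf m).smul _))]
    have hmono : ∀ k, N ≤ k → s N ⊆ s k := fun k hk x hx =>
      (one_div_le_one_div_of_le (by positivity)
        (add_le_add_left (Nat.cast_le.2 hk) (1 : ℝ))).trans_lt hx
    refine integral_mono_of_nonneg (Eventually.of_forall fun x => sq_nonneg _)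
      (hint.indicator (hs N).compl) (Eventually.of_forall fun x => ?_)
    simp only [Pi.add_apply, Pi.smul_apply, smul_eq_mul, f]
    by_cases hx : x ∈ s N
    · rw [Set.indicator_of_mem (hmono n hn hx), Set.indicator_of_mem (hmono m hm hx),
        Set.indicator_of_notMem (Set.notMem_compl_iff.2 hx)]
      simp
    · rw [show (s N)ᶜ.indicator (fun x => (x⁻¹) ^ 2) x = (x⁻¹) ^ 2 from Set.indicator_of_mem hx _]
      have h0 := sq_nonneg x⁻¹
      by_cases hxn : x ∈ s n <;> by_cases hxm : x ∈ s m <;> simp [hxn, hxm, sq_nonneg]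
  obtain ⟨h, hh⟩ := cauchySeq_tendsto_of_complete hcau
  refine ⟨h, ?_⟩
  have h1 : Tendsto (fun n => e.integral g (e.integral (f n) u)) atTop (𝓝 (e.integral g h)) :=
    ((e.integral g).continuous.tendsto h).comp hh
  refine tendsto_nhds_unique h1 ?_
  rw [tendsto_iff_norm_sub_tendsto_zero]
  have h2 : ∀ n, ‖e.integral g (e.integral (f n) u) - u‖
      = √((e.scalarMeasure u).real (s n)ᶜ) := by
    intro n
    rw [eq_comm, Real.sqrt_eq_iff_mul_self_eq measureReal_nonneg (norm_nonneg _), ← sq]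
    have h3 : e.integral g (e.integral (f n) u) - u
        = e.integral (g * f n + (-1 : ℝ) • fun _ => (1 : ℝ)) u := by
      rw [e.integral_add (hg.mul (hf n)) ((BddMeas.const 1).smul _),
        e.integral_smul (BddMeas.const 1), e.integral_mul hg (hf n), e.integral_one]
      simp [sub_eq_add_neg]
    rw [h3, e.norm_integral_apply_sq ((hg.mul (hf n)).add ((BddMeas.const 1).smul _)),
      ← MeasureTheory.integral_indicator_one (hs n).compl]
    refine (integral_congr_ae ?_).symm
    filter_upwards [hae] with x hx
    by_cases hxn : x ∈ s n
    · have : x ≠ 0 := hx.1.ne'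
      simp [f, hxn, hx.2.2, this]
    · simp [f, hxn]
  simp only [h2]
  have h4 : Tendsto (fun n => (e.scalarMeasure u).real (s n)ᶜ) atTop (𝓝 0) := by
    refine squeeze_zero (fun n => measureReal_nonneg) (fun n => ?_) hb
    rw [← MeasureTheory.integral_indicator_one (hs n).compl]
    refine integral_mono_ae ((integrable_const (1 : ℝ)).indicator (hs n).compl)
      (hint.indicator (hs n).compl) ?_
    filter_upwards [hae] with x hx
    by_cases hxn : x ∈ s n
    · simp [hxn]
    · have : 1 ≤ x⁻¹ := (one_le_inv₀ hx.1).2 hx.2.1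
      simpa [hxn] using one_le_pow₀ (n := 2) this
  simpa [Function.comp_def] using (Real.continuous_sqrt.tendsto _).comp h4

/-- The measure of A is the image of the measure of B = (1 + A)⁻¹ under b ↦ b⁻¹ - 1. A vector u = Bh
has scalar measure b² times that of h, so integrals of b⁻² against u become finite; conversely
integrability of b⁻² puts u in the range of B, which is the domain of A. -/
theorem exists_isSpectralMeasureOf {A : H →ₗ.[ℂ] H} {B : H →L[ℂ] H} (hB : IsResolvent A B) :
    ∃ e : ProjMeasure H, e.IsSpectralMeasureOf A := by
  obtain ⟨e, g, hg, hgB, hae⟩ := exists_resolvent_projMeasure hB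
  have hcomp : ∀ f : ℝ → ℝ, BddMeas f → BddMeas (f ∘ unresolve) := fun f hf =>
    ⟨hf.1.comp measurable_unresolve, hf.2.imp fun C hC x => hC _⟩
  have hμ : QuadFamily fun u => (e.scalarMeasure u).map unresolve :=
    ⟨fun u => inferInstance, fun u => by
      rw [map_measureReal_apply measurable_unresolve .univ, Set.preimage_univ, e.quadFamily.mass]⟩
  obtain ⟨d, hd⟩ := hμ.exists_projMeasure (Φ := fun f => e.integral (f ∘ unresolve))
    (fun f hf u => by
      rw [e.weakIntegral_integral (hcomp f hf) u,
        integral_map measurable_unresolve.aemeasurable hf.1.aestronglyMeasurable]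
      rfl)
    (fun f g hf hg => e.integral_mul (hcomp f hf) (hcomp g hg))
  refine ⟨d, fun u => ?_, fun u => ?_⟩
  · rw [hd, lintegral_map (by fun_prop) measurable_unresolve]
    constructor
    · intro hu
      have hu' : e.integral g (u + A ⟨u, hu⟩) = u := by
        rw [hgB]; exact hB.apply_add _ _ (A.mem_graph_mk hu)
      rw [← hu', e.scalarMeasure_integral hg, lintegral_withDensity_eq_lintegral_mul _
        (by have := hg.1; fun_prop) (by have := measurable_unresolve; fun_prop)]
      -- The density is b²(b⁻¹ - 1)² = (1 - b)² ≤ 1 on (0, 1].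
      refine (lintegral_mono_ae (g := fun _ => 1) ?_).trans_lt (by simp)
      filter_upwards [hae (u + A ⟨u, hu⟩)] with x hx
      rw [Pi.mul_apply, ← ENNReal.ofReal_mul (sq_nonneg _), hx.2.2, ← mul_pow, unresolve, mul_sub,
        mul_inv_cancel₀ hx.1.ne', mul_one]
      refine ENNReal.ofReal_le_one.2 ?_
      have := hx.1
      have := hx.2.1
      nlinarith
    · intro h
      have hint : Integrable (fun x => unresolve x ^ 2) (e.scalarMeasure u) := by
        refine ⟨(measurable_unresolve.pow_const 2).aestronglyMeasurable, ?_⟩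
        rw [hasFiniteIntegral_iff_ofReal (Eventually.of_forall fun x => sq_nonneg _)]
        exact h
      have hint2 : Integrable (fun x => (x⁻¹) ^ 2) (e.scalarMeasure u) := by
        refine ((hint.const_mul 2).add (integrable_const (2 : ℝ))).mono'
          (measurable_inv.pow_const 2).aestronglyMeasurable (Eventually.of_forall fun x => ?_)
        rw [Real.norm_of_nonneg (sq_nonneg _), Pi.add_apply, unresolve]
        nlinarith [sq_nonneg (x⁻¹ - 2)]
      obtain ⟨v, rfl⟩ := ProjMeasure.exists_apply_eq hg (hae u) hint2
      rw [hgB]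
      exact (LinearPMap.mem_graph_iff_exists.1 (hB.mem_graph v)).1
  · obtain ⟨u, hu⟩ := u
    have hu' : e.integral g (u + A ⟨u, hu⟩) = u := by
      rw [hgB]; exact hB.apply_add _ _ (A.mem_graph_mk hu)
    set h := u + A ⟨u, hu⟩ with hh
    have hA : A ⟨u, hu⟩ = h - u := by rw [hh]; abel
    change ⟪u, A ⟨u, hu⟩⟫_ℂ = ((∫ x, x ∂(d.scalarMeasure u) : ℝ) : ℂ)
    rw [hA, hd, integral_map (f := fun x => x) measurable_unresolve.aemeasurable
      measurable_id.aestronglyMeasurable]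
    -- With density b² the integrand b⁻¹ - 1 becomes b - b², a bounded function of B.
    have h1 : ∫ x, unresolve x ∂(e.scalarMeasure u)
        = ∫ x, (g + (-1 : ℝ) • (g * g)) x ∂(e.scalarMeasure h) := by
      conv_lhs => rw [← hu']
      rw [e.scalarMeasure_integral hg, integral_withDensity_eq_integral_toReal_smul
        (by have := hg.1; fun_prop) (Eventually.of_forall fun x => ENNReal.ofReal_lt_top)]
      refine integral_congr_ae ?_
      filter_upwards [hae h] with x hx
      rw [ENNReal.toReal_ofReal (sq_nonneg _), hx.2.2, unresolve]
      simp only [smul_eq_mul, Pi.add_apply, Pi.smul_apply, Pi.mul_apply, hx.2.2]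
      have := hx.1.ne'
      field_simp
      ring
    rw [h1, ← e.weakIntegral_integral (hg.add ((hg.mul hg).smul _)) h,
      e.integral_add hg ((hg.mul hg).smul _), e.integral_smul (hg.mul hg), e.integral_mul hg hg]
    have h2 : ⟪h, e.integral g u⟫_ℂ = ⟪u, u⟫_ℂ := by
      have := (e.isSelfAdjoint_integral hg).isSymmetric h u
      rw [ContinuousLinearMap.coe_coe, hu'] at this
      exact this.symm
    have h3 : ⟪h, u⟫_ℂ = ⟪u, h⟫_ℂ := by
      have := (e.isSelfAdjoint_integral hg).isSymmetric h h
      rw [ContinuousLinearMap.coe_coe, hu'] at this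
      exact this.symm
    simp [hu', h2, h3, sub_eq_add_neg]

/-- The spectral theorem for `T^* T`. -/
theorem isSpectralMeasureOf_gram {T : H →ₗ.[ℂ] K} (hd : Dense (T.domain : Set H))
    (hc : T.IsClosed) :
    (spectralMeasure (unboundedComp T† T)).IsSpectralMeasureOf (unboundedComp T† T) := by
  obtain ⟨B, hB⟩ := exists_isResolvent_gram hd hc
  have h := exists_isSpectralMeasureOf hB
  rw [spectralMeasure, dif_pos h]
  exact h.choose_spec

end Gram

/-! ## Reading off an operator from its spectral measure -/

section SpectralFacts

open Filter Topology

variable {H : Type*} [NormedAddCommGroup H] [InnerProductSpace ℂ H] [CompleteSpace H]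
variable {K : Type*} [NormedAddCommGroup K] [InnerProductSpace ℂ K] [CompleteSpace K]

theorem inner_polarization_partial {D : Submodule ℂ H} (L : D →ₗ[ℂ] H) (u v : D) :
    ⟪(u : H), L v⟫_ℂ = (⟪((u + v : D) : H), L (u + v)⟫_ℂ - ⟪((u - v : D) : H), L (u - v)⟫_ℂ
      - Complex.I * ⟪((u + Complex.I • v : D) : H), L (u + Complex.I • v)⟫_ℂ
      + Complex.I * ⟪((u - Complex.I • v : D) : H), L (u - Complex.I • v)⟫_ℂ) / 4 := by
  simp only [map_add, map_sub, inner_add_left, inner_add_right, map_smul, inner_smul_left,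
    inner_smul_right, Complex.conj_I, inner_sub_left, inner_sub_right, Submodule.coe_add,
    Submodule.coe_sub, Submodule.coe_smul]
  linear_combination (1 / 2 * ⟪(u : H), L v⟫_ℂ - 1 / 2 * ⟪(v : H), L u⟫_ℂ) * Complex.I_sq

theorem tendsto_inner_partial {D : Submodule ℂ H} (L : D →ₗ[ℂ] H) (T : ℕ → H →L[ℂ] H)
    (h : ∀ v : D, Tendsto (fun n => ⟪(v : H), T n v⟫_ℂ) atTop (𝓝 ⟪(v : H), L v⟫_ℂ)) (u v : D) :
    Tendsto (fun n => ⟪(u : H), T n v⟫_ℂ) atTop (𝓝 ⟪(u : H), L v⟫_ℂ) := by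
  rw [inner_polarization_partial L u v]
  simp only [fun n => inner_polarization_right (T n) (u : H) v]
  exact ((((h (u + v)).sub (h (u - v))).sub ((h (u + Complex.I • v)).const_mul _)).add
    ((h (u - Complex.I • v)).const_mul _)).div_const _

theorem bddMeas_indicator_id {s : Set ℝ} (hs : MeasurableSet s) {M : ℝ} (hM : ∀ x ∈ s, |x| ≤ M) :
    BddMeas (s.indicator fun x => x) := by
  refine ⟨measurable_id.indicator hs, max M 0, fun x => ?_⟩
  by_cases hx : x ∈ s
  · simpa [hx] using Or.inl (hM x hx)
  · simp [hx]

theorem bddMeas_id_Icc (a b : ℝ) : BddMeas ((Set.Icc a b).indicator fun x => x) :=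
  bddMeas_indicator_id measurableSet_Icc (M := max |a| |b|) fun _ hx => abs_le_max_abs_abs hx.1 hx.2

namespace ProjMeasure.IsSpectralMeasureOf

variable {e : ProjMeasure H} {A : H →ₗ.[ℂ] H}

theorem integrable_sq (he : e.IsSpectralMeasureOf A) {u : H} (hu : u ∈ A.domain) :
    Integrable (fun x => x ^ 2) (e.scalarMeasure u) :=
  ⟨(measurable_id.pow_const 2).aestronglyMeasurable, by
    rw [hasFiniteIntegral_iff_ofReal (Eventually.of_forall fun x => sq_nonneg _)]
    exact (he.mem_domain_iff u).1 hu⟩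

theorem E_mem_domain (he : e.IsSpectralMeasureOf A) {s : Set ℝ} (hs : MeasurableSet s) {M : ℝ}
    (hM : ∀ x ∈ s, |x| ≤ M) (u : H) : e.E s u ∈ A.domain := by
  rw [he.mem_domain_iff, e.scalarMeasure_E hs]
  refine (setLIntegral_mono measurable_const (g := fun _ => ENNReal.ofReal (M ^ 2))
    fun x hx => ENNReal.ofReal_le_ofReal (sq_le_sq' ?_ ?_)).trans_lt ?_
  · linarith [neg_abs_le x, hM x hx]
  · exact (le_abs_self x).trans (hM x hx)
  · rw [setLIntegral_const]
    exact ENNReal.mul_lt_top ENNReal.ofReal_lt_top (measure_lt_top _ _)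

theorem dense_domain (he : e.IsSpectralMeasureOf A) : Dense (A.domain : Set H) := by
  intro u
  refine mem_closure_of_tendsto (e.tendsto_E_Icc u) (Eventually.of_forall fun n => ?_)
  exact he.E_mem_domain measurableSet_Icc (M := n) (fun x hx => abs_le.2 hx) u

/-- The definition of the spectral measure fixes only the quadratic form of A. It is the limit of
the forms of truncations of x, polarization on the domain recovers A weakly, and on the range of
E(s) the truncations are eventually constant. -/
theorem apply_E (he : e.IsSpectralMeasureOf A) {s : Set ℝ} (hs : MeasurableSet s) {M : ℝ}
    (hM : ∀ x ∈ s, |x| ≤ M) (u : H) (hu : e.E s u ∈ A.domain) :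
    A ⟨e.E s u, hu⟩ = e.integral (s.indicator fun x => x) u := by
  have hquad : ∀ v : A.domain, Tendsto (fun n : ℕ =>
      ⟪(v : H), e.integral ((Set.Icc (-(n : ℝ)) n).indicator fun x => x) v⟫_ℂ) atTop
      (𝓝 ⟪(v : H), A v⟫_ℂ) := by
    intro v
    rw [he.inner_apply v]
    simp only [e.weakIntegral_integral (bddMeas_id_Icc _ _) _]
    refine (Complex.continuous_ofReal.tendsto _).comp ?_
    have hint : Integrable (fun x : ℝ => x ^ 2 + 1) (e.scalarMeasure (v : H)) :=
      (he.integrable_sq v.2).add (integrable_const (1 : ℝ))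
    refine tendsto_integral_of_dominated_convergence
      (F := fun n : ℕ => (Set.Icc (-(n : ℝ)) n).indicator fun x => x) (f := fun x => x)
      (fun x => x ^ 2 + 1)
      (fun n => (bddMeas_id_Icc _ _).1.aestronglyMeasurable) hint (fun n => Eventually.of_forall fun x => ?_)
      (Eventually.of_forall fun x => ?_)
    · refine (norm_indicator_le_norm_self _ _).trans ?_
      rw [Real.norm_eq_abs]
      nlinarith [sq_abs x, abs_nonneg x, sq_nonneg (|x| - 1)]
    · obtain ⟨N, hN⟩ := exists_nat_ge |x|
      refine tendsto_const_nhds.congr' ?_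
      filter_upwards [eventually_ge_atTop N] with n hn
      rw [Set.indicator_of_mem]
      exact abs_le.1 (hN.trans (Nat.cast_le.2 hn))
  have hpol : ∀ v w : A.domain, Tendsto (fun n : ℕ =>
      ⟪(v : H), e.integral ((Set.Icc (-(n : ℝ)) n).indicator fun x => x) w⟫_ℂ) atTop
      (𝓝 ⟪(v : H), A w⟫_ℂ) := by
    exact tendsto_inner_partial A.toFun _ hquad
  refine he.dense_domain.eq_of_inner_right ℂ fun v hv => ?_
  refine tendsto_nhds_unique (hpol ⟨v, hv⟩ ⟨e.E s u, hu⟩) (tendsto_const_nhds.congr' ?_)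
  obtain ⟨N, hN⟩ := exists_nat_ge M
  filter_upwards [eventually_ge_atTop N] with n hn
  have h1 : ∀ f : ℝ → ℝ, BddMeas f → e.integral f (e.E s u) = e.integral (s.indicator f) u :=
    fun f hf => by rw [e.integral_indicator_mul hf hs]; rfl
  change ⟪v, _⟫_ℂ = ⟪v, e.integral _ (e.E s u)⟫_ℂ
  rw [h1 _ (bddMeas_id_Icc _ _), Set.indicator_indicator]
  congr 3
  rw [Set.inter_eq_left.2]
  intro x hx
  exact abs_le.1 ((hM x hx).trans (hN.trans (Nat.cast_le.2 hn)))

/-- A lower bound for `A` forces the spectral measure to vanish below it. -/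
theorem E_Iio_eq_zero (he : e.IsSpectralMeasureOf A) {a : ℝ}
    (ha : ∀ u : A.domain, a * ‖(u : H)‖ ^ 2 ≤ (⟪(u : H), A u⟫_ℂ).re) : e.E (Set.Iio a) = 0 := by
  -- On the range of E([b, c]) with c < a the form is at most c‖u‖², against the lower bound a‖u‖²,
  -- so the range is trivial. The half-line is a countable union of such intervals.
  have h1 : ∀ b c, c < a → e.E (Set.Icc b c) = 0 := by
    intro b c hca
    ext u
    have hM : ∀ x ∈ Set.Icc b c, |x| ≤ max |b| |c| := fun x hx => abs_le_max_abs_abs hx.1 hx.2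
    have hu := he.E_mem_domain measurableSet_Icc hM u
    have h2 := ha ⟨_, hu⟩
    rw [he.inner_apply ⟨_, hu⟩, Complex.ofReal_re] at h2
    simp only at h2
    rw [e.scalarMeasure_E measurableSet_Icc] at h2
    have h3 : ∫ x in Set.Icc b c, x ∂(e.scalarMeasure u) ≤ c * ‖e.E (Set.Icc b c) u‖ ^ 2 := by
      rw [← e.scalarMeasure_real measurableSet_Icc, mul_comm, ← smul_eq_mul, ← setIntegral_const]
      refine setIntegral_mono_on ?_ integrableOn_const measurableSet_Icc fun x hx => hx.2
      rw [← integrable_indicator_iff measurableSet_Icc]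
      exact e.quadFamily.integrable (bddMeas_id_Icc _ _) u
    have h4 : ‖e.E (Set.Icc b c) u‖ ^ 2 = 0 := by nlinarith [sq_nonneg ‖e.E (Set.Icc b c) u‖]
    simpa using h4
  ext u
  rw [zero_apply, e.E_eq_zero_iff measurableSet_Iio]
  have : Set.Iio a = ⋃ n : ℕ, Set.Icc (-(n : ℝ)) (a - 1 / ((n : ℝ) + 1)) := by
    ext x
    simp only [Set.mem_Iio, Set.mem_iUnion, Set.mem_Icc]
    constructor
    · intro hx
      obtain ⟨N, hN⟩ := exists_nat_ge (-x)
      obtain ⟨M, hM⟩ := exists_nat_one_div_lt (sub_pos.2 hx)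
      refine ⟨max N M, ?_, ?_⟩
      · have : (N : ℝ) ≤ (max N M : ℕ) := Nat.cast_le.2 (le_max_left _ _)
        linarith
      · have : (1 : ℝ) / (((max N M : ℕ) : ℝ) + 1) ≤ 1 / ((M : ℝ) + 1) :=
          one_div_le_one_div_of_le (by positivity)
            (add_le_add_left (Nat.cast_le.2 (le_max_right _ _)) (1 : ℝ))
        linarith
    · rintro ⟨n, -, hn⟩
      have : (0 : ℝ) < 1 / ((n : ℝ) + 1) := Nat.one_div_pos_of_nat
      linarith
  rw [this, measure_iUnion_null_iff]
  intro n
  have : (0 : ℝ) < 1 / ((n : ℝ) + 1) := Nat.one_div_pos_of_nat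
  rw [← e.E_eq_zero_iff measurableSet_Icc, h1 _ _ (by linarith), zero_apply]

/-- Points outside the spectrum have a neighbourhood of spectral measure zero. -/
theorem exists_E_Ioo_eq_zero (he : e.IsSpectralMeasureOf A) {z : ℝ}
    (hz : (z : ℂ) ∉ unboundedSpectrum A) : ∃ η > 0, e.E (Set.Ioo (z - η) (z + η)) = 0 := by
  rw [unboundedSpectrum, Set.mem_ofPred_eq, not_not] at hz
  obtain ⟨R, hR, -⟩ := hz
  -- On an interval of radius η around z the operator A - z has norm at most η on the range of E,
  -- and R inverts it; ‖R‖η < 1 then forces the range to be zero.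
  refine ⟨(‖R‖ + 1)⁻¹, by positivity, ?_⟩
  set η : ℝ := (‖R‖ + 1)⁻¹ with hη
  set s := Set.Ioo (z - η) (z + η) with hs
  have hsm : MeasurableSet s := measurableSet_Ioo
  have hηpos : 0 < η := by positivity
  ext u
  have hM : ∀ x ∈ s, |x| ≤ max |z - η| |z + η| := fun x hx => abs_le_max_abs_abs hx.1.le hx.2.le
  have hu := he.E_mem_domain hsm hM u
  have h1 := hR ⟨_, hu⟩
  rw [he.apply_E hsm hM u hu] at h1
  have hb : BddMeas (s.indicator fun x => x) := bddMeas_indicator_id hsm hM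
  have hb1 : BddMeas (s.indicator fun _ => (1 : ℝ)) := .one_indicator hsm
  have h2 : e.integral (s.indicator fun x => x) u - (z : ℂ) • e.E s u
      = e.integral ((s.indicator fun x => x - z)) (e.E s u) := by
    have h3 : (s.indicator fun x => x - z)
        = (s.indicator fun x => x) + (-z) • (s.indicator fun _ => (1 : ℝ)) := by
      ext x
      by_cases hx : x ∈ s <;> simp [hx, sub_eq_add_neg]
    have h4 : e.integral (s.indicator fun x => x) (e.E s u)
        = e.integral (s.indicator fun x => x) u := by
      rw [← mul_apply_eq_comp, ← e.integral_indicator_mul hb hsm, Set.indicator_indicator,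
        Set.inter_self]
    rw [h3, e.integral_add hb (hb1.smul _), e.integral_smul hb1, e.integral_indicator_one hsm]
    simp [h4, e.E_mul_E hsm hsm, sub_eq_add_neg]
  change R (e.integral (s.indicator fun x => x) u - (z : ℂ) • e.E s u) = e.E s u at h1
  rw [h2] at h1
  have hb2 : BddMeas (s.indicator fun x => x - z) := by
    refine ⟨(measurable_id.sub_const z).indicator hsm, η, fun x => ?_⟩
    by_cases hx : x ∈ s
    · rw [Set.indicator_of_mem hx, abs_le]
      exact ⟨by linarith [hx.1], by linarith [hx.2]⟩
    · rw [Set.indicator_of_notMem hx, abs_zero]; exact hηpos.le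
  have h5 : ‖e.integral (s.indicator fun x => x - z)‖ ≤ η :=
    e.norm_integral_le hb2 fun x => by
      by_cases hx : x ∈ s
      · rw [Set.indicator_of_mem hx, abs_le]
        exact ⟨by linarith [hx.1], by linarith [hx.2]⟩
      · rw [Set.indicator_of_notMem hx, abs_zero]; exact hηpos.le
  have h6 : ‖e.E s u‖ ≤ ‖R‖ * (η * ‖e.E s u‖) := by
    conv_lhs => rw [← h1]
    exact (R.le_opNorm _).trans (mul_le_mul_of_nonneg_left
      (ContinuousLinearMap.le_of_opNorm_le _ h5 _) (norm_nonneg _))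
  have h7 : ‖R‖ * η < 1 := by
    rw [hη, ← div_eq_mul_inv, div_lt_one (by positivity)]
    linarith
  have h8 : ‖e.E s u‖ = 0 := by nlinarith [norm_nonneg (e.E s u)]
  simpa using h8

end ProjMeasure.IsSpectralMeasureOf

/-- Spectral measures of `T^* T`. -/
structure IsGramMeasure (T : H →ₗ.[ℂ] K) (e : ProjMeasure H) : Prop where
  dense : Dense (T.domain : Set H)
  closed : T.IsClosed
  spec : e.IsSpectralMeasureOf (unboundedComp T† T)

namespace IsGramMeasure

variable {T : H →ₗ.[ℂ] K} {e : ProjMeasure H}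

theorem exists_graph (h : IsGramMeasure T e) {s : Set ℝ} (hs : MeasurableSet s) {M : ℝ}
    (hM : ∀ x ∈ s, |x| ≤ M) (u : H) :
    ∃ y, (e.E s u, y) ∈ T.graph ∧ ∀ x z, (x, z) ∈ T.graph →
      ⟪e.integral (s.indicator fun x => x) u, x⟫_ℂ = ⟪y, z⟫_ℂ := by
  have hu := h.spec.E_mem_domain hs hM u
  have h1 := LinearPMap.mem_graph_mk _ hu
  rw [h.spec.apply_E hs hM u hu] at h1
  exact (mem_graph_gram h.dense).1 h1

theorem E_Iio_zero (h : IsGramMeasure T e) : e.E (Set.Iio 0) = 0 := by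
  refine h.spec.E_Iio_eq_zero fun u => ?_
  obtain ⟨y, hy, hyf⟩ := (mem_graph_gram h.dense).1 (LinearPMap.mem_graph _ u)
  have := hyf _ _ hy
  rw [inner_self_eq_ofReal] at this
  rw [← inner_conj_symm, this, zero_mul, Complex.conj_ofReal, Complex.ofReal_re]
  positivity

/-- The vector u lies only in the domain of T, not of T^*T. For u cut off to [-n, n] the image w
under T satisfies (w, y) = ‖w‖², so ‖w‖ ≤ ‖y‖, while ‖w‖² is the integral of x over [-n, n]; then n
→ ∞. -/
theorem norm_sq_ge (h : IsGramMeasure T e) {a : ℝ} {u : H} {y : K} (hu : (u, y) ∈ T.graph)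
    (hE : e.E (Set.Iio a) u = 0) : a * ‖u‖ ^ 2 ≤ ‖y‖ ^ 2 := by
  have key : ∀ n : ℕ, a * ‖e.E (Set.Icc (-(n : ℝ)) n) u‖ ^ 2 ≤ ‖y‖ ^ 2 := by
    intro n
    set s := Set.Icc (-(n : ℝ)) n
    have hs : MeasurableSet s := measurableSet_Icc
    obtain ⟨w, hw, hwf⟩ := h.exists_graph hs (M := n) (fun x hx => abs_le.2 hx) u
    have h1 := hwf _ _ hu
    have h2 := hwf _ _ hw
    have hint := bddMeas_id_Icc (-(n : ℝ)) n
    have h3 : ⟪e.integral (s.indicator fun x => x) u, e.E s u⟫_ℂ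
        = ⟪e.integral (s.indicator fun x => x) u, u⟫_ℂ := by
      have := (e.isSelfAdjoint_E s).isSymmetric (e.integral (s.indicator fun x => x) u) u
      rw [ContinuousLinearMap.coe_coe] at this
      rw [← this, ← mul_apply_eq_comp, e.E_commute hint hs, ← e.integral_indicator_mul hint hs,
        Set.indicator_indicator, Set.inter_self]
    have h4 : ⟪w, y⟫_ℂ = ((‖w‖ ^ 2 : ℝ) : ℂ) := by
      rw [← h1, ← h3, h2, inner_self_eq_ofReal]
    have h5 : ‖w‖ ^ 2 ≤ ‖w‖ * ‖y‖ := by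
      have := norm_inner_le_norm (𝕜 := ℂ) w y
      rw [h4, Complex.norm_real, Real.norm_of_nonneg (sq_nonneg _)] at this
      exact this
    have h6 : ‖w‖ ^ 2 ≤ ‖y‖ ^ 2 := by nlinarith [sq_nonneg (‖w‖ - ‖y‖), norm_nonneg w, norm_nonneg y]
    refine le_trans ?_ h6
    have h7 : ‖w‖ ^ 2 = ∫ x in s, x ∂(e.scalarMeasure u) := by
      have a1 := e.weakIntegral_integral hint u
      have a2 : ⟪e.integral (s.indicator fun x => x) u, u⟫_ℂ = ((‖w‖ ^ 2 : ℝ) : ℂ) := by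
        rw [h1, h4]
      rw [← inner_conj_symm, a2, Complex.conj_ofReal, integral_indicator hs] at a1
      exact Complex.ofReal_injective a1
    rw [h7, ← e.scalarMeasure_real hs, mul_comm, ← smul_eq_mul, ← setIntegral_const]
    rw [e.E_eq_zero_iff measurableSet_Iio] at hE
    refine setIntegral_mono_ae integrableOn_const ?_ ?_
    · rw [← integrable_indicator_iff hs]
      exact e.quadFamily.integrable hint u
    · have h8 : ∀ᵐ x ∂(e.scalarMeasure u), x ∉ Set.Iio a := measure_eq_zero_iff_ae_notMem.1 hE
      filter_upwards [h8] with x hx using not_lt.1 hx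
  exact le_of_tendsto ((((e.tendsto_E_Icc u).norm).pow 2).const_mul a) (Eventually.of_forall key)

end IsGramMeasure

end SpectralFacts

/-! ## The spectral projection of `T^* T` for `[0, δ]` -/

section GramProjection

open Filter Topology

variable {H : Type*} [NormedAddCommGroup H] [InnerProductSpace ℂ H] [CompleteSpace H]
variable {K : Type*} [NormedAddCommGroup K] [InnerProductSpace ℂ K] [CompleteSpace K]

theorem bddMeas_sqrt_Icc (δ : ℝ) : BddMeas ((Set.Icc 0 δ).indicator Real.sqrt) := by
  refine ⟨Real.continuous_sqrt.measurable.indicator measurableSet_Icc, √δ, fun x => ?_⟩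
  by_cases hx : x ∈ Set.Icc 0 δ
  · rw [Set.indicator_of_mem hx, abs_of_nonneg (Real.sqrt_nonneg _)]
    exact Real.sqrt_le_sqrt hx.2
  · rw [Set.indicator_of_notMem hx, abs_zero]
    exact Real.sqrt_nonneg _

theorem bddMeas_cos_sqrt (s : ℝ) : BddMeas fun x => Real.cos (s * √x) :=
  ⟨by fun_prop, 1, fun _ => Real.abs_cos_le_one _⟩

namespace ProjMeasure

variable (e : ProjMeasure H) (δ : ℝ)

/-- The operator `∫_{[0, δ]} √x dE(x)`. -/
def sqrtPart : H →L[ℂ] H := e.integral ((Set.Icc 0 δ).indicator Real.sqrt)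

theorem isSelfAdjoint_sqrtPart : IsSelfAdjoint (e.sqrtPart δ) :=
  e.isSelfAdjoint_integral (bddMeas_sqrt_Icc δ)

theorem sqrtPart_mul_E : e.sqrtPart δ * e.E (Set.Icc 0 δ) = e.sqrtPart δ := by
  rw [sqrtPart, ← e.integral_indicator_mul (bddMeas_sqrt_Icc δ) measurableSet_Icc,
    Set.indicator_indicator, Set.inter_self]

theorem E_mul_sqrtPart : e.E (Set.Icc 0 δ) * e.sqrtPart δ = e.sqrtPart δ := by
  rw [sqrtPart, e.E_commute (bddMeas_sqrt_Icc δ) measurableSet_Icc]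
  exact e.sqrtPart_mul_E δ

theorem sqrtPart_mul_self :
    e.sqrtPart δ * e.sqrtPart δ = e.integral ((Set.Icc 0 δ).indicator fun x => x) := by
  rw [sqrtPart, ← e.integral_mul (bddMeas_sqrt_Icc δ) (bddMeas_sqrt_Icc δ)]
  congr 1
  ext x
  by_cases hx : x ∈ Set.Icc 0 δ
  · simp only [Pi.mul_apply, Set.indicator_of_mem hx]
    exact Real.mul_self_sqrt hx.1
  · simp [Set.indicator_of_notMem hx]

theorem norm_sqrtPart_le : ‖e.sqrtPart δ‖ ≤ √δ := by
  refine e.norm_integral_le (bddMeas_sqrt_Icc δ) fun x => ?_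
  by_cases hx : x ∈ Set.Icc 0 δ
  · rw [Set.indicator_of_mem hx, abs_of_nonneg (Real.sqrt_nonneg _)]
    exact Real.sqrt_le_sqrt hx.2
  · rw [Set.indicator_of_notMem hx, abs_zero]
    exact Real.sqrt_nonneg _

theorem norm_integral_cos_le (s : ℝ) : ‖e.integral fun x => Real.cos (s * √x)‖ ≤ 1 :=
  e.norm_integral_le (bddMeas_cos_sqrt s) fun _ => Real.abs_cos_le_one _

/-- On [0, δ] the two functions agree. Outside it the right-hand cosine is cos 0 = 1, so the
identity needs the factor E. -/
theorem integral_cos_mul_E (s : ℝ) :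
    (e.integral fun x => Real.cos (s * √x)) * e.E (Set.Icc 0 δ)
      = cfc (fun x : ℝ => Real.cos (s * x)) (e.sqrtPart δ) * e.E (Set.Icc 0 δ) := by
  have h := e.integral_comp (bddMeas_sqrt_Icc δ) (h := fun x => Real.cos (s * x)) (by fun_prop)
  rw [sqrtPart, ← h.2, ← e.integral_indicator_mul (bddMeas_cos_sqrt s) measurableSet_Icc,
    ← e.integral_indicator_mul h.1 measurableSet_Icc]
  congr 1
  ext x
  by_cases hx : x ∈ Set.Icc 0 δ
  · simp [Set.indicator_of_mem hx]
  · simp [Set.indicator_of_notMem hx]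

/-- A spectral lower bound gives a lower bound for the square root. -/
theorem sqrtPart_ge {a : ℝ} (ha : e.E (Set.Iio (a ^ 2)) = 0) (u : H) :
    a * ‖e.E (Set.Icc 0 δ) u‖ ^ 2 ≤ (⟪u, e.sqrtPart δ u⟫_ℂ).re := by
  rw [sqrtPart, e.weakIntegral_integral (bddMeas_sqrt_Icc δ), Complex.ofReal_re,
    ← e.scalarMeasure_real measurableSet_Icc, integral_indicator measurableSet_Icc, mul_comm,
    ← smul_eq_mul, ← setIntegral_const]
  have h0 : e.scalarMeasure u (Set.Iio (a ^ 2)) = 0 := by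
    rw [← e.E_eq_zero_iff measurableSet_Iio, ha, zero_apply]
  have h1 : ∀ᵐ x ∂(e.scalarMeasure u), x ∉ Set.Iio (a ^ 2) := measure_eq_zero_iff_ae_notMem.1 h0
  refine setIntegral_mono_ae integrableOn_const ?_ ?_
  · rw [← integrable_indicator_iff measurableSet_Icc]
    exact e.quadFamily.integrable (bddMeas_sqrt_Icc δ) u
  · filter_upwards [h1] with x hx
    exact Real.le_sqrt_of_sq_le (not_lt.1 hx)

end ProjMeasure

namespace IsGramMeasure

variable {T : H →ₗ.[ℂ] K} {e : ProjMeasure H}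

/-- Negative numbers carry no mass, so off [0, δ] the spectral measure sits above δ. -/
theorem E_compl_Icc (h : IsGramMeasure T e) (δ : ℝ) (u : H) :
    e.E (Set.Iio δ) (u - e.E (Set.Icc 0 δ) u) = 0 := by
  have h1 : u - e.E (Set.Icc 0 δ) u = e.E (Set.Icc 0 δ)ᶜ u := by
    rw [e.E_compl measurableSet_Icc]; rfl
  rw [h1, e.E_mul_E measurableSet_Iio measurableSet_Icc.compl,
    e.E_eq_zero_iff (measurableSet_Iio.inter measurableSet_Icc.compl)]
  refine measure_mono_null (t := Set.Iio 0) (fun x hx => ?_) ?_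
  · by_contra h0
    exact hx.2 ⟨not_lt.1 h0, le_of_lt hx.1⟩
  · rw [← e.E_eq_zero_iff measurableSet_Iio, h.E_Iio_zero, zero_apply]

/-- The decomposition of `T v` along the spectral projection for `[0, δ]`. -/
theorem exists_decomp (h : IsGramMeasure T e) (δ : ℝ) {v : H} {y : K} (hv : (v, y) ∈ T.graph) :
    ∃ w, (e.E (Set.Icc 0 δ) v, w) ∈ T.graph ∧ ‖w‖ = ‖e.sqrtPart δ v‖ ∧ ⟪w, y - w⟫_ℂ = 0 ∧
      (v - e.E (Set.Icc 0 δ) v, y - w) ∈ T.graph ∧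
      δ * ‖v - e.E (Set.Icc 0 δ) v‖ ^ 2 ≤ ‖y - w‖ ^ 2 ∧
      ∀ x z, (x, z) ∈ T.graph → ⟪e.sqrtPart δ (e.sqrtPart δ v), x⟫_ℂ = ⟪w, z⟫_ℂ := by
  obtain ⟨w, hw, hwf⟩ := h.exists_graph (s := Set.Icc 0 δ) measurableSet_Icc (M := |δ|)
    (fun x hx => by
      rw [abs_of_nonneg hx.1]; exact hx.2.trans (le_abs_self _)) v
  rw [← e.sqrtPart_mul_self] at hwf
  have hsub := T.graph.sub_mem hv hw
  have hsym := (e.isSelfAdjoint_sqrtPart δ).isSymmetric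
  have h1 : ⟪w, w⟫_ℂ = ((‖e.sqrtPart δ v‖ ^ 2 : ℝ) : ℂ) := by
    rw [← hwf _ _ hw, ← inner_self_eq_ofReal, mul_apply_eq_comp]
    have := hsym (e.sqrtPart δ v) (e.E (Set.Icc 0 δ) v)
    rw [ContinuousLinearMap.coe_coe] at this
    rw [this, ← mul_apply_eq_comp, e.sqrtPart_mul_E]
  have h2 : ⟪w, y⟫_ℂ = ((‖e.sqrtPart δ v‖ ^ 2 : ℝ) : ℂ) := by
    rw [← hwf _ _ hv, ← inner_self_eq_ofReal, mul_apply_eq_comp]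
    exact hsym (e.sqrtPart δ v) v
  refine ⟨w, hw, ?_, ?_, hsub, ?_, hwf⟩
  · rw [inner_self_eq_ofReal] at h1
    have := Complex.ofReal_injective h1
    exact (sq_eq_sq₀ (norm_nonneg _) (norm_nonneg _)).1 this
  · rw [inner_sub_right, h1, h2, sub_self]
  · exact h.norm_sq_ge hsub (h.E_compl_Icc δ v)

end IsGramMeasure

end GramProjection

/-! ## The operator pencil -/

namespace OperatorPencil

open Filter Topology

variable {H : Type*} [NormedAddCommGroup H] [InnerProductSpace ℂ H] [CompleteSpace H]
variable {K : Type*} [NormedAddCommGroup K] [InnerProductSpace ℂ K] [CompleteSpace K]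
variable {p : OperatorPencil H K}

theorem mem_graph_X {t : ℝ} {u : H} {y : K} :
    (u, y) ∈ (p.X t).graph ↔ (u, y - (t : ℂ) • p.X₁ u) ∈ p.X₀.graph := by
  rw [LinearPMap.mem_graph_iff_exists, LinearPMap.mem_graph_iff_exists]
  constructor
  · rintro ⟨h, rfl⟩
    exact ⟨h, by simp [X, LinearPMap.vadd_apply]⟩
  · rintro ⟨h, e⟩
    refine ⟨h, ?_⟩
    have : p.X t ⟨u, h⟩ = (t : ℂ) • p.X₁ u + p.X₀ ⟨u, h⟩ := rfl
    rw [this, e]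
    abel

theorem isClosed_X (p : OperatorPencil H K) (t : ℝ) : (p.X t).IsClosed := by
  have h : ((p.X t).graph : Set (H × K))
      = (fun q : H × K => (q.1, q.2 - (t : ℂ) • p.X₁ q.1)) ⁻¹' (p.X₀.graph : Set (H × K)) := by
    ext ⟨u, y⟩
    exact mem_graph_X
  rw [LinearPMap.IsClosed, h]
  exact IsClosed.preimage (by fun_prop) p.isClosed

theorem isGramMeasure (p : OperatorPencil H K) (t : ℝ) :
    IsGramMeasure (p.X t) (spectralMeasure (p.A t)) :=
  ⟨p.dense_domain, p.isClosed_X t, isSpectralMeasureOf_gram p.dense_domain (p.isClosed_X t)⟩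

theorem closure_𝔑 (p : OperatorPencil H K) : p.𝔑.topologicalClosure = p.𝔑 :=
  (isClosed_unboundedKer p.isClosed).submodule_topologicalClosure_eq

theorem P_mem (p : OperatorPencil H K) (u : H) : p.P u ∈ p.𝔑 := by
  have h : p.P u ∈ p.𝔑.topologicalClosure := Submodule.starProjection_apply_mem _ _
  rwa [p.closure_𝔑] at h

theorem P_eq_self {u : H} (hu : u ∈ p.𝔑) : p.P u = u :=
  Submodule.starProjection_eq_self_iff.2 (p.𝔑.le_topologicalClosure hu)

theorem P_eq_zero {u : H} (hu : u ∈ p.𝔑ᗮ) : p.P u = 0 := by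
  refine (Submodule.starProjection_apply_eq_zero_iff _).2 ?_
  rwa [Submodule.orthogonal_closure]

theorem sub_P_mem (p : OperatorPencil H K) (u : H) : u - p.P u ∈ p.𝔑ᗮ := by
  rw [← Submodule.orthogonal_closure]
  exact Submodule.sub_starProjection_mem_orthogonal _

theorem P_graph (p : OperatorPencil H K) (u : H) : (p.P u, (0 : K)) ∈ p.X₀.graph :=
  mem_unboundedKer.1 (p.P_mem u)

theorem isStarProjection_P (p : OperatorPencil H K) : IsStarProjection p.P :=
  isStarProjection_starProjection

/-- The spectral gap gives the lower bound for `X₀` on the orthogonal complement of its kernel. -/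
theorem gap (p : OperatorPencil H K) {a : ℝ} (ha : ENNReal.ofReal a < p.d₀) {ζ : H} {y : K}
    (hζ : (ζ, y) ∈ p.X₀.graph) (hort : ζ ∈ p.𝔑ᗮ) : a * ‖ζ‖ ^ 2 ≤ ‖y‖ ^ 2 := by
  set e := spectralMeasure (p.A 0) with he
  have hg : IsGramMeasure (p.X 0) e := p.isGramMeasure 0
  have hX : ∀ {u : H} {y : K}, (u, y) ∈ (p.X 0).graph ↔ (u, y) ∈ p.X₀.graph := by
    intro u y
    rw [mem_graph_X]; simp
  refine hg.norm_sq_ge (hX.2 hζ) ?_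
  -- The range of E({0}) lies in 𝔑, so a vector orthogonal to 𝔑 has no atom at 0.
  have h0 : e.E {0} ζ = 0 := by
    obtain ⟨w, hw, hwf⟩ := hg.exists_graph (measurableSet_singleton 0) (M := 0)
      (fun x hx => by simp [Set.mem_singleton_iff.1 hx]) ζ
    have hz : (({0} : Set ℝ).indicator fun x => x) = (0 : ℝ) • fun _ => (1 : ℝ) := by
      ext x
      by_cases hx : x = 0 <;> simp [hx]
    rw [hz, e.integral_smul (.const 1), Complex.ofReal_zero, zero_smul, zero_apply] at hwf
    have h1 := hwf _ _ hw
    rw [inner_zero_left, eq_comm, inner_self_eq_zero] at h1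
    rw [h1, hX] at hw
    have h2 : e.E {0} ζ ∈ p.𝔑 := mem_unboundedKer.2 hw
    have h3 := (Submodule.mem_orthogonal _ _).1 hort _ h2
    rw [← inner_conj_symm, e.inner_E (measurableSet_singleton 0), Complex.conj_ofReal] at h3
    have h4 := Complex.ofReal_eq_zero.1 h3
    simpa using h4
  -- No point of (0, a] is in the spectrum; each has a null neighbourhood, and local nullity gives
  -- nullity.
  have h1 : e.scalarMeasure ζ (Set.Ioc 0 a) = 0 := by
    refine measure_null_of_locally_null _ fun x hx => ?_
    have hx' : (x : ℂ) ∉ unboundedSpectrum (p.A 0) := by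
      intro hmem
      have hne : (x : ℂ) ≠ 0 := Complex.ofReal_ne_zero.2 hx.1.ne'
      have h2 : p.d₀ ≤ edist (0 : ℂ) (x : ℂ) := Metric.infEDist_le_edist_of_mem ⟨hmem, hne⟩
      rw [edist_comm, edist_zero_right, ← ofReal_norm, Complex.norm_real,
        Real.norm_of_nonneg hx.1.le] at h2
      exact absurd (h2.trans (ENNReal.ofReal_le_ofReal hx.2)) (not_le.2 ha)
    obtain ⟨η, hη, hE⟩ := hg.spec.exists_E_Ioo_eq_zero hx'
    refine ⟨Set.Ioo (x - η) (x + η), mem_nhdsWithin_of_mem_nhds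
      (Ioo_mem_nhds (by linarith) (by linarith)), ?_⟩
    rw [← e.E_eq_zero_iff measurableSet_Ioo, hE, zero_apply]
  rw [e.E_eq_zero_iff measurableSet_Iio]
  rw [e.E_eq_zero_iff (measurableSet_singleton 0)] at h0
  have h2 : e.scalarMeasure ζ (Set.Iio 0) = 0 := by
    rw [← e.E_eq_zero_iff measurableSet_Iio, hg.E_Iio_zero, zero_apply]
  refine measure_mono_null (t := Set.Iio 0 ∪ ({0} ∪ Set.Ioc 0 a)) (fun x hx => ?_)
    (measure_union_null h2 (measure_union_null h0 h1))
  rcases lt_trichotomy x 0 with h | h | h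
  · exact Or.inl h
  · exact Or.inr (Or.inl h)
  · exact Or.inr (Or.inr ⟨h, le_of_lt hx⟩)

/-! ### The corrector -/

/-- This is Lax–Milgram on the graph of X₀ over 𝔑ᗮ. The gap bounds T : (ζ, X₀ζ) ↦ X₀ζ from below
there, so T^*T is invertible and the weak equation is solved by -(T^*T)⁻¹T^*X₁P. -/
theorem exists_isCorrector (p : OperatorPencil H K) {a : ℝ} (ha0 : 0 < a)
    (ha : ENNReal.ofReal a < p.d₀) : ∃ Z, p.IsCorrector Z := by
  let G : Submodule ℂ (WithLp 2 (H × K)) :=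
    graphL2 p.X₀ ⊓ p.𝔑ᗮ.comap (WithLp.fstL 2 ℂ H K : WithLp 2 (H × K) →ₗ[ℂ] H)
  have hG : IsClosed (G : Set (WithLp 2 (H × K))) :=
    (isClosed_graphL2 p.isClosed).inter
      ((Submodule.isClosed_orthogonal _).preimage (WithLp.fstL 2 ℂ H K).continuous)
  have : CompleteSpace G := hG.completeSpace_coe
  let T : G →L[ℂ] K := (WithLp.sndL 2 ℂ H K) ∘L G.subtypeL
  have hT : ∀ g : G, T g = g.1.snd := fun _ => rfl
  have hbelow : ∀ g : G, ‖g‖ ^ 2 ≤ (1 + a⁻¹) * ‖T g‖ ^ 2 := by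
    intro g
    have h1 : a * ‖g.1.fst‖ ^ 2 ≤ ‖g.1.snd‖ ^ 2 := p.gap ha g.2.1 g.2.2
    have h2 : ‖g‖ ^ 2 = ‖g.1.fst‖ ^ 2 + ‖g.1.snd‖ ^ 2 := by
      change ‖(g.1 : WithLp 2 (H × K))‖ ^ 2 = _
      rw [WithLp.prod_norm_sq_eq_of_L2]
    rw [h2, hT]
    have h3 : ‖g.1.fst‖ ^ 2 ≤ a⁻¹ * ‖g.1.snd‖ ^ 2 := by
      rw [inv_mul_eq_div, le_div_iff₀ ha0]; linarith
    linarith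
  let S : G →L[ℂ] G := ContinuousLinearMap.adjoint T ∘L T
  have hS : IsUnit S := by
    refine S.isUnit_of_forall_le_norm_inner_map (c := ⟨(1 + a⁻¹)⁻¹, by positivity⟩)
      (by change (0 : ℝ) < (1 + a⁻¹)⁻¹; positivity) fun g => ?_
    have h1 : ⟪S g, g⟫_ℂ = ((‖T g‖ ^ 2 : ℝ) : ℂ) := by
      rw [← inner_self_eq_ofReal]
      exact ContinuousLinearMap.adjoint_inner_left T g (T g)
    rw [h1, Complex.norm_real, Real.norm_of_nonneg (sq_nonneg _)]
    change ‖g‖ ^ 2 * (1 + a⁻¹)⁻¹ ≤ _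
    rw [← div_eq_mul_inv, div_le_iff₀ (by positivity), mul_comm]
    exact hbelow g
  obtain ⟨W, hW⟩ := hS.exists_right_inv
  let C : H →L[ℂ] G := -(W ∘L ContinuousLinearMap.adjoint T ∘L p.X₁ ∘L p.P)
  have hC : ∀ u g, ⟪T g, T (C u)⟫_ℂ = -⟪T g, p.X₁ (p.P u)⟫_ℂ := by
    intro u g
    have h1 : S (C u) = -ContinuousLinearMap.adjoint T (p.X₁ (p.P u)) := by
      have : S (C u) = -((S * W) (ContinuousLinearMap.adjoint T (p.X₁ (p.P u)))) := by
        simp [C]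
      rw [this, hW]; rfl
    have h2 : ⟪T g, T (C u)⟫_ℂ = ⟪g, S (C u)⟫_ℂ :=
      (ContinuousLinearMap.adjoint_inner_right T g (T (C u))).symm
    rw [h2, h1, inner_neg_right, ContinuousLinearMap.adjoint_inner_right]
  have hmem : ∀ u, ((C u).1.fst, (C u).1.snd) ∈ p.X₀.graph := fun u => (C u).2.1
  refine ⟨(WithLp.fstL 2 ℂ H K) ∘L G.subtypeL ∘L C,
    fun u => (LinearPMap.mem_graph_iff_exists.1 (hmem u)).1, fun u => (C u).2.2,
    fun u ζ hζ => ?_⟩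
  obtain ⟨h1, h2⟩ := LinearPMap.mem_graph_iff_exists.1 (hmem u)
  let g : G := ⟨WithLp.toLp 2 ((ζ : H), p.X₀ ζ), p.X₀.mem_graph ζ, hζ⟩
  have h3 := hC u g
  rw [hT, hT] at h3
  change ⟪p.X₀ ζ, (C u).1.snd⟫_ℂ = -⟪p.X₀ ζ, p.X₁ (p.P u)⟫_ℂ at h3
  rw [← h2] at h3
  exact h3

theorem isCorrector_Z {a : ℝ} (ha0 : 0 < a) (ha : ENNReal.ofReal a < p.d₀) :
    p.IsCorrector p.Z := by
  have h := p.exists_isCorrector ha0 ha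
  rw [Z, dif_pos h]
  exact h.choose_spec

theorem RP_apply_eq (p : OperatorPencil H K) (u : H) : p.RP u = p.Pstar (p.X₁ (p.P u)) := rfl

/-- The range of `R` is orthogonal to the range of `X₀`. -/
theorem inner_RP (p : OperatorPencil H K) (u : H) {x : H} {z : K} (hx : (x, z) ∈ p.X₀.graph) :
    ⟪p.RP u, z⟫_ℂ = 0 := by
  have hcl : p.𝔑star.topologicalClosure = p.𝔑star :=
    (isClosed_unboundedKer (LinearPMap.adjoint_isClosed p.dense_domain)).submodule_topologicalClosure_eq
  have h1 : p.RP u ∈ p.𝔑star := by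
    rw [← hcl]
    exact Submodule.starProjection_apply_mem _ _
  obtain ⟨⟨y, hy⟩, hy0, hyu⟩ := h1
  obtain ⟨hx', rfl⟩ := LinearPMap.mem_graph_iff_exists.1 hx
  have h2 := LinearPMap.adjoint_isFormalAdjoint p.dense_domain ⟨y, hy⟩ ⟨x, hx'⟩
  have hy0' : p.X₀† ⟨y, hy⟩ = 0 := hy0
  rw [hy0', inner_zero_left] at h2
  have hyu' : y = p.RP u := hyu
  rw [← hyu']
  exact h2.symm

namespace IsCorrector

variable {Z : H →L[ℂ] H}

theorem graph (h : p.IsCorrector Z) (u : H) : (Z u, p.RP u - p.X₁ (p.P u)) ∈ p.X₀.graph := by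
  rw [h.RP_apply u, add_sub_cancel_right]
  exact p.X₀.mem_graph_mk _

theorem P_apply (h : p.IsCorrector Z) (u : H) : p.P (Z u) = 0 := P_eq_zero (h.mem_orthogonal u)

theorem P_comp (h : p.IsCorrector Z) : p.P * Z = 0 := by
  ext u; exact h.P_apply u

/-- This is uniqueness of the corrector: Z(Pu) and Zu have the same image under X₀ and lie in 𝔑ᗮ,
where the gap makes X₀ injective. -/
theorem comp_P (h : p.IsCorrector Z) {a : ℝ} (ha0 : 0 < a) (ha : ENNReal.ofReal a < p.d₀) :
    Z * p.P = Z := by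
  ext u
  have h1 := p.X₀.graph.sub_mem (h.graph (p.P u)) (h.graph u)
  have h2 : p.P (p.P u) = p.P u := P_eq_self (p.P_mem u)
  rw [RP_apply_eq, RP_apply_eq, h2, Prod.mk_sub_mk, sub_self] at h1
  have h3 := p.gap ha h1 (p.𝔑ᗮ.sub_mem (h.mem_orthogonal _) (h.mem_orthogonal _))
  rw [norm_zero] at h3
  have h4 : ‖Z (p.P u) - Z u‖ ^ 2 = 0 := by
    nlinarith [sq_nonneg ‖Z (p.P u) - Z u‖]
  have h5 : Z (p.P u) - Z u = 0 := by simpa using h4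
  exact sub_eq_zero.1 h5

/-- The a priori estimates of the corrector. -/
theorem estimate (h : p.IsCorrector Z) {a : ℝ} (ha : ENNReal.ofReal a < p.d₀) (u : H) :
    a * ‖Z u‖ ^ 2 + ‖p.RP u‖ ^ 2 ≤ ‖p.X₁‖ ^ 2 * ‖u‖ ^ 2 := by
  have h1 := p.gap ha (h.graph u) (h.mem_orthogonal u)
  -- X₁Pu is the orthogonal sum of RPu and -X₀Zu, because RPu is orthogonal to the range of X₀.
  have h2 : ‖p.X₁ (p.P u)‖ ^ 2 = ‖p.RP u‖ ^ 2 + ‖p.RP u - p.X₁ (p.P u)‖ ^ 2 := by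
    have h3 : ⟪p.RP u, p.X₁ (p.P u) - p.RP u⟫_ℂ = 0 := by
      have := p.inner_RP u (h.graph u)
      rw [← neg_sub, inner_neg_right, this, neg_zero]
    have h4 : p.X₁ (p.P u) = p.RP u + (p.X₁ (p.P u) - p.RP u) := by abel
    conv_lhs => rw [h4]
    rw [norm_sub_rev (p.RP u), sq, sq, sq]
    exact norm_add_sq_eq_norm_sq_add_norm_sq_of_inner_eq_zero _ _ h3
  have h5 : ‖p.X₁ (p.P u)‖ ^ 2 ≤ ‖p.X₁‖ ^ 2 * ‖u‖ ^ 2 := by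
    rw [← mul_pow]
    refine pow_le_pow_left₀ (norm_nonneg _) ((p.X₁.le_opNorm _).trans ?_) 2
    refine mul_le_mul_of_nonneg_left ?_ (norm_nonneg _)
    exact Submodule.norm_starProjection_apply_le _ _
  linarith

end IsCorrector

end OperatorPencil

/-! ## Estimates for bounded operators close to each other -/

section OperatorEstimates

variable {H : Type*} [NormedAddCommGroup H] [InnerProductSpace ℂ H] [CompleteSpace H]

/-- A norm bound from the spectral separation in an operator equation `V X + X V₀ = Y`, where
`X` vanishes on the orthogonal complement of a finite-dimensional subspace. -/
theorem norm_le_of_sylvester {L : Submodule ℂ H} [FiniteDimensional ℂ L] {P V V₀ X Y : H →L[ℂ] H}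
    (hP : ∀ u, P u ∈ L) (hP1 : ‖P‖ ≤ 1) (hXP : X * P = X) {a : ℝ}
    (hV : ∀ u, a * ‖X u‖ ^ 2 ≤ (⟪X u, V (X u)⟫_ℂ).re)
    (hV₀ : ∀ u ∈ L, a * ‖u‖ ^ 2 ≤ (⟪u, V₀ u⟫_ℂ).re) (hY : V * X + X * V₀ = Y) :
    2 * a * ‖X‖ ≤ ‖Y‖ := by
  rcases eq_or_ne X 0 with rfl | hX
  · simp
  have hXu : ∀ u, X u = X (P u) := fun u => by
    conv_lhs => rw [← hXP]
    rfl
  have hne : Nontrivial L := by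
    by_contra hn
    rw [not_nontrivial_iff_subsingleton] at hn
    refine hX (ContinuousLinearMap.ext fun u => ?_)
    have : (⟨P u, hP u⟩ : L) = 0 := Subsingleton.elim _ _
    rw [hXu u, show P u = 0 from congrArg Subtype.val this, map_zero, zero_apply]
  -- Finite dimension of L makes the norm of X attained at a unit vector of L.
  obtain ⟨u₀, hu₀, hmax⟩ := (isCompact_sphere (0 : L) 1).exists_isMaxOn
    (NormedSpace.sphere_nonempty.2 zero_le_one)
    (f := fun u : L => ‖X u‖) (by fun_prop)
  set u : H := (u₀ : H) with hu
  have hu1 : ‖u‖ = 1 := mem_sphere_zero_iff_norm.1 hu₀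
  set M := ‖X u‖ with hM
  have hXle : ‖X‖ ≤ M := by
    refine X.opNorm_le_bound (norm_nonneg _) fun v => ?_
    have h1 : ‖X (P v)‖ ≤ M * ‖P v‖ := by
      rcases eq_or_ne (P v) 0 with h0 | h0
      · simp [h0]
      have hpos : 0 < ‖P v‖ := norm_pos_iff.2 h0
      let w : L := (((‖P v‖⁻¹ : ℝ)) : ℂ) • ⟨P v, hP v⟩
      have hw : w ∈ Metric.sphere (0 : L) 1 := by
        rw [mem_sphere_zero_iff_norm, norm_smul, Complex.norm_real, norm_inv, norm_norm]
        exact inv_mul_cancel₀ hpos.ne'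
      have h2 : ‖X (w : H)‖ ≤ M := hmax hw
      have h3 : X (w : H) = ((‖P v‖⁻¹ : ℝ) : ℂ) • X (P v) := map_smul X _ _
      rw [h3, norm_smul, Complex.norm_real, norm_inv, norm_norm, inv_mul_le_iff₀ hpos] at h2
      linarith
    rw [hXu v]
    refine h1.trans (mul_le_mul_of_nonneg_left ?_ (norm_nonneg _))
    exact (P.le_opNorm v).trans (by nlinarith [norm_nonneg v])
  have hMle : M ≤ ‖X‖ := by
    have := X.le_opNorm u
    rwa [hu1, mul_one] at this
  have hMX : M = ‖X‖ := le_antisymm hMle hXle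
  set X' := ContinuousLinearMap.adjoint X with hX'
  -- A maximizing unit vector is an eigenvector of X^*X: expanding ‖X^*Xu - M²u‖² gives at most M⁴ -
  -- 2M⁴ + M⁴. Pairing the equation with Xu then lets V₀ act on u itself.
  have hXX : X' (X u) = ((M ^ 2 : ℝ) : ℂ) • u := by
    rw [← sub_eq_zero, ← norm_eq_zero, ← sq_eq_zero_iff]
    have h1 : ‖X' (X u)‖ ≤ M ^ 2 := by
      refine (X'.le_opNorm _).trans ?_
      rw [hX', LinearIsometryEquiv.norm_map, ← hMX, sq]
    have h2 := norm_sub_sq (𝕜 := ℂ) (X' (X u)) (((M ^ 2 : ℝ) : ℂ) • u)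
    have h3 : ⟪X' (X u), ((M ^ 2 : ℝ) : ℂ) • u⟫_ℂ = ((M ^ 2 * M ^ 2 : ℝ) : ℂ) := by
      rw [inner_smul_right, hX', ContinuousLinearMap.adjoint_inner_left, inner_self_eq_ofReal,
        Complex.ofReal_mul]
    rw [h3, norm_smul, hu1, Complex.norm_real, Real.norm_of_nonneg (sq_nonneg _)] at h2
    have h4 : RCLike.re ((M ^ 2 * M ^ 2 : ℝ) : ℂ) = M ^ 2 * M ^ 2 := Complex.ofReal_re _
    rw [h4] at h2
    nlinarith [sq_nonneg ‖X' (X u) - ((M ^ 2 : ℝ) : ℂ) • u‖, norm_nonneg (X' (X u))]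
  have h1 := hV u
  have h2 := hV₀ u u₀.2
  have h3 : (⟪X u, Y u⟫_ℂ).re = (⟪X u, V (X u)⟫_ℂ).re + M ^ 2 * (⟪u, V₀ u⟫_ℂ).re := by
    have h4 : Y u = V (X u) + X (V₀ u) := by rw [← hY]; rfl
    have h5 : ⟪X u, X (V₀ u)⟫_ℂ = ((M ^ 2 : ℝ) : ℂ) * ⟪u, V₀ u⟫_ℂ := by
      rw [← ContinuousLinearMap.adjoint_inner_left, ← hX', hXX, inner_smul_left,
        Complex.conj_ofReal]
    rw [h4, inner_add_right, h5, Complex.add_re, Complex.re_ofReal_mul]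
  have h4 : (⟪X u, Y u⟫_ℂ).re ≤ M * ‖Y‖ := by
    refine (Complex.re_le_norm _).trans ((norm_inner_le_norm _ _).trans ?_)
    refine mul_le_mul_of_nonneg_left ?_ (norm_nonneg _)
    have := Y.le_opNorm u
    rwa [hu1, mul_one] at this
  rw [hu1] at h2
  have hMpos : 0 < M := by rw [hMX]; exact norm_pos_iff.2 hX
  rw [← hMX]
  have h5 : M * (2 * a * M) ≤ M * ‖Y‖ := by
    nlinarith [mul_le_mul_of_nonneg_left h2 (sq_nonneg M)]
  exact le_of_mul_le_mul_left h5 hMpos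

theorem mul_mul_of_mul_eq {M : Type*} [Semigroup M] {a b c : M} (h : a * b = c) (x : M) :
    a * (b * x) = c * x := by
  rw [← mul_assoc, h]

variable {F P z : H →L[ℂ] H} {θ : ℝ}

/-- The approximate projection `(P + z) (P + z)^*`. -/
theorem norm_sub_mul_star_le (hF : IsStarProjection F)
    (hP : IsStarProjection P) (hPz : P * z = 0) (hzP : z * P = z) (hθ0 : 0 ≤ θ) (hθ1 : θ ≤ 1)
    (hz : ‖z‖ ≤ θ) (hFP : ‖F - P‖ ≤ 3 * θ) (hU : ‖(1 - F) * (P + z)‖ ≤ 2 * θ ^ 2) :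
    ‖F - (P + z) * star (P + z)‖ ≤ 48 * θ ^ 2 := by
  have hFs : star F = F := hF.isSelfAdjoint
  have hPs : star P = P := hP.isSelfAdjoint
  have hFF : F * F = F := hF.isIdempotentElem
  have hPP : P * P = P := hP.isIdempotentElem
  have hzsP : star z * P = 0 := by
    have := congrArg star hPz
    rwa [star_mul, hPs, star_zero] at this
  have hPzs : P * star z = star z := by
    have := congrArg star hzP
    rwa [star_mul, hPs] at this
  have hP1 : ‖P‖ ≤ 1 := hP.norm_le
  have hzs : ‖star z‖ ≤ θ := by rwa [norm_star]
  set U := P + z with hUdef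
  have hUs : star U = P + star z := by rw [hUdef, star_add, hPs]
  have hU2 : ‖U‖ ≤ 2 := (norm_add_le_of_le hP1 hz).trans (by linarith)
  have hU2s : ‖star U‖ ≤ 2 := by rwa [norm_star]
  have hUU : star U * U = P + star z * z := by
    rw [hUs, hUdef]
    linear_combination (norm := noncomm_ring) hPP + hPz + hzsP
  have hUP : U * P = U := by
    rw [hUdef]
    linear_combination (norm := noncomm_ring) hPP + hzP
  set D := F - U * star U with hD
  have h1 : star ((1 - F) * U) = star U * (1 - F) := by rw [star_mul, star_sub, star_one, hFs]
  -- The operator F is a projection and UU^* nearly is one, since U^*U = P + z^*z. Hence D equals D²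
  -- up to terms already of order θ², and a first-order bound on D suffices: 36 + 4 + 4 + 4 = 48.
  have key : D = D * D - (1 - F) * U * star U - U * star ((1 - F) * U)
      - U * (star z * z) * star U := by
    rw [h1, hD]
    linear_combination (norm := noncomm_ring) -hFF - U * hUU * star U - hUP * star U
  have hDle : ‖D‖ ≤ 6 * θ := by
    have h2 : D = (F - P) - (P * star z + z * P + z * star z) := by
      rw [hD, hUs, hUdef]
      linear_combination (norm := noncomm_ring) -hPP
    rw [h2, hPzs, hzP]
    refine (norm_sub_le_of_le hFP (norm_add_le_of_le (norm_add_le_of_le hzs hz) (norm_mul_le_of_le hz hzs))).trans ?_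
    nlinarith
  have hUs' : ‖star ((1 - F) * U)‖ ≤ 2 * θ ^ 2 := by rwa [norm_star]
  rw [key]
  refine (norm_sub_le_of_le (norm_sub_le_of_le (norm_sub_le_of_le (norm_mul_le_of_le hDle hDle)
    (norm_mul_le_of_le hU hU2s)) (norm_mul_le_of_le hU2 hUs'))
    (norm_mul_le_of_le (norm_mul_le_of_le hU2 (norm_mul_le_of_le hzs hz)) hU2s)).trans ?_
  nlinarith

/-- Comparison of `B` with its compression. -/
theorem norm_sub_germ_le {B T n : H →L[ℂ] H} {m : ℝ} (hF : IsStarProjection F)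
    (hP : IsStarProjection P) (hθ1 : θ ≤ 1)
    (hz : ‖z‖ ≤ θ) (hFB : F * B = B) (hBF : B * F = B) (hB : ‖B‖ ≤ 9 * m ^ 2)
    (hD : ‖F - (P + z) * star (P + z)‖ ≤ 48 * θ ^ 2) (hPT : P * T = T) (hTP : T * P = T)
    (hPn : P * n = n) (hnP : n * P = n) (hT : ‖T‖ ≤ m ^ 2) (hn : ‖n‖ ≤ m ^ 2 * θ)
    (hE : ‖star (P + z) * B * (P + z) - T - n‖ ≤ 5 * m ^ 2 * θ ^ 2) :
    ‖B - T - n - z * T - T * star z‖ ≤ 2200 * m ^ 2 * θ ^ 2 := by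
  have hPs : star P = P := hP.isSelfAdjoint
  have hP1 : ‖P‖ ≤ 1 := hP.norm_le
  have hF1 : ‖F‖ ≤ 1 := hF.norm_le
  have hzs : ‖star z‖ ≤ θ := by rwa [norm_star]
  set U := P + z with hUdef
  have hUs : star U = P + star z := by rw [hUdef, star_add, hPs]
  have hU2 : ‖U‖ ≤ 2 := (norm_add_le_of_le hP1 hz).trans (by linarith)
  have hU2s : ‖star U‖ ≤ 2 := by rwa [norm_star]
  set D := F - U * star U with hDdef
  set E := star U * B * U - T - n with hEdef
  -- Replace both copies of F in B = FBF by UU^* + D, insert U^*BU = T + n + E, and expand. Only n,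
  -- zT and Tz^* survive beyond T at first order.
  have key : B - T - n - z * T - T * star z = D * B * F + U * star U * B * D + U * E * star U
      + z * T * star z + (z * n + n * star z) + z * n * star z := by
    have h1 : U * (T + n) * star U = T + n + z * T + T * star z + z * T * star z + z * n
        + n * star z + z * n * star z := by
      rw [hUs, hUdef]
      linear_combination (norm := noncomm_ring)
        (P + z) * hTP + hPT + hPT * star z + (P + z) * hnP + hPn + hPn * star z
    rw [hDdef, hEdef]
    linear_combination (norm := noncomm_ring) h1 - hFB * F - hBF
  rw [key]
  have hn0 := norm_nonneg n
  have hT0 := norm_nonneg T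
  refine (norm_add_le_of_le (norm_add_le_of_le (norm_add_le_of_le (norm_add_le_of_le
    (norm_add_le_of_le
    (norm_mul_le_of_le (norm_mul_le_of_le hD hB) hF1)
    (norm_mul_le_of_le (norm_mul_le_of_le (norm_mul_le_of_le hU2 hU2s) hB) hD))
    (norm_mul_le_of_le (norm_mul_le_of_le hU2 hE) hU2s))
    (norm_mul_le_of_le (norm_mul_le_of_le hz hT) hzs))
    (norm_add_le_of_le (norm_mul_le_of_le hz hn) (norm_mul_le_of_le hn hzs)))
    (norm_mul_le_of_le (norm_mul_le_of_le hz hn) hzs)).trans ?_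
  have : m ^ 2 * θ ^ 2 * θ ≤ m ^ 2 * θ ^ 2 * 1 := mul_le_mul_of_nonneg_left hθ1 (by positivity)
  nlinarith [sq_nonneg (m * θ)]

/-- The first-order comparison of the square roots. -/
theorem norm_sqrt_sub_le {V V₀ g : H →L[ℂ] H} {m a κ : ℝ} (hF : IsStarProjection F)
    (hP : IsStarProjection P) (ha : 0 < a) (hm : m = a * κ) (hθ0 : 0 ≤ θ) (hθ1 : θ ≤ 1)
    (hz : ‖z‖ ≤ θ) (hFV : F * V = V) (hVF : V * F = V) (hV₀P : V₀ * P = V₀) (hPV₀ : P * V₀ = V₀)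
    (hV₀ : ‖V₀‖ ≤ m) (hgn : ‖V₀ * g + g * V₀‖ ≤ m ^ 2 * θ)
    (hB : ‖V * V - V₀ * V₀ - (V₀ * g + g * V₀) - z * (V₀ * V₀) - V₀ * V₀ * star z‖
      ≤ 2200 * m ^ 2 * θ ^ 2)
    (hS : ∀ X : H →L[ℂ] H, F * X = X → X * P = X → 2 * a * ‖X‖ ≤ ‖V * X + X * V₀‖) :
    ‖F * (V - V₀) * P‖ ≤ 1102 * m * θ * κ := by
  have hFF : F * F = F := hF.isIdempotentElem
  have hPP : P * P = P := hP.isIdempotentElem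
  have hzs : ‖star z‖ ≤ θ := by rwa [norm_star]
  have h1 : ‖V * V - V₀ * V₀‖ ≤ 2203 * m ^ 2 * θ := by
    have : V * V - V₀ * V₀ = (V * V - V₀ * V₀ - (V₀ * g + g * V₀) - z * (V₀ * V₀)
        - V₀ * V₀ * star z) + (V₀ * g + g * V₀) + z * (V₀ * V₀) + V₀ * V₀ * star z := by abel
    rw [this]
    refine (norm_add_le_of_le (norm_add_le_of_le (norm_add_le_of_le hB hgn)
      (norm_mul_le_of_le hz (norm_mul_le_of_le hV₀ hV₀)))
      (norm_mul_le_of_le (norm_mul_le_of_le hV₀ hV₀) hzs)).trans ?_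
    have : m ^ 2 * θ * θ ≤ m ^ 2 * θ * 1 := mul_le_mul_of_nonneg_left hθ1 (by positivity)
    nlinarith
  have h2 := hS (F * (V - V₀) * P) (by linear_combination (norm := noncomm_ring) hFF * (V - V₀) * P)
    (by linear_combination (norm := noncomm_ring) F * (V - V₀) * hPP)
  -- The noncommutative difference of squares is V(V - V₀) + (V - V₀)V₀ = V² - V₀², so the Sylvester
  -- bound gains a factor 1/(2a).
  have h3 : V * (F * (V - V₀) * P) + F * (V - V₀) * P * V₀ = F * (V * V - V₀ * V₀) * P := by
    simp only [mul_sub, sub_mul, mul_add, add_mul, mul_assoc, one_mul, mul_one,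
      hFV, hVF, hV₀P, hPV₀, mul_mul_of_mul_eq hFV, mul_mul_of_mul_eq hVF, mul_mul_of_mul_eq hV₀P, mul_mul_of_mul_eq hPV₀]
    abel
  have h4 : ‖F * (V * V - V₀ * V₀) * P‖ ≤ 1 * (2203 * m ^ 2 * θ) * 1 :=
    norm_mul_le_of_le (norm_mul_le_of_le hF.norm_le h1) hP.norm_le
  rw [h3] at h2
  have h5 : 2 * a * ‖F * (V - V₀) * P‖ ≤ 2 * a * (1102 * m * θ * κ) := by
    have h6 : m ^ 2 * θ = a * (m * θ * κ) := by rw [hm]; ring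
    have h7 : 0 ≤ m ^ 2 * θ := by positivity
    nlinarith
  exact le_of_mul_le_mul_left h5 (by positivity)

set_option maxHeartbeats 800000 in
/-- The second-order comparison of the square roots. -/
theorem norm_sqrt_sub_sub_le {V V₀ g : H →L[ℂ] H} {m a κ : ℝ} (hF : IsStarProjection F)
    (hP : IsStarProjection P) (ha : 0 < a) (hm : m = a * κ) (hκ : 1 ≤ κ)
    (hθ0 : 0 ≤ θ) (hθ1 : θ ≤ 1) (hPz : P * z = 0) (hzP : z * P = z)
    (hz : ‖z‖ ≤ θ) (hFV : F * V = V) (hVF : V * F = V) (hV₀P : V₀ * P = V₀) (hPV₀ : P * V₀ = V₀)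
    (hPg : P * g = g) (hgP : g * P = g)
    (hV : ‖V‖ ≤ 3 * m) (hV₀ : ‖V₀‖ ≤ m) (hg : ‖g‖ ≤ m * θ * κ)
    (hD : ‖F - (P + z) * star (P + z)‖ ≤ 48 * θ ^ 2) (hFP : ‖(1 - F) * P‖ ≤ θ)
    (hFU : ‖(1 - F) * (P + z)‖ ≤ 2 * θ ^ 2)
    (hB : ‖V * V - V₀ * V₀ - (V₀ * g + g * V₀) - z * (V₀ * V₀) - V₀ * V₀ * star z‖
      ≤ 2200 * m ^ 2 * θ ^ 2)
    (hX : ‖F * (V - V₀) * P‖ ≤ 1102 * m * θ * κ)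
    (hS : ∀ X : H →L[ℂ] H, F * X = X → X * P = X → 2 * a * ‖X‖ ≤ ‖V * X + X * V₀‖) :
    ‖V - V₀ - z * V₀ - V₀ * star z - g‖ ≤ 5000 * m * θ ^ 2 * κ ^ 3 := by
  have hPs : star P = P := hP.isSelfAdjoint
  have hFF : F * F = F := hF.isIdempotentElem
  have hPP : P * P = P := hP.isIdempotentElem
  have hP1 : ‖P‖ ≤ 1 := hP.norm_le
  have hF1 : ‖F‖ ≤ 1 := hF.norm_le
  have hP1' : ‖1 - P‖ ≤ 1 := hP.one_sub.norm_le
  have hzs : ‖star z‖ ≤ θ := by rwa [norm_star]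
  have hzsP : star z * P = 0 := by
    have := congrArg star hPz
    rwa [star_mul, hPs, star_zero] at this
  have hPzs : P * star z = star z := by
    have := congrArg star hzP
    rwa [star_mul, hPs] at this
  have hUs : star (P + z) = P + star z := by rw [star_add, hPs]
  have hV₀z : V₀ * z = 0 := by rw [← hV₀P, mul_assoc, hPz, mul_zero]
  have hgz : g * z = 0 := by rw [← hgP, mul_assoc, hPz, mul_zero]
  have hzsV₀ : star z * V₀ = 0 := by rw [← hPV₀, ← mul_assoc, hzsP, zero_mul]
  have hzsg : star z * g = 0 := by rw [← hPg, ← mul_assoc, hzsP, zero_mul]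
  have hm0 : 0 < m := by rw [hm]; positivity
  set L := V₀ + z * V₀ + V₀ * star z + g with hL
  have hΔ : V - V₀ - z * V₀ - V₀ * star z - g = V - L := by rw [hL]; abel
  rw [hΔ]
  have hθκ : 0 ≤ m * θ := by positivity
  have hzg : ‖z * V₀ + g‖ ≤ 2 * m * θ * κ := by
    refine (norm_add_le_of_le (norm_mul_le_of_le hz hV₀) hg).trans ?_
    nlinarith
  -- The approximant L is built so that L² reproduces the expansion of V² through first order in θ;
  -- the cross terms V₀z and z^*V₀ vanish.
  have hLL : ‖V * V - L * L‖ ≤ 2205 * m ^ 2 * θ ^ 2 * κ ^ 2 := by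
    have h1 : V * V - L * L
        = (V * V - V₀ * V₀ - (V₀ * g + g * V₀) - z * (V₀ * V₀) - V₀ * V₀ * star z)
          - (z * (V₀ * V₀) * star z + V₀ * (star z * z) * V₀ + (z * V₀ * g + g * V₀ * star z)
            + g * g) := by
      rw [hL]
      simp only [mul_sub, sub_mul, mul_add, add_mul, mul_assoc, one_mul, mul_one,
        hPP, hFF, hFV, hVF, hV₀P, hPV₀, hPg, hgP, hzsP, hPzs, hPz, hzP, hV₀z, hgz, hzsV₀, hzsg, mul_mul_of_mul_eq hPP, mul_mul_of_mul_eq hFF, mul_mul_of_mul_eq hFV, mul_mul_of_mul_eq hVF, mul_mul_of_mul_eq hV₀P, mul_mul_of_mul_eq hPV₀, mul_mul_of_mul_eq hPg, mul_mul_of_mul_eq hgP, mul_mul_of_mul_eq hzsP, mul_mul_of_mul_eq hPzs, mul_mul_of_mul_eq hPz, mul_mul_of_mul_eq hzP, mul_mul_of_mul_eq hV₀z, mul_mul_of_mul_eq hgz, mul_mul_of_mul_eq hzsV₀, mul_mul_of_mul_eq hzsg,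
        zero_mul, mul_zero]
      abel
    rw [h1]
    refine (norm_sub_le_of_le hB (norm_add_le_of_le (norm_add_le_of_le (norm_add_le_of_le
      (norm_mul_le_of_le (norm_mul_le_of_le hz (norm_mul_le_of_le hV₀ hV₀)) hzs)
      (norm_mul_le_of_le (norm_mul_le_of_le hV₀ (norm_mul_le_of_le hzs hz)) hV₀))
      (norm_add_le_of_le (norm_mul_le_of_le (norm_mul_le_of_le hz hV₀) hg)
        (norm_mul_le_of_le (norm_mul_le_of_le hg hV₀) hzs)))
      (norm_mul_le_of_le hg hg))).trans ?_
    have h2 : 0 ≤ m ^ 2 * θ ^ 2 := by positivity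
    have h3 : m ^ 2 * θ ^ 2 * 1 ≤ m ^ 2 * θ ^ 2 * κ ^ 2 :=
      mul_le_mul_of_nonneg_left (one_le_pow₀ hκ) h2
    have h4 : m ^ 2 * θ ^ 2 * κ ≤ m ^ 2 * θ ^ 2 * κ ^ 2 :=
      mul_le_mul_of_nonneg_left (by nlinarith) h2
    linarith
  -- Off 𝔑 no Sylvester bound is needed: V(1 - P) = VF(1 - P), and F = UU^* + D with U^*(1 - P) =
  -- z^* gives an error already of order θ².
  have hFΔ : F * (V - L) * (1 - P) = V * (F - (P + z) * star (P + z)) * (1 - P)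
      + V * z * star z + F * (V - V₀) * P * star z := by
    rw [hL, hUs]
    simp only [mul_sub, sub_mul, mul_add, add_mul, mul_assoc, one_mul, mul_one,
      hPP, hFF, hFV, hVF, hV₀P, hPV₀, hPg, hgP, hzsP, hPzs, hPz, hzP, hV₀z, hgz, hzsV₀, hzsg, mul_mul_of_mul_eq hPP, mul_mul_of_mul_eq hFF, mul_mul_of_mul_eq hFV, mul_mul_of_mul_eq hVF, mul_mul_of_mul_eq hV₀P, mul_mul_of_mul_eq hPV₀, mul_mul_of_mul_eq hPg, mul_mul_of_mul_eq hgP, mul_mul_of_mul_eq hzsP, mul_mul_of_mul_eq hPzs, mul_mul_of_mul_eq hPz, mul_mul_of_mul_eq hzP, mul_mul_of_mul_eq hV₀z, mul_mul_of_mul_eq hgz, mul_mul_of_mul_eq hzsV₀, mul_mul_of_mul_eq hzsg,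
      zero_mul, mul_zero]
    abel
  have hFΔ1 : ‖F * (V - L) * (1 - P)‖ ≤ 1249 * m * θ ^ 2 * κ := by
    rw [hFΔ]
    refine (norm_add_le_of_le (norm_add_le_of_le
      (norm_mul_le_of_le (norm_mul_le_of_le hV hD) hP1')
      (norm_mul_le_of_le (norm_mul_le_of_le hV hz) hzs)) (norm_mul_le_of_le hX hzs)).trans ?_
    nlinarith [mul_le_mul_of_nonneg_left hκ (by positivity : 0 ≤ m * θ ^ 2)]
  have hFΔP : F * (V - L) * P = F * (V - V₀) * P - F * (z * V₀ + g) := by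
    rw [hL]
    simp only [mul_sub, sub_mul, mul_add, add_mul, mul_assoc, one_mul, mul_one,
      hPP, hFF, hFV, hVF, hV₀P, hPV₀, hPg, hgP, hzsP, hPzs, hPz, hzP, hV₀z, hgz, hzsV₀, hzsg, mul_mul_of_mul_eq hPP, mul_mul_of_mul_eq hFF, mul_mul_of_mul_eq hFV, mul_mul_of_mul_eq hVF, mul_mul_of_mul_eq hV₀P, mul_mul_of_mul_eq hPV₀, mul_mul_of_mul_eq hPg, mul_mul_of_mul_eq hgP, mul_mul_of_mul_eq hzsP, mul_mul_of_mul_eq hPzs, mul_mul_of_mul_eq hPz, mul_mul_of_mul_eq hzP, mul_mul_of_mul_eq hV₀z, mul_mul_of_mul_eq hgz, mul_mul_of_mul_eq hzsV₀, mul_mul_of_mul_eq hzsg,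
      zero_mul, mul_zero]
    abel
  have hFΔ2 : ‖F * (V - L)‖ ≤ 2353 * m * θ * κ := by
    have h1 : F * (V - L) = F * (V - V₀) * P - F * (z * V₀ + g) + F * (V - L) * (1 - P) := by
      rw [← hFΔP]; noncomm_ring
    rw [h1]
    refine (norm_add_le_of_le (norm_sub_le_of_le hX (norm_mul_le_of_le hF1 hzg)) hFΔ1).trans ?_
    have : m * θ * κ * θ ≤ m * θ * κ * 1 := mul_le_mul_of_nonneg_left hθ1 (by positivity)
    nlinarith
  have hX2 : ‖F * (V - L) * P‖ ≤ 3456 * m * θ ^ 2 * κ ^ 3 := by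
    have h2 := hS (F * (V - L) * P)
      (by linear_combination (norm := noncomm_ring) hFF * (V - L) * P)
      (by linear_combination (norm := noncomm_ring) F * (V - L) * hPP)
    -- On 𝔑 one has LP = V₀ + zV₀ + g. Thus V² - L² yields the Sylvester expression plus a product
    -- of two first-order terms, and dividing by 2a raises the power of κ to 3.
    have h3 : V * (F * (V - L) * P) + F * (V - L) * P * V₀
        = F * (V * V - L * L) * P - F * (V - L) * (z * V₀ + g) := by
      rw [hL]
      simp only [mul_sub, sub_mul, mul_add, add_mul, mul_assoc, one_mul, mul_one,
        hPP, hFF, hFV, hVF, hV₀P, hPV₀, hPg, hgP, hzsP, hPzs, hPz, hzP, hV₀z, hgz, hzsV₀, hzsg, mul_mul_of_mul_eq hPP, mul_mul_of_mul_eq hFF, mul_mul_of_mul_eq hFV, mul_mul_of_mul_eq hVF, mul_mul_of_mul_eq hV₀P, mul_mul_of_mul_eq hPV₀, mul_mul_of_mul_eq hPg, mul_mul_of_mul_eq hgP, mul_mul_of_mul_eq hzsP, mul_mul_of_mul_eq hPzs, mul_mul_of_mul_eq hPz, mul_mul_of_mul_eq hzP, mul_mul_of_mul_eq hV₀z, mul_mul_of_mul_eq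 hgz, mul_mul_of_mul_eq hzsV₀, mul_mul_of_mul_eq hzsg,
        zero_mul, mul_zero]
      abel
    rw [h3] at h2
    have h4 := h2.trans (norm_sub_le_of_le (norm_mul_le_of_le (norm_mul_le_of_le hF1 hLL) hP1)
      (norm_mul_le_of_le hFΔ2 hzg))
    have h6 : m ^ 2 * θ ^ 2 * κ ^ 2 = a * (m * θ ^ 2 * κ ^ 3) := by rw [hm]; ring
    have h5 : 2 * a * ‖F * (V - L) * P‖ ≤ 2 * a * (3456 * m * θ ^ 2 * κ ^ 3) := by
      refine h4.trans (le_of_sub_nonneg ?_)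
      have h7 : 0 ≤ m ^ 2 * θ ^ 2 * κ ^ 2 := by positivity
      have h8 : 2 * a * (3456 * m * θ ^ 2 * κ ^ 3) = 6912 * (m ^ 2 * θ ^ 2 * κ ^ 2) := by
        rw [h6]; ring
      rw [h8]
      ring_nf at h7 ⊢
      linarith
    exact le_of_mul_le_mul_left h5 (by positivity)
  -- The remaining part is -(1 - F)L, because (1 - F)V = 0. Its term with V₀ on the right combines
  -- into (1 - F)U, which is of second order.
  have h1 : V - L = F * (V - L) * P + F * (V - L) * (1 - P)
      - ((1 - F) * (P + z) * V₀ + (1 - F) * P * (V₀ * star z + g)) := by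
    rw [hL]
    simp only [mul_sub, sub_mul, mul_add, add_mul, mul_assoc, one_mul, mul_one,
      hPP, hFF, hFV, hVF, hV₀P, hPV₀, hPg, hgP, hzsP, hPzs, hPz, hzP, hV₀z, hgz, hzsV₀, hzsg, mul_mul_of_mul_eq hPP, mul_mul_of_mul_eq hFF, mul_mul_of_mul_eq hFV, mul_mul_of_mul_eq hVF, mul_mul_of_mul_eq hV₀P, mul_mul_of_mul_eq hPV₀, mul_mul_of_mul_eq hPg, mul_mul_of_mul_eq hgP, mul_mul_of_mul_eq hzsP, mul_mul_of_mul_eq hPzs, mul_mul_of_mul_eq hPz, mul_mul_of_mul_eq hzP, mul_mul_of_mul_eq hV₀z, mul_mul_of_mul_eq hgz, mul_mul_of_mul_eq hzsV₀, mul_mul_of_mul_eq hzsg,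
      zero_mul, mul_zero]
    abel
  rw [h1]
  refine (norm_sub_le_of_le (norm_add_le_of_le hX2 hFΔ1) (norm_add_le_of_le
    (norm_mul_le_of_le hFU hV₀)
    (norm_mul_le_of_le hFP (norm_add_le_of_le (norm_mul_le_of_le hV₀ hzs) hg)))).trans ?_
  have h2 : 0 ≤ m * θ ^ 2 := by positivity
  have h3 : m * θ ^ 2 * 1 ≤ m * θ ^ 2 * κ ^ 3 := mul_le_mul_of_nonneg_left (one_le_pow₀ hκ) h2
  have h4 : m * θ ^ 2 * κ ≤ m * θ ^ 2 * κ ^ 3 :=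
    mul_le_mul_of_nonneg_left (le_self_pow₀ hκ (by norm_num)) h2
  ring_nf at h2 h3 h4 ⊢
  linarith

end OperatorEstimates

/-! ## Threshold approximations for the pencil -/

namespace OperatorPencil

open Filter Topology

variable {H : Type*} [NormedAddCommGroup H] [InnerProductSpace ℂ H] [CompleteSpace H]
variable {K : Type*} [NormedAddCommGroup K] [InnerProductSpace ℂ K] [CompleteSpace K]
variable {p : OperatorPencil H K} {δ t₀ cstar t : ℝ}

theorem isStarProjection_F (p : OperatorPencil H K) (δ t : ℝ) : IsStarProjection (p.F δ t) :=
  (spectralMeasure (p.A t)).isStarProjection _ measurableSet_Icc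

theorem isSelfAdjoint_sqrtAF (p : OperatorPencil H K) (δ t : ℝ) :
    IsSelfAdjoint (p.sqrtAF δ t) :=
  (spectralMeasure (p.A t)).isSelfAdjoint_sqrtPart δ

theorem F_mul_sqrtAF (p : OperatorPencil H K) (δ t : ℝ) :
    p.F δ t * p.sqrtAF δ t = p.sqrtAF δ t :=
  (spectralMeasure (p.A t)).E_mul_sqrtPart δ

theorem sqrtAF_mul_F (p : OperatorPencil H K) (δ t : ℝ) :
    p.sqrtAF δ t * p.F δ t = p.sqrtAF δ t :=
  (spectralMeasure (p.A t)).sqrtPart_mul_E δ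

theorem exists_decomp (p : OperatorPencil H K) (δ t : ℝ) {v : H} {y : K}
    (hv : (v, y) ∈ (p.X t).graph) :
    ∃ w, (p.F δ t v, w) ∈ (p.X t).graph ∧ ‖w‖ = ‖p.sqrtAF δ t v‖ ∧ ⟪w, y - w⟫_ℂ = 0 ∧
      (v - p.F δ t v, y - w) ∈ (p.X t).graph ∧ δ * ‖v - p.F δ t v‖ ^ 2 ≤ ‖y - w‖ ^ 2 := by
  obtain ⟨w, h1, h2, h3, h4, h5, -⟩ := (p.isGramMeasure t).exists_decomp δ hv
  exact ⟨w, h1, h2, h3, h4, h5⟩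

theorem exists_graph_F (p : OperatorPencil H K) (δ t : ℝ) (u : H) :
    ∃ w, (p.F δ t u, w) ∈ (p.X t).graph ∧ ‖w‖ = ‖p.sqrtAF δ t u‖ := by
  obtain ⟨w, hw, -⟩ := (p.isGramMeasure t).exists_graph (s := Set.Icc 0 δ) measurableSet_Icc
    (M := |δ|) (fun x hx => by rw [abs_of_nonneg hx.1]; exact hx.2.trans (le_abs_self _)) u
  obtain ⟨w', h1, h2, -⟩ := p.exists_decomp δ t (v := p.F δ t u) hw
  refine ⟨w', ?_, ?_⟩
  · rwa [← mul_apply_eq_comp, (p.isStarProjection_F δ t).isIdempotentElem] at h1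
  · rwa [← mul_apply_eq_comp, p.sqrtAF_mul_F] at h2

/-- The small parameter `|t| ‖X₁‖ δ^{-1/2}`. -/
def smallness (p : OperatorPencil H K) (δ t : ℝ) : ℝ := |t| * ‖p.X₁‖ / √δ

theorem smallness_nonneg (p : OperatorPencil H K) (δ t : ℝ) : 0 ≤ p.smallness δ t := by
  unfold smallness; positivity

/-- The approximation `P + t Z` of the spectral projection. -/
def approxProj (p : OperatorPencil H K) (t : ℝ) : H →L[ℂ] H := p.P + (t : ℂ) • p.Z

theorem norm_P_apply_le (p : OperatorPencil H K) (u : H) : ‖p.P u‖ ≤ ‖u‖ :=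
  Submodule.norm_starProjection_apply_le _ _

theorem RP_mul_P (p : OperatorPencil H K) : p.RP ∘L p.P = p.RP := by
  ext u
  rw [ContinuousLinearMap.comp_apply, RP_apply_eq, RP_apply_eq, P_eq_self (p.P_mem u)]

namespace Assumptions

variable (h : p.Assumptions δ t₀ cstar)
include h

theorem X₁_pos : 0 < ‖p.X₁‖ := by
  refine (norm_nonneg _).lt_of_ne' fun h0 => ?_
  have := h.t₀_le
  rw [h0, inv_zero, mul_zero] at this
  exact absurd h.t₀_pos (not_lt.2 this)

theorem sqrt_δ_pos : 0 < √δ := Real.sqrt_pos.2 h.δ_pos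

theorem mul_smallness (t : ℝ) : √δ * p.smallness δ t = |t| * ‖p.X₁‖ := by
  rw [smallness, mul_div_cancel₀ _ h.sqrt_δ_pos.ne']

theorem smallness_le_one (ht : |t| ≤ t₀) : p.smallness δ t ≤ 1 := by
  rw [smallness, div_le_one h.sqrt_δ_pos]
  have := ht.trans h.t₀_le
  rwa [← div_eq_mul_inv, le_div_iff₀ h.X₁_pos] at this

theorem isCorrector : p.IsCorrector p.Z :=
  isCorrector_Z (by linarith [h.δ_pos] : 0 < 8 * δ) h.δ_lt

theorem Z_mul_P : p.Z * p.P = p.Z := h.isCorrector.comp_P (by linarith [h.δ_pos]) h.δ_lt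

theorem P_mul_Z : p.P * p.Z = 0 := h.isCorrector.P_comp

theorem estimate (u : H) : 8 * δ * ‖p.Z u‖ ^ 2 + ‖p.RP u‖ ^ 2 ≤ ‖p.X₁‖ ^ 2 * ‖u‖ ^ 2 :=
  h.isCorrector.estimate h.δ_lt u

theorem norm_RP_apply_le (u : H) : ‖p.RP u‖ ≤ ‖p.X₁‖ * ‖u‖ := by
  rw [← sq_le_sq₀ (norm_nonneg _) (by positivity), mul_pow]
  have := h.estimate u
  have h2 : 0 ≤ 8 * δ * ‖p.Z u‖ ^ 2 := by have := h.δ_pos; positivity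
  linarith

theorem norm_Z_apply_le (u : H) : √δ * ‖p.Z u‖ ≤ ‖p.X₁‖ * ‖u‖ := by
  have h0 := h.δ_pos
  rw [← sq_le_sq₀ (by positivity) (by positivity), mul_pow, mul_pow, Real.sq_sqrt h0.le]
  have h1 := h.estimate u
  have h2 : 0 ≤ δ * ‖p.Z u‖ ^ 2 := by positivity
  nlinarith [sq_nonneg ‖p.RP u‖]

theorem norm_smul_Z_le (t : ℝ) : ‖(t : ℂ) • p.Z‖ ≤ p.smallness δ t := by
  refine ContinuousLinearMap.opNorm_le_bound _ (p.smallness_nonneg δ t) fun u => ?_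
  rw [smul_apply, norm_smul, Complex.norm_real, Real.norm_eq_abs, smallness, div_mul_eq_mul_div,
    le_div_iff₀ h.sqrt_δ_pos]
  have := mul_le_mul_of_nonneg_left (h.norm_Z_apply_le u) (abs_nonneg t)
  linarith

theorem P_mul_smul_Z (t : ℝ) : p.P * ((t : ℂ) • p.Z) = 0 := by
  rw [mul_smul_comm, h.P_mul_Z, smul_zero]

theorem smul_Z_mul_P (t : ℝ) : ((t : ℂ) • p.Z) * p.P = (t : ℂ) • p.Z := by
  rw [smul_mul_assoc, h.Z_mul_P]

/-! ### The threshold projection -/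

/-- X(t)Pu is just tX₁Pu. Its two orthogonal components along F and 1 - F bound VPu and √δ(1 - F)Pu.
-/
theorem norm_P_sub_F_apply_le (t : ℝ) (u : H) :
    ‖p.P u - p.F δ t (p.P u)‖ ≤ p.smallness δ t * ‖u‖ ∧
      ‖p.sqrtAF δ t (p.P u)‖ ≤ |t| * ‖p.X₁‖ * ‖u‖ := by
  have hv : (p.P u, (t : ℂ) • p.X₁ (p.P u)) ∈ (p.X t).graph := by
    rw [mem_graph_X, sub_self]; exact p.P_graph u
  obtain ⟨w, -, h2, h3, -, h5⟩ := p.exists_decomp δ t hv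
  set y := (t : ℂ) • p.X₁ (p.P u) with hy
  have h6 : ‖y‖ ^ 2 = ‖w‖ ^ 2 + ‖y - w‖ ^ 2 := by
    conv_lhs => rw [show y = w + (y - w) by abel]
    rw [sq, sq, sq]
    exact norm_add_sq_eq_norm_sq_add_norm_sq_of_inner_eq_zero _ _ h3
  have h7 : ‖y‖ ≤ |t| * ‖p.X₁‖ * ‖u‖ := by
    rw [hy, norm_smul, Complex.norm_real, Real.norm_eq_abs, mul_assoc]
    refine mul_le_mul_of_nonneg_left ((p.X₁.le_opNorm _).trans ?_) (abs_nonneg t)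
    exact mul_le_mul_of_nonneg_left (p.norm_P_apply_le u) (norm_nonneg _)
  constructor
  · have h8 : √δ * ‖p.P u - p.F δ t (p.P u)‖ ≤ ‖y‖ := by
      rw [← sq_le_sq₀ (by positivity) (norm_nonneg _), mul_pow, Real.sq_sqrt h.δ_pos.le]
      nlinarith [sq_nonneg ‖w‖]
    refine le_of_mul_le_mul_left ?_ h.sqrt_δ_pos
    rw [← mul_assoc, h.mul_smallness]
    exact h8.trans h7
  · rw [← h2]
    refine le_trans ?_ h7
    rw [← sq_le_sq₀ (norm_nonneg _) (norm_nonneg _), h6]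
    linarith [sq_nonneg ‖y - w‖]

theorem norm_one_sub_F_mul_P_le (t : ℝ) : ‖(1 - p.F δ t) * p.P‖ ≤ p.smallness δ t :=
  ContinuousLinearMap.opNorm_le_bound _ (p.smallness_nonneg δ t) fun u =>
    (h.norm_P_sub_F_apply_le t u).1

theorem norm_sqrtAF_mul_P_le (t : ℝ) : ‖p.sqrtAF δ t * p.P‖ ≤ |t| * ‖p.X₁‖ :=
  ContinuousLinearMap.opNorm_le_bound _ (by positivity) fun u =>
    (h.norm_P_sub_F_apply_le t u).2

/-- An a priori bound for the absorption in `norm_one_sub_P_mul_F_le`. For f = Fu, X₀f = X(t)f -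
tX₁f has norm at most 2√δ‖u‖, and the gap 8δ on 𝔑ᗮ gives 4δ/(8δ) = 1/2. -/
theorem norm_one_sub_P_mul_F_sq_le (ht : |t| ≤ t₀) : ‖(1 - p.P) * p.F δ t‖ ^ 2 ≤ 1 / 2 := by
  have h0 := h.sqrt_δ_pos
  have h1 : √8 * ‖(1 - p.P) * p.F δ t‖ ≤ 2 := by
    rw [mul_comm, ← le_div_iff₀ (by positivity)]
    refine ContinuousLinearMap.opNorm_le_bound _ (by positivity) fun u => ?_
    obtain ⟨w, hw, hwn⟩ := p.exists_graph_F δ t u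
    set f := p.F δ t u with hf
    have hf1 : ‖f‖ ≤ ‖u‖ := by
      have := (p.F δ t).le_of_opNorm_le (p.isStarProjection_F δ t).norm_le u
      simpa using this
    rw [mem_graph_X] at hw
    have h2 := p.X₀.graph.sub_mem hw (p.P_graph f)
    rw [Prod.mk_sub_mk, sub_zero] at h2
    have h3 := p.gap h.δ_lt h2 (p.sub_P_mem f)
    have h4 : ‖w - (t : ℂ) • p.X₁ f‖ ≤ 2 * √δ * ‖u‖ := by
      have h5 : ‖w‖ ≤ √δ * ‖u‖ := by
        rw [hwn]
        exact (p.sqrtAF δ t).le_of_opNorm_le ((spectralMeasure (p.A t)).norm_sqrtPart_le δ) u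
      have h6 : ‖(t : ℂ) • p.X₁ f‖ ≤ √δ * ‖u‖ := by
        rw [norm_smul, Complex.norm_real, Real.norm_eq_abs]
        calc |t| * ‖p.X₁ f‖ ≤ |t| * (‖p.X₁‖ * ‖u‖) := by
              refine mul_le_mul_of_nonneg_left ((p.X₁.le_opNorm _).trans ?_) (abs_nonneg t)
              exact mul_le_mul_of_nonneg_left hf1 (norm_nonneg _)
          _ = √δ * p.smallness δ t * ‖u‖ := by rw [h.mul_smallness]; ring
          _ ≤ √δ * 1 * ‖u‖ := by gcongr; exact h.smallness_le_one ht
          _ = _ := by ring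
      exact (norm_sub_le_of_le h5 h6).trans (by linarith)
    have h7 : ((1 - p.P) * p.F δ t) u = f - p.P f := rfl
    rw [h7, div_mul_eq_mul_div, le_div_iff₀ (by positivity)]
    refine le_of_mul_le_mul_right (a := √δ) ?_ h0
    rw [← sq_le_sq₀ (by positivity) (by positivity), mul_pow, mul_pow, Real.sq_sqrt h.δ_pos.le,
      Real.sq_sqrt (by norm_num)]
    have h8 := pow_le_pow_left₀ (norm_nonneg _) h4 2
    calc ‖f - p.P f‖ ^ 2 * 8 * δ = 8 * δ * ‖f - p.P f‖ ^ 2 := by ring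
      _ ≤ _ := h3.trans h8
      _ = _ := by ring
  have h2 := pow_le_pow_left₀ (by positivity) h1 2
  rw [mul_pow, Real.sq_sqrt (by norm_num)] at h2
  linarith

/-- T = (1 - P)F equals TT^*T up to a term containing (1 - F)P. Hence ‖T‖ ≤ ‖T‖³ + θ, and ‖T‖² ≤ 1/2
lets the cube be absorbed. -/
theorem norm_one_sub_P_mul_F_le (ht : |t| ≤ t₀) :
    ‖(1 - p.P) * p.F δ t‖ ≤ 2 * p.smallness δ t := by
  set F := p.F δ t with hF
  have hFp := p.isStarProjection_F δ t
  have hPp := p.isStarProjection_P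
  have hFF : F * F = F := hFp.isIdempotentElem
  have hPP : p.P * p.P = p.P := hPp.isIdempotentElem
  have hFs : star F = F := hFp.isSelfAdjoint
  have hPs : star p.P = p.P := hPp.isSelfAdjoint
  set T := (1 - p.P) * F with hT
  have hTs : star T = F * (1 - p.P) := by rw [hT, star_mul, star_sub, star_one, hFs, hPs]
  have h1 : T = T * (star T * T) - (1 - p.P) * ((1 - F) * p.P) * F := by
    rw [hTs, hT]
    simp only [mul_sub, sub_mul, mul_assoc, one_mul, mul_one, hFF, hPP, mul_mul_of_mul_eq hFF,
      mul_mul_of_mul_eq hPP]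
    abel
  have h2 := h.norm_one_sub_P_mul_F_sq_le ht
  have h3 : ‖T‖ ≤ ‖T‖ * (‖T‖ * ‖T‖) + 1 * p.smallness δ t * 1 := by
    conv_lhs => rw [h1]
    refine norm_sub_le_of_le (norm_mul_le_of_le le_rfl (norm_mul_le_of_le (norm_star T).le le_rfl))
      (norm_mul_le_of_le (norm_mul_le_of_le hPp.one_sub.norm_le (h.norm_one_sub_F_mul_P_le t))
        hFp.norm_le)
  nlinarith [norm_nonneg T]

theorem norm_F_sub_P_le (ht : |t| ≤ t₀) : ‖p.F δ t - p.P‖ ≤ 3 * p.smallness δ t := by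
  have hFs : star (p.F δ t) = p.F δ t := (p.isStarProjection_F δ t).isSelfAdjoint
  have hPs : star p.P = p.P := p.isStarProjection_P.isSelfAdjoint
  have h1 : p.F δ t - p.P = star ((1 - p.P) * p.F δ t) - (1 - p.F δ t) * p.P := by
    rw [star_mul, star_sub, star_one, hFs, hPs]
    noncomm_ring
  rw [h1]
  refine (norm_sub_le_of_le ((norm_star _).trans_le (h.norm_one_sub_P_mul_F_le ht))
    (h.norm_one_sub_F_mul_P_le t)).trans (by linarith)

/-- Split V = VPF + V(1 - P)F: the first part is at most m and the second at most √δ · 2θ = 2m. -/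
theorem norm_sqrtAF_le (ht : |t| ≤ t₀) : ‖p.sqrtAF δ t‖ ≤ 3 * (|t| * ‖p.X₁‖) := by
  have h1 : p.sqrtAF δ t = p.sqrtAF δ t * p.P * p.F δ t
      + p.sqrtAF δ t * ((1 - p.P) * p.F δ t) := by
    conv_lhs => rw [← p.sqrtAF_mul_F]
    noncomm_ring
  rw [h1]
  refine (norm_add_le_of_le (norm_mul_le_of_le (h.norm_sqrtAF_mul_P_le t)
    (p.isStarProjection_F δ t).norm_le) (norm_mul_le_of_le
      ((spectralMeasure (p.A t)).norm_sqrtPart_le δ) (h.norm_one_sub_P_mul_F_le ht))).trans ?_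
  have := h.mul_smallness t
  linarith

/-! ### The approximate projection -/

/-- The term of X(t)Uu containing X₁Pu is cancelled by X₀Z up to R, which leaves tRPu + t²X₁Zu. -/
theorem approxProj_graph (t : ℝ) (u : H) :
    (p.approxProj t u, (t : ℂ) • p.RP u + ((t : ℂ) * t) • p.X₁ (p.Z u)) ∈ (p.X t).graph := by
  rw [mem_graph_X]
  have h1 := p.X₀.graph.add_mem (p.P_graph u) (p.X₀.graph.smul_mem (t : ℂ) (h.isCorrector.graph u))
  convert h1 using 1
  ext
  · rfl
  · simp only [approxProj, add_apply, smul_apply, map_add, map_smul, smul_add, smul_smul,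
      Prod.snd_add, Prod.smul_mk, smul_sub, zero_add]
    abel

/-- Here q = ‖X(t)(1 - F)Uu‖. Pairing X(t)Uu with X(t)(1 - F)Uu gives q²; since RPu is orthogonal to
the range of X₀, the R-term also gains a factor t, and so q is of second order. -/
theorem approxProj_decomp (t : ℝ) (u : H) :
    ∃ q : ℝ, 0 ≤ q ∧ q ≤ 2 * (|t| * ‖p.X₁‖) * p.smallness δ t * ‖u‖ ∧
      √δ * ‖p.approxProj t u - p.F δ t (p.approxProj t u)‖ ≤ q ∧
      ‖p.sqrtAF δ t (p.approxProj t u)‖ ^ 2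
        = ‖(t : ℂ) • p.RP u + ((t : ℂ) * t) • p.X₁ (p.Z u)‖ ^ 2 - q ^ 2 := by
  obtain ⟨w, -, h2, h3, h4, h5⟩ := p.exists_decomp δ t (h.approxProj_graph t u)
  set v := p.approxProj t u with hv
  set y := (t : ℂ) • p.RP u + ((t : ℂ) * t) • p.X₁ (p.Z u) with hy
  set f := v - p.F δ t v with hf
  have h0 := h.sqrt_δ_pos
  have h6 : √δ * ‖f‖ ≤ ‖y - w‖ := by
    rw [← sq_le_sq₀ (by positivity) (norm_nonneg _), mul_pow, Real.sq_sqrt h.δ_pos.le]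
    exact h5
  refine ⟨‖y - w‖, norm_nonneg _, ?_, h6, ?_⟩
  · have h7 : ((‖y - w‖ ^ 2 : ℝ) : ℂ) = (t : ℂ) * ⟪p.RP u, y - w⟫_ℂ
        + (t : ℂ) * t * ⟪p.X₁ (p.Z u), y - w⟫_ℂ := by
      have h8 : ⟪y, y - w⟫_ℂ = ((‖y - w‖ ^ 2 : ℝ) : ℂ) := by
        rw [← inner_self_eq_ofReal]
        nth_rewrite 1 [show y = w + (y - w) by abel]
        rw [inner_add_left, h3, zero_add]
      rw [← h8]
      nth_rewrite 1 [hy]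
      rw [inner_add_left, inner_smul_left, inner_smul_left, map_mul, Complex.conj_ofReal]
    -- With f = (1 - F)Uu one has y - w = X₀f + tX₁f, and RPu does not see X₀f.
    have h9 : ⟪p.RP u, y - w⟫_ℂ = (t : ℂ) * ⟪p.RP u, p.X₁ f⟫_ℂ := by
      have := p.inner_RP u (mem_graph_X.1 h4)
      rw [inner_sub_right, inner_smul_right, sub_eq_zero] at this
      exact this
    rw [h9] at h7
    have h10 : ‖y - w‖ ^ 2 ≤ |t| * (|t| * ((‖p.X₁‖ * ‖u‖) * (‖p.X₁‖ * ‖f‖)))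
        + |t| * |t| * ((‖p.X₁‖ * ‖p.Z u‖) * ‖y - w‖) := by
      have := congrArg norm h7
      rw [Complex.norm_real, Real.norm_of_nonneg (sq_nonneg _)] at this
      rw [this]
      refine norm_add_le_of_le ?_ ?_
      · rw [norm_mul, norm_mul, Complex.norm_real, Real.norm_eq_abs]
        gcongr
        exact (norm_inner_le_norm _ _).trans (mul_le_mul (h.norm_RP_apply_le u)
          (p.X₁.le_opNorm f) (norm_nonneg _) (by positivity))
      · rw [norm_mul, norm_mul, Complex.norm_real, Real.norm_eq_abs]
        gcongr
        exact (norm_inner_le_norm _ _).trans (mul_le_mul_of_nonneg_right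
          (p.X₁.le_opNorm _) (norm_nonneg _))
    have h11 := h.norm_Z_apply_le u
    have h12 : |t| * ‖p.X₁‖ = √δ * p.smallness δ t := (h.mul_smallness t).symm
    rcases eq_or_lt_of_le (norm_nonneg (y - w)) with h13 | h13
    · rw [← h13]
      have := p.smallness_nonneg δ t
      positivity
    refine le_of_mul_le_mul_right (a := ‖y - w‖) ?_ h13
    have hθ := p.smallness_nonneg δ t
    have hx := norm_nonneg p.X₁
    have ht := abs_nonneg t
    rw [sq] at h10
    calc ‖y - w‖ * ‖y - w‖ ≤ _ := h10
      _ = p.smallness δ t * ((|t| * ‖p.X₁‖) * ‖u‖ * (√δ * ‖f‖))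
          + p.smallness δ t * |t| * ((√δ * ‖p.Z u‖) * ‖y - w‖) := by
        have e1 : |t| * (|t| * ((‖p.X₁‖ * ‖u‖) * (‖p.X₁‖ * ‖f‖)))
          = (|t| * ‖p.X₁‖) * ((|t| * ‖p.X₁‖) * ‖u‖ * ‖f‖) := by ring
        have e2 : |t| * |t| * ((‖p.X₁‖ * ‖p.Z u‖) * ‖y - w‖)
          = (|t| * ‖p.X₁‖) * |t| * (‖p.Z u‖ * ‖y - w‖) := by ring
        rw [e1, e2]
        nth_rewrite 1 [h12]
        nth_rewrite 2 [h12]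
        ring
      _ ≤ p.smallness δ t * ((|t| * ‖p.X₁‖) * ‖u‖ * ‖y - w‖)
          + p.smallness δ t * |t| * ((‖p.X₁‖ * ‖u‖) * ‖y - w‖) := by gcongr
      _ = _ := by ring
  · rw [← h2]
    have h6 : ‖y‖ ^ 2 = ‖w‖ ^ 2 + ‖y - w‖ ^ 2 := by
      conv_lhs => rw [show y = w + (y - w) by abel]
      rw [sq, sq, sq]
      exact norm_add_sq_eq_norm_sq_add_norm_sq_of_inner_eq_zero _ _ h3
    linarith

theorem norm_one_sub_F_mul_approxProj_le (t : ℝ) :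
    ‖(1 - p.F δ t) * p.approxProj t‖ ≤ 2 * p.smallness δ t ^ 2 := by
  refine ContinuousLinearMap.opNorm_le_bound _ (by positivity) fun u => ?_
  obtain ⟨q, -, hq, hf, -⟩ := h.approxProj_decomp t u
  refine le_of_mul_le_mul_left ?_ h.sqrt_δ_pos
  refine (hf.trans hq).trans (le_of_eq ?_)
  rw [← h.mul_smallness]
  ring

theorem norm_F_sub_approxProj_le (ht : |t| ≤ t₀) :
    ‖p.F δ t - p.approxProj t * star (p.approxProj t)‖ ≤ 48 * p.smallness δ t ^ 2 :=
  norm_sub_mul_star_le (p.isStarProjection_F δ t) p.isStarProjection_P (h.P_mul_smul_Z t)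
    (h.smul_Z_mul_P t) (p.smallness_nonneg δ t) (h.smallness_le_one ht) (h.norm_smul_Z_le t)
    (h.norm_F_sub_P_le ht) (h.norm_one_sub_F_mul_approxProj_le t)

end Assumptions

end OperatorPencil

/-! ## The germ and the threshold approximation of `A(t) F(t)` -/

namespace OperatorPencil

open Filter Topology

variable {H : Type*} [NormedAddCommGroup H] [InnerProductSpace ℂ H] [CompleteSpace H]
variable {K : Type*} [NormedAddCommGroup K] [InnerProductSpace ℂ K] [CompleteSpace K]
variable {p : OperatorPencil H K} {δ t₀ cstar t : ℝ}

theorem inner_SP (p : OperatorPencil H K) (u v : H) : ⟪u, p.SP v⟫_ℂ = ⟪p.RP u, p.RP v⟫_ℂ :=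
  ContinuousLinearMap.adjoint_inner_right p.RP u (p.RP v)

theorem inner_SP_self (p : OperatorPencil H K) (u : H) :
    ⟪u, p.SP u⟫_ℂ = ((‖p.RP u‖ ^ 2 : ℝ) : ℂ) := by
  rw [inner_SP, inner_self_eq_ofReal]

theorem isSelfAdjoint_SP (p : OperatorPencil H K) : IsSelfAdjoint p.SP :=
  isSelfAdjoint_of_inner_real fun u => ⟨_, p.inner_SP_self u⟩

theorem star_P (p : OperatorPencil H K) : star p.P = p.P := p.isStarProjection_P.isSelfAdjoint

theorem P_mul_P (p : OperatorPencil H K) : p.P * p.P = p.P := p.isStarProjection_P.isIdempotentElem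

theorem SP_mul_P (p : OperatorPencil H K) : p.SP * p.P = p.SP := by
  ext u
  change ContinuousLinearMap.adjoint p.RP ((p.RP ∘L p.P) u) = _
  rw [RP_mul_P]; rfl

theorem P_mul_SP (p : OperatorPencil H K) : p.P * p.SP = p.SP := by
  have := congrArg star p.SP_mul_P
  rwa [star_mul, star_P, p.isSelfAdjoint_SP.star_eq] at this

theorem inner_N (p : OperatorPencil H K) (u v : H) :
    ⟪u, p.N v⟫_ℂ = ⟪p.X₁ (p.Z u), p.RP v⟫_ℂ + ⟪p.RP u, p.X₁ (p.Z v)⟫_ℂ := by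
  have : p.N v = ContinuousLinearMap.adjoint p.Z (ContinuousLinearMap.adjoint p.X₁ (p.RP v))
    + ContinuousLinearMap.adjoint p.RP (p.X₁ (p.Z v)) := rfl
  rw [this, inner_add_right, ContinuousLinearMap.adjoint_inner_right,
    ContinuousLinearMap.adjoint_inner_right, ContinuousLinearMap.adjoint_inner_right]

theorem inner_N_self (p : OperatorPencil H K) (u : H) :
    ⟪u, p.N u⟫_ℂ = ((2 * (⟪p.RP u, p.X₁ (p.Z u)⟫_ℂ).re : ℝ) : ℂ) := by
  rw [inner_N, ← inner_conj_symm (p.X₁ (p.Z u)), add_comm, Complex.add_conj]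

theorem isSelfAdjoint_N (p : OperatorPencil H K) : IsSelfAdjoint p.N :=
  isSelfAdjoint_of_inner_real fun u => ⟨_, p.inner_N_self u⟩

namespace Assumptions

variable (h : p.Assumptions δ t₀ cstar)
include h

theorem N_mul_P : p.N * p.P = p.N := by
  ext u
  refine ext_inner_left ℂ fun v => ?_
  have h1 : p.RP (p.P u) = p.RP u := congrArg (fun T : H →L[ℂ] K => T u) p.RP_mul_P
  have h2 : p.Z (p.P u) = p.Z u := congrArg (fun T : H →L[ℂ] H => T u) h.Z_mul_P
  rw [mul_apply_eq_comp, inner_N, inner_N, h1, h2]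

theorem P_mul_N : p.P * p.N = p.N := by
  have := congrArg star h.N_mul_P
  rwa [star_mul, star_P, p.isSelfAdjoint_N.star_eq] at this

theorem norm_SP_le : ‖p.SP‖ ≤ ‖p.X₁‖ ^ 2 := by
  refine p.isSelfAdjoint_SP.norm_le_of_inner (by positivity) fun u => ?_
  rw [inner_SP_self, Complex.norm_real, Real.norm_of_nonneg (sq_nonneg _), ← mul_pow]
  exact pow_le_pow_left₀ (norm_nonneg _) (h.norm_RP_apply_le u) 2

/-- The arithmetic-geometric mean inequality applied to the two terms of 8δ‖Zu‖² + ‖RPu‖² ≤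
‖X₁‖²‖u‖² yields the factor (8δ)^{-1/2}. -/
theorem norm_N_le : ‖p.N‖ ≤ (√(8 * δ))⁻¹ * ‖p.X₁‖ ^ 3 := by
  have hδ := h.δ_pos
  have h0 : 0 < √(8 * δ) := Real.sqrt_pos.2 (by linarith)
  refine p.isSelfAdjoint_N.norm_le_of_inner (by positivity) fun u => ?_
  rw [inner_N_self, Complex.norm_real, Real.norm_eq_abs, abs_mul, abs_two]
  have h1 : |(⟪p.RP u, p.X₁ (p.Z u)⟫_ℂ).re| ≤ ‖p.RP u‖ * (‖p.X₁‖ * ‖p.Z u‖) :=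
    (Complex.abs_re_le_norm _).trans ((norm_inner_le_norm _ _).trans
      (mul_le_mul_of_nonneg_left (p.X₁.le_opNorm _) (norm_nonneg _)))
  have h2 := h.estimate u
  have h3 : 2 * (‖p.RP u‖ * (√(8 * δ) * ‖p.Z u‖)) ≤ ‖p.X₁‖ ^ 2 * ‖u‖ ^ 2 := by
    have h4 : (√(8 * δ) * ‖p.Z u‖) ^ 2 = 8 * δ * ‖p.Z u‖ ^ 2 := by
      rw [mul_pow, Real.sq_sqrt (by linarith)]
    nlinarith [sq_nonneg (‖p.RP u‖ - √(8 * δ) * ‖p.Z u‖)]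
  rw [mul_assoc, inv_mul_eq_div, le_div_iff₀ h0]
  calc 2 * |(⟪p.RP u, p.X₁ (p.Z u)⟫_ℂ).re| * √(8 * δ)
      ≤ 2 * (‖p.RP u‖ * (‖p.X₁‖ * ‖p.Z u‖)) * √(8 * δ) := by gcongr
    _ = ‖p.X₁‖ * (2 * (‖p.RP u‖ * (√(8 * δ) * ‖p.Z u‖))) := by ring
    _ ≤ ‖p.X₁‖ * (‖p.X₁‖ ^ 2 * ‖u‖ ^ 2) := by gcongr
    _ = _ := by ring

theorem norm_smul_SP_le (t : ℝ) : ‖((t : ℂ) ^ 2) • p.SP‖ ≤ (|t| * ‖p.X₁‖) ^ 2 := by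
  rw [norm_smul, norm_pow, Complex.norm_real, Real.norm_eq_abs, mul_pow]
  exact mul_le_mul_of_nonneg_left h.norm_SP_le (by positivity)

theorem norm_smul_N_le (t : ℝ) :
    ‖((t : ℂ) ^ 3) • p.N‖ ≤ (|t| * ‖p.X₁‖) ^ 2 * p.smallness δ t := by
  have hδ := h.δ_pos
  have h0 : (√(8 * δ))⁻¹ ≤ (√δ)⁻¹ :=
    inv_anti₀ h.sqrt_δ_pos (Real.sqrt_le_sqrt (by linarith))
  rw [norm_smul, norm_pow, Complex.norm_real, Real.norm_eq_abs]
  calc |t| ^ 3 * ‖p.N‖ ≤ |t| ^ 3 * ((√(8 * δ))⁻¹ * ‖p.X₁‖ ^ 3) := by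
        gcongr; exact h.norm_N_le
    _ ≤ |t| ^ 3 * ((√δ)⁻¹ * ‖p.X₁‖ ^ 3) := by gcongr
    _ = _ := by rw [smallness]; ring

theorem norm_compression_sub_le (t : ℝ) :
    ‖star (p.approxProj t) * (p.sqrtAF δ t * p.sqrtAF δ t) * p.approxProj t
      - ((t : ℂ) ^ 2) • p.SP - ((t : ℂ) ^ 3) • p.N‖
      ≤ 5 * (|t| * ‖p.X₁‖) ^ 2 * p.smallness δ t ^ 2 := by
  set T := star (p.approxProj t) * (p.sqrtAF δ t * p.sqrtAF δ t) * p.approxProj t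
      - ((t : ℂ) ^ 2) • p.SP - ((t : ℂ) ^ 3) • p.N with hT
  -- The form of U^*V²U is ‖tRPu + t²X₁Zu‖² - q². Its t² and t³ coefficients are the forms of SP and
  -- N, which leaves t⁴‖X₁Zu‖² - q².
  have hinner : ∀ u, ∃ q : ℝ, 0 ≤ q ∧ q ≤ 2 * (|t| * ‖p.X₁‖) * p.smallness δ t * ‖u‖ ∧
      ⟪u, T u⟫_ℂ = ((t ^ 4 * ‖p.X₁ (p.Z u)‖ ^ 2 - q ^ 2 : ℝ) : ℂ) := by
    intro u
    obtain ⟨q, hq0, hq, -, hq2⟩ := h.approxProj_decomp t u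
    refine ⟨q, hq0, hq, ?_⟩
    have h1 : ⟪u, (star (p.approxProj t) * (p.sqrtAF δ t * p.sqrtAF δ t) * p.approxProj t) u⟫_ℂ
        = ((‖p.sqrtAF δ t (p.approxProj t u)‖ ^ 2 : ℝ) : ℂ) := by
      rw [← inner_self_eq_ofReal]
      have h2 : (star (p.approxProj t) * (p.sqrtAF δ t * p.sqrtAF δ t) * p.approxProj t) u
        = ContinuousLinearMap.adjoint (p.approxProj t)
          (p.sqrtAF δ t (p.sqrtAF δ t (p.approxProj t u))) := rfl
      rw [h2, ContinuousLinearMap.adjoint_inner_right]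
      exact ((p.isSelfAdjoint_sqrtAF δ t).isSymmetric (p.approxProj t u) _).symm
    have h3 : ‖(t : ℂ) • p.RP u + ((t : ℂ) * t) • p.X₁ (p.Z u)‖ ^ 2
        = t ^ 2 * ‖p.RP u‖ ^ 2 + 2 * t ^ 3 * (⟪p.RP u, p.X₁ (p.Z u)⟫_ℂ).re
          + t ^ 4 * ‖p.X₁ (p.Z u)‖ ^ 2 := by
      have h4 : ⟪(t : ℂ) • p.RP u, ((t : ℂ) * t) • p.X₁ (p.Z u)⟫_ℂ
          = ((t ^ 3 : ℝ) : ℂ) * ⟪p.RP u, p.X₁ (p.Z u)⟫_ℂ := by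
        rw [inner_smul_left, inner_smul_right, Complex.conj_ofReal]
        push_cast; ring
      have h5 := norm_add_sq (𝕜 := ℂ) ((t : ℂ) • p.RP u) (((t : ℂ) * t) • p.X₁ (p.Z u))
      have h6 : RCLike.re (((t ^ 3 : ℝ) : ℂ) * ⟪p.RP u, p.X₁ (p.Z u)⟫_ℂ)
          = t ^ 3 * (⟪p.RP u, p.X₁ (p.Z u)⟫_ℂ).re := Complex.re_ofReal_mul _ _
      rw [h5, h4, h6, norm_smul, norm_smul, norm_mul, Complex.norm_real, Real.norm_eq_abs,
        mul_pow, mul_pow, mul_pow, sq_abs]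
      ring
    rw [hT, sub_apply, sub_apply, smul_apply, smul_apply, inner_sub_right, inner_sub_right,
      inner_smul_right, inner_smul_right, h1, hq2, h3, inner_SP_self, inner_N_self]
    push_cast
    ring
  have hsa : IsSelfAdjoint T := isSelfAdjoint_of_inner_real fun u => by
    obtain ⟨q, -, -, hq⟩ := hinner u
    exact ⟨_, hq⟩
  refine hsa.norm_le_of_inner (by positivity) fun u => ?_
  obtain ⟨q, hq0, hq, hqT⟩ := hinner u
  rw [hqT, Complex.norm_real, Real.norm_eq_abs]
  have h0 := h.sqrt_δ_pos
  have h1 : t ^ 2 * ‖p.X₁ (p.Z u)‖ ≤ (|t| * ‖p.X₁‖) * p.smallness δ t * ‖u‖ := by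
    calc t ^ 2 * ‖p.X₁ (p.Z u)‖ ≤ t ^ 2 * (‖p.X₁‖ * ‖p.Z u‖) := by
          gcongr; exact p.X₁.le_opNorm _
      _ = |t| * (√δ * p.smallness δ t) * ‖p.Z u‖ := by
          rw [h.mul_smallness, ← sq_abs]; ring
      _ = |t| * p.smallness δ t * (√δ * ‖p.Z u‖) := by ring
      _ ≤ |t| * p.smallness δ t * (‖p.X₁‖ * ‖u‖) :=
          mul_le_mul_of_nonneg_left (h.norm_Z_apply_le u)
            (mul_nonneg (abs_nonneg t) (p.smallness_nonneg δ t))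
      _ = _ := by ring
  have h2 := pow_le_pow_left₀ (by positivity) h1 2
  have h3 := pow_le_pow_left₀ hq0 hq 2
  rw [abs_le]
  constructor
  · nlinarith [sq_nonneg (t ^ 2 * ‖p.X₁ (p.Z u)‖)]
  · nlinarith [sq_nonneg q]

theorem norm_sqrtAF_sq_sub_le (ht : |t| ≤ t₀) :
    ‖p.sqrtAF δ t * p.sqrtAF δ t - ((t : ℂ) ^ 2) • p.SP - ((t : ℂ) ^ 3) • p.N
      - ((t : ℂ) • p.Z) * (((t : ℂ) ^ 2) • p.SP)
      - (((t : ℂ) ^ 2) • p.SP) * star ((t : ℂ) • p.Z)‖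
      ≤ 2200 * (|t| * ‖p.X₁‖) ^ 2 * p.smallness δ t ^ 2 := by
  refine norm_sub_germ_le (p.isStarProjection_F δ t) p.isStarProjection_P
    (h.smallness_le_one ht) (h.norm_smul_Z_le t) ?_ ?_ ?_
    (h.norm_F_sub_approxProj_le ht) ?_ ?_ ?_ ?_ (h.norm_smul_SP_le t) (h.norm_smul_N_le t)
    (h.norm_compression_sub_le t)
  · rw [← mul_assoc, p.F_mul_sqrtAF]
  · rw [mul_assoc, p.sqrtAF_mul_F]
  · refine (norm_mul_le_of_le (h.norm_sqrtAF_le ht) (h.norm_sqrtAF_le ht)).trans (by linarith)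
  · rw [mul_smul_comm, P_mul_SP]
  · rw [smul_mul_assoc, SP_mul_P]
  · rw [mul_smul_comm, h.P_mul_N]
  · rw [smul_mul_assoc, h.N_mul_P]

/-! ### Nondegeneracy -/

theorem E_Iio_eq_zero (ht : |t| ≤ t₀) :
    (spectralMeasure (p.A t)).E (Set.Iio (cstar * t ^ 2)) = 0 :=
  (p.isGramMeasure t).spec.E_Iio_eq_zero (h.nondegenerate t ht)

theorem sqrtAF_ge (ht : |t| ≤ t₀) (u : H) :
    √cstar * |t| * ‖p.F δ t u‖ ^ 2 ≤ (⟪u, p.sqrtAF δ t u⟫_ℂ).re := by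
  refine (spectralMeasure (p.A t)).sqrtPart_ge δ ?_ u
  rw [mul_pow, Real.sq_sqrt h.cstar_pos.le, sq_abs]
  exact h.E_Iio_eq_zero ht

/-- Nondegeneracy is tested on u + tZu, where X(t) gives t(Ru + tX₁Zu); divide by t² and let t → 0.
-/
theorem RP_ge {u : H} (hu : u ∈ p.𝔑) : cstar * ‖u‖ ^ 2 ≤ ‖p.RP u‖ ^ 2 := by
  have h1 : ∀ t : ℝ, t ≠ 0 → |t| ≤ t₀ →
      cstar * ‖u + (t : ℂ) • p.Z u‖ ^ 2 ≤ ‖p.RP u + (t : ℂ) • p.X₁ (p.Z u)‖ ^ 2 := by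
    intro t ht0 ht
    have h2 := (p.isGramMeasure t).norm_sq_ge (a := cstar * t ^ 2) (h.approxProj_graph t u)
      (by rw [h.E_Iio_eq_zero ht, zero_apply])
    have h3 : p.approxProj t u = u + (t : ℂ) • p.Z u := by
      simp [approxProj, P_eq_self hu]
    have h4 : (t : ℂ) • p.RP u + ((t : ℂ) * t) • p.X₁ (p.Z u)
        = (t : ℂ) • (p.RP u + (t : ℂ) • p.X₁ (p.Z u)) := by
      rw [smul_add, smul_smul]
    rw [h3, h4, norm_smul, Complex.norm_real, Real.norm_eq_abs, mul_pow, sq_abs] at h2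
    have h5 : 0 < t ^ 2 := by positivity
    refine le_of_mul_le_mul_left ?_ h5
    linarith
  have h2 : Tendsto (fun t : ℝ => cstar * ‖u + (t : ℂ) • p.Z u‖ ^ 2) (𝓝[≠] 0)
      (𝓝 (cstar * ‖u‖ ^ 2)) := by
    have : Continuous fun t : ℝ => cstar * ‖u + (t : ℂ) • p.Z u‖ ^ 2 := by fun_prop
    have := (this.tendsto 0).mono_left (nhdsWithin_le_nhds (s := {0}ᶜ))
    simpa using this
  have h3 : Tendsto (fun t : ℝ => ‖p.RP u + (t : ℂ) • p.X₁ (p.Z u)‖ ^ 2) (𝓝[≠] 0)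
      (𝓝 (‖p.RP u‖ ^ 2)) := by
    have : Continuous fun t : ℝ => ‖p.RP u + (t : ℂ) • p.X₁ (p.Z u)‖ ^ 2 := by fun_prop
    have := (this.tendsto 0).mono_left (nhdsWithin_le_nhds (s := {0}ᶜ))
    simpa using this
  refine le_of_tendsto_of_tendsto h2 h3 ?_
  have h4 : ∀ᶠ t : ℝ in 𝓝[≠] 0, |t| ≤ t₀ :=
    nhdsWithin_le_nhds ((continuous_abs.tendsto' (0 : ℝ) 0 abs_zero).eventually
      (Iic_mem_nhds h.t₀_pos))
  filter_upwards [h4, self_mem_nhdsWithin] with t ht ht0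
  exact h1 t ht0 ht

/-- Compare the lower and upper bounds for R on a nonzero vector of 𝔑. This is what makes κ ≥ 1. -/
theorem cstar_le : cstar ≤ ‖p.X₁‖ ^ 2 := by
  obtain ⟨u, hu, hu0⟩ := p.𝔑.exists_mem_ne_zero_of_ne_bot h.ker_ne_bot
  have h1 : 0 < ‖u‖ ^ 2 := by have := norm_pos_iff.2 hu0; positivity
  refine le_of_mul_le_mul_right ((h.RP_ge hu).trans ?_) h1
  rw [← mul_pow]
  exact pow_le_pow_left₀ (norm_nonneg _) (h.norm_RP_apply_le u) 2

end Assumptions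

end OperatorPencil

/-! ## Functions of finite spectral resolutions -/

section FiniteResolution

variable {H : Type*} [NormedAddCommGroup H] [InnerProductSpace ℂ H] [CompleteSpace H]

/-- The operator `∑ f(i) Q_i`. -/
def resolutionSum (s : Finset ℝ) (Q : ℝ → H →L[ℂ] H) (f : ℝ → ℝ) : H →L[ℂ] H :=
  ∑ i ∈ s, (f i : ℂ) • Q i

variable {s : Finset ℝ} {Q : ℝ → H →L[ℂ] H}

theorem resolutionSum_mul (hQ : ∀ i ∈ s, Q i * Q i = Q i)
    (hort : ∀ i ∈ s, ∀ j ∈ s, i ≠ j → Q i * Q j = 0) (f g : ℝ → ℝ) :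
    resolutionSum s Q f * resolutionSum s Q g = resolutionSum s Q fun x => f x * g x := by
  rw [resolutionSum, resolutionSum, resolutionSum, Finset.sum_mul_sum]
  refine Finset.sum_congr rfl fun i hi => ?_
  rw [Finset.sum_eq_single i]
  · rw [smul_mul_smul_comm, hQ i hi, Complex.ofReal_mul]
  · intro j hj hji
    rw [smul_mul_smul_comm, hort i hi j hj hji.symm, smul_zero]
  · exact fun h => absurd hi h

theorem isSelfAdjoint_resolutionSum (hQ : ∀ i ∈ s, IsSelfAdjoint (Q i)) (f : ℝ → ℝ) :
    IsSelfAdjoint (resolutionSum s Q f) := by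
  refine isSelfAdjoint_sum s fun i hi => ?_
  exact IsSelfAdjoint.smul (Complex.conj_ofReal _) (hQ i hi)

/-- Orthogonality makes the sums multiplicative, which handles polynomials and puts the spectrum
inside s. On a finite set every f is a Lagrange polynomial, so no continuity is required. -/
theorem cfc_resolutionSum (hQ : ∀ i ∈ s, IsStarProjection (Q i))
    (hort : ∀ i ∈ s, ∀ j ∈ s, i ≠ j → Q i * Q j = 0) (hsum : ∑ i ∈ s, Q i = 1) (f : ℝ → ℝ) :
    cfc f (resolutionSum s Q fun x => x) = resolutionSum s Q f := by
  have hmul := resolutionSum_mul (fun i hi => (hQ i hi).isIdempotentElem.eq) hort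
  have hone : resolutionSum s Q (fun _ => 1) = 1 := by simp [resolutionSum, hsum]
  set T := resolutionSum s Q fun x => x with hT
  have hTsa : IsSelfAdjoint T := isSelfAdjoint_resolutionSum (fun i hi => (hQ i hi).isSelfAdjoint) _
  have hpow : ∀ n : ℕ, T ^ n = resolutionSum s Q fun x => x ^ n := by
    intro n
    induction n with
    | zero => simp [hone]
    | succ n ih => rw [pow_succ, ih, hT, hmul]; simp only [pow_succ]
  have hpoly : ∀ q : Polynomial ℝ, Polynomial.aeval T q = resolutionSum s Q fun x => q.eval x := by
    intro q
    induction q using Polynomial.induction_on' with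
    | add q r hq hr =>
      rw [map_add, hq, hr]
      simp [resolutionSum, add_smul, Finset.sum_add_distrib]
    | monomial n a =>
      rw [Polynomial.aeval_monomial, hpow, Algebra.algebraMap_eq_smul_one, smul_mul_assoc, one_mul]
      simp only [resolutionSum, Polynomial.eval_monomial, Finset.smul_sum, Complex.ofReal_mul,
        mul_smul]
      rfl
  have hspec : spectrum ℝ T ⊆ s := by
    intro μ hμ
    by_contra hμs
    refine hμ ?_
    have hne : ∀ i ∈ s, μ - i ≠ 0 := fun i hi h0 => hμs (by rw [sub_eq_zero.1 h0]; exact hi)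
    have h1 : algebraMap ℝ (H →L[ℂ] H) μ - T = resolutionSum s Q fun x => μ - x := by
      have h2 := hpoly (Polynomial.C μ - Polynomial.X)
      simpa using h2
    rw [spectrum.mem_resolventSet_iff, h1]
    have h2 : resolutionSum s Q (fun x => (μ - x) * (μ - x)⁻¹) = 1 := by
      rw [← hone]
      refine Finset.sum_congr rfl fun i hi => ?_
      simp only [mul_inv_cancel₀ (hne i hi)]
    refine ⟨⟨resolutionSum s Q fun x => μ - x, resolutionSum s Q fun x => (μ - x)⁻¹, ?_, ?_⟩, rfl⟩
    · rw [hmul, h2]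
    · rw [hmul, ← h2]; simp only [mul_comm]
  set q := Lagrange.interpolate s id f with hq
  have hqf : ∀ i ∈ s, q.eval i = f i := fun i hi =>
    Lagrange.eval_interpolate_at_node (v := id) f (Set.injOn_id _) hi
  rw [cfc_congr (g := q.eval) fun x hx => (hqf x (hspec hx)).symm, cfc_polynomial q T hTsa, hpoly]
  refine Finset.sum_congr rfl fun i hi => ?_
  simp only [hqf i hi]

end FiniteResolution

/-! ## The spectral resolution of the germ -/

namespace OperatorPencil

open Filter Topology

variable {H : Type*} [NormedAddCommGroup H] [InnerProductSpace ℂ H] [CompleteSpace H]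
variable {K : Type*} [NormedAddCommGroup K] [InnerProductSpace ℂ K] [CompleteSpace K]
variable {p : OperatorPencil H K} {δ t₀ cstar t : ℝ}

theorem isStarProjection_germProj (p : OperatorPencil H K) (γ : ℝ) :
    IsStarProjection (p.germProj γ) := isStarProjection_starProjection

theorem mem_germEigenspace {γ : ℝ} {u : H} :
    u ∈ p.germEigenspace γ ↔ u ∈ p.𝔑 ∧ p.SP u = (γ : ℂ) • u := by
  rw [germEigenspace, Submodule.mem_inf, LinearMap.mem_ker]
  refine and_congr_right fun _ => ?_
  rw [← sub_eq_zero (a := p.SP u)]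
  rfl

theorem isClosed_germEigenspace (p : OperatorPencil H K) (γ : ℝ) :
    IsClosed (p.germEigenspace γ : Set H) :=
  (isClosed_unboundedKer p.isClosed).inter (ContinuousLinearMap.isClosed_ker _)

theorem germProj_mem (p : OperatorPencil H K) (γ : ℝ) (u : H) :
    p.germProj γ u ∈ p.germEigenspace γ := by
  have h : p.germProj γ u ∈ (p.germEigenspace γ).topologicalClosure :=
    Submodule.starProjection_apply_mem _ _
  rwa [(p.isClosed_germEigenspace γ).submodule_topologicalClosure_eq] at h

theorem germProj_eq_self {γ : ℝ} {u : H} (hu : u ∈ p.germEigenspace γ) : p.germProj γ u = u :=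
  Submodule.starProjection_eq_self_iff.2 (Submodule.le_topologicalClosure _ hu)

theorem inner_germEigenspace {γ γ' : ℝ} (hne : γ ≠ γ') {u v : H} (hu : u ∈ p.germEigenspace γ)
    (hv : v ∈ p.germEigenspace γ') : ⟪u, v⟫_ℂ = 0 := by
  have h1 : ⟪p.SP u, v⟫_ℂ = ⟪u, p.SP v⟫_ℂ := p.isSelfAdjoint_SP.isSymmetric u v
  rw [(mem_germEigenspace.1 hu).2, (mem_germEigenspace.1 hv).2, inner_smul_left, inner_smul_right,
    Complex.conj_ofReal, ← sub_eq_zero, ← sub_mul, mul_eq_zero, sub_eq_zero] at h1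
  exact h1.resolve_left fun h2 => hne (Complex.ofReal_injective h2)

theorem germProj_eq_zero {γ γ' : ℝ} (hne : γ ≠ γ') {u : H} (hu : u ∈ p.germEigenspace γ') :
    p.germProj γ u = 0 := by
  refine (Submodule.starProjection_apply_eq_zero_iff _).2 ?_
  rw [Submodule.orthogonal_closure]
  exact (Submodule.mem_orthogonal _ _).2 fun v hv => inner_germEigenspace hne hv hu

theorem germProj_mul_germProj {γ γ' : ℝ} (hne : γ ≠ γ') : p.germProj γ * p.germProj γ' = 0 := by
  ext u
  exact germProj_eq_zero hne (p.germProj_mem γ' u)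

theorem germProj_mul_self (p : OperatorPencil H K) (γ : ℝ) :
    p.germProj γ * p.germProj γ = p.germProj γ := (p.isStarProjection_germProj γ).isIdempotentElem

theorem star_germProj (p : OperatorPencil H K) (γ : ℝ) : star (p.germProj γ) = p.germProj γ :=
  (p.isStarProjection_germProj γ).isSelfAdjoint

theorem P_mul_germProj (p : OperatorPencil H K) (γ : ℝ) : p.P * p.germProj γ = p.germProj γ := by
  ext u
  exact P_eq_self (mem_germEigenspace.1 (p.germProj_mem γ u)).1

theorem germProj_mul_P (p : OperatorPencil H K) (γ : ℝ) : p.germProj γ * p.P = p.germProj γ := by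
  have := congrArg star (p.P_mul_germProj γ)
  rwa [star_mul, star_P, star_germProj] at this

theorem SP_mul_germProj (p : OperatorPencil H K) (γ : ℝ) :
    p.SP * p.germProj γ = (γ : ℂ) • p.germProj γ := by
  ext u
  exact (mem_germEigenspace.1 (p.germProj_mem γ u)).2

theorem germProj_of_notMem {γ : ℝ} (hγ : γ ∉ p.germEigenvalues) : p.germProj γ = 0 := by
  have h1 : p.germEigenspace γ = ⊥ := by
    by_contra h; exact hγ h
  ext u
  have h2 := p.germProj_mem γ u
  rw [h1, Submodule.mem_bot] at h2
  exact h2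

/-- The finite set `s` is the set of the eigenvalues of the germ. -/
structure IsGermSpectrum (p : OperatorPencil H K) (cstar : ℝ) (s : Finset ℝ) : Prop where
  mem_iff : ∀ γ, γ ∈ s ↔ γ ∈ p.germEigenvalues
  card_le : s.card ≤ p.n
  sum_eq : ∑ γ ∈ s, p.germProj γ = p.P
  ge : ∀ γ ∈ s, cstar ≤ γ
  pos : 0 < cstar

/-- An orthonormal eigenbasis of SP restricted to the finite-dimensional 𝔑 gives the eigenvalues and
the resolution of P. The bound from below is `RP_ge` on an eigenvector. -/
theorem Assumptions.exists_isGermSpectrum (h : p.Assumptions δ t₀ cstar) :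
    ∃ s, p.IsGermSpectrum cstar s := by
  have := h.ker_finite
  have hmaps : ∀ u : H, u ∈ p.𝔑 → p.SP u ∈ p.𝔑 := fun u _ => by
    have : p.SP u = p.P (p.SP u) := (congrArg (fun T : H →L[ℂ] H => T u) p.P_mul_SP).symm
    rw [this]; exact p.P_mem _
  let S : p.𝔑 →ₗ[ℂ] p.𝔑 := (p.SP : H →ₗ[ℂ] H).restrict hmaps
  have hS : S.IsSymmetric := fun u v => p.isSelfAdjoint_SP.isSymmetric (u : H) v
  have hn : Module.finrank ℂ p.𝔑 = p.n := rfl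
  let b := hS.eigenvectorBasis hn
  let ev := hS.eigenvalues hn
  have hb : ∀ i, (b i : H) ∈ p.germEigenspace (ev i) := fun i =>
    mem_germEigenspace.2 ⟨(b i).2, congrArg Subtype.val (hS.apply_eigenvectorBasis hn i)⟩
  have hb0 : ∀ i, (b i : H) ≠ 0 := fun i h0 => b.orthonormal.ne_zero i (Subtype.ext h0)
  have hsumb : ∀ i, ∑ γ ∈ Finset.univ.image ev, p.germProj γ (b i : H) = b i := by
    intro i
    rw [Finset.sum_eq_single (ev i)]
    · exact germProj_eq_self (hb i)
    · exact fun γ _ hne => germProj_eq_zero hne (hb i)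
    · exact fun h0 => absurd (Finset.mem_image_of_mem _ (Finset.mem_univ i)) h0
  have hsumv : ∀ v : p.𝔑, ∑ γ ∈ Finset.univ.image ev, p.germProj γ (v : H) = v := by
    intro v
    have h1 : (v : H) = ∑ i, b.repr v i • (b i : H) := by
      have := congrArg (Subtype.val : p.𝔑 → H) (b.sum_repr v)
      rw [← this, Submodule.coe_sum]
      rfl
    rw [h1]
    simp only [map_sum, map_smul]
    rw [Finset.sum_comm]
    refine Finset.sum_congr rfl fun i _ => ?_
    rw [← Finset.smul_sum, hsumb]
  have hge : ∀ γ ∈ p.germEigenvalues, cstar ≤ γ := by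
    intro γ hγ
    obtain ⟨u, hu, hu0⟩ := Submodule.exists_mem_ne_zero_of_ne_bot hγ
    obtain ⟨hu1, hu2⟩ := mem_germEigenspace.1 hu
    have h1 := h.RP_ge hu1
    have h2 := p.inner_SP_self u
    rw [hu2, inner_smul_right, inner_self_eq_ofReal, ← Complex.ofReal_mul] at h2
    have h3 := Complex.ofReal_injective h2
    rw [← h3] at h1
    exact le_of_mul_le_mul_right h1 (by have := norm_pos_iff.2 hu0; positivity)
  have hmem : ∀ γ, γ ∈ Finset.univ.image ev ↔ γ ∈ p.germEigenvalues := by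
    intro γ
    constructor
    · intro hγ
      obtain ⟨i, -, rfl⟩ := Finset.mem_image.1 hγ
      exact fun h0 => hb0 i (by have := hb i; rwa [h0, Submodule.mem_bot] at this)
    · intro hγ
      by_contra hn
      obtain ⟨u, hu, hu0⟩ := Submodule.exists_mem_ne_zero_of_ne_bot hγ
      have h1 := hsumv ⟨u, (mem_germEigenspace.1 hu).1⟩
      rw [Finset.sum_eq_zero] at h1
      · exact hu0 h1.symm
      · exact fun γ' hγ' => germProj_eq_zero (fun heq => hn (by rw [← heq]; exact hγ')) hu
  refine ⟨Finset.univ.image ev, hmem, ?_, ?_, fun γ hγ => hge γ ((hmem γ).1 hγ), h.cstar_pos⟩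
  · exact Finset.card_image_le.trans (by simp)
  · ext u
    rw [sum_apply]
    have h1 := hsumv ⟨p.P u, p.P_mem u⟩
    change _ = p.P u at h1
    rw [← h1]
    refine Finset.sum_congr rfl fun γ _ => ?_
    rw [← mul_apply_eq_comp, germProj_mul_P]

end OperatorPencil

/-! ## Functions of the germ -/

namespace OperatorPencil

open Filter Topology

variable {H : Type*} [NormedAddCommGroup H] [InnerProductSpace ℂ H] [CompleteSpace H]
variable {K : Type*} [NormedAddCommGroup K] [InnerProductSpace ℂ K] [CompleteSpace K]
variable {p : OperatorPencil H K} {δ t₀ cstar t : ℝ} {s : Finset ℝ}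

/-- The operator `∑ f(γ) P_γ`. -/
def germFun (p : OperatorPencil H K) (s : Finset ℝ) (f : ℝ → ℝ) : H →L[ℂ] H :=
  resolutionSum s p.germProj f

/-- The operator `∑_{γ ≠ γ'} k(γ, γ') P_γ N P_γ'`. -/
def offDiagSum (p : OperatorPencil H K) (s : Finset ℝ) (k : ℝ → ℝ → ℝ) : H →L[ℂ] H :=
  ∑ x ∈ s.offDiag, (k x.1 x.2 : ℂ) • (p.germProj x.1 * p.N * p.germProj x.2)

theorem isSelfAdjoint_germFun (p : OperatorPencil H K) (s : Finset ℝ) (f : ℝ → ℝ) :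
    IsSelfAdjoint (p.germFun s f) :=
  isSelfAdjoint_resolutionSum (fun γ _ => p.star_germProj γ) f

theorem germFun_mul_germFun (p : OperatorPencil H K) (s : Finset ℝ) (f g : ℝ → ℝ) :
    p.germFun s f * p.germFun s g = p.germFun s fun x => f x * g x :=
  resolutionSum_mul (fun γ _ => p.germProj_mul_self γ)
    (fun _ _ _ _ hne => germProj_mul_germProj hne) f g

theorem germFun_mul_germProj {γ : ℝ} (hγ : γ ∈ s) (f : ℝ → ℝ) :
    p.germFun s f * p.germProj γ = (f γ : ℂ) • p.germProj γ := by
  rw [germFun, resolutionSum, Finset.sum_mul, Finset.sum_eq_single γ]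
  · rw [smul_mul_assoc, germProj_mul_self]
  · intro γ' _ hne
    rw [smul_mul_assoc, germProj_mul_germProj hne, smul_zero]
  · exact fun h => absurd hγ h

theorem germProj_mul_germFun {γ : ℝ} (hγ : γ ∈ s) (f : ℝ → ℝ) :
    p.germProj γ * p.germFun s f = (f γ : ℂ) • p.germProj γ := by
  rw [germFun, resolutionSum, Finset.mul_sum, Finset.sum_eq_single γ]
  · rw [mul_smul_comm, germProj_mul_self]
  · intro γ' _ hne
    rw [mul_smul_comm, germProj_mul_germProj hne.symm, smul_zero]
  · exact fun h => absurd hγ h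

theorem germFun_mul_offDiagSum (p : OperatorPencil H K) (s : Finset ℝ) (f : ℝ → ℝ)
    (k : ℝ → ℝ → ℝ) :
    p.germFun s f * p.offDiagSum s k = p.offDiagSum s fun x y => f x * k x y := by
  rw [offDiagSum, offDiagSum, Finset.mul_sum]
  refine Finset.sum_congr rfl fun x hx => ?_
  rw [mul_smul_comm, ← mul_assoc, ← mul_assoc,
    germFun_mul_germProj (Finset.mem_offDiag.1 hx).1, smul_mul_assoc, smul_mul_assoc, smul_smul,
    Complex.ofReal_mul, mul_comm]

theorem offDiagSum_mul_germFun (p : OperatorPencil H K) (s : Finset ℝ) (f : ℝ → ℝ)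
    (k : ℝ → ℝ → ℝ) :
    p.offDiagSum s k * p.germFun s f = p.offDiagSum s fun x y => k x y * f y := by
  rw [offDiagSum, offDiagSum, Finset.sum_mul]
  refine Finset.sum_congr rfl fun x hx => ?_
  rw [smul_mul_assoc, mul_assoc, germProj_mul_germFun (Finset.mem_offDiag.1 hx).2.1,
    mul_smul_comm, smul_smul, Complex.ofReal_mul]

theorem offDiagSum_congr {k k' : ℝ → ℝ → ℝ} (h : ∀ x ∈ s, ∀ y ∈ s, x ≠ y → k x y = k' x y) :
    p.offDiagSum s k = p.offDiagSum s k' := by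
  refine Finset.sum_congr rfl fun x hx => ?_
  obtain ⟨h1, h2, h3⟩ := Finset.mem_offDiag.1 hx
  rw [h _ h1 _ h2 h3]

theorem offDiagSum_add (p : OperatorPencil H K) (s : Finset ℝ) (k k' : ℝ → ℝ → ℝ) :
    p.offDiagSum s k + p.offDiagSum s k' = p.offDiagSum s fun x y => k x y + k' x y := by
  rw [offDiagSum, offDiagSum, offDiagSum, ← Finset.sum_add_distrib]
  refine Finset.sum_congr rfl fun x _ => ?_
  rw [Complex.ofReal_add, add_smul]

theorem offDiagSum_sub (p : OperatorPencil H K) (s : Finset ℝ) (k k' : ℝ → ℝ → ℝ) :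
    p.offDiagSum s k - p.offDiagSum s k' = p.offDiagSum s fun x y => k x y - k' x y := by
  rw [offDiagSum, offDiagSum, offDiagSum, ← Finset.sum_sub_distrib]
  refine Finset.sum_congr rfl fun x _ => ?_
  rw [Complex.ofReal_sub, sub_smul]

/-- Each term is at most b‖N‖ and there are at most card² pairs. The bound on k is required only
where the block of N is nonzero, matching the definition of c°. -/
theorem norm_offDiagSum_le {k : ℝ → ℝ → ℝ} {b : ℝ} (hb : 0 ≤ b)
    (hk : ∀ x ∈ s, ∀ y ∈ s, x ≠ y → p.germProj x * p.N * p.germProj y ≠ 0 → |k x y| ≤ b) :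
    ‖p.offDiagSum s k‖ ≤ (s.card : ℝ) ^ 2 * (b * ‖p.N‖) := by
  have h1 : ∀ x ∈ s.offDiag,
      ‖(k x.1 x.2 : ℂ) • (p.germProj x.1 * p.N * p.germProj x.2)‖ ≤ b * ‖p.N‖ := by
    intro x hx
    obtain ⟨h1, h2, h3⟩ := Finset.mem_offDiag.1 hx
    rcases eq_or_ne (p.germProj x.1 * p.N * p.germProj x.2) 0 with h0 | h0
    · rw [h0, smul_zero, norm_zero]; positivity
    rw [norm_smul, Complex.norm_real, Real.norm_eq_abs]
    refine mul_le_mul (hk _ h1 _ h2 h3 h0) ?_ (norm_nonneg _) hb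
    refine (norm_mul_le_of_le (norm_mul_le_of_le (p.isStarProjection_germProj _).norm_le le_rfl)
      (p.isStarProjection_germProj _).norm_le).trans (by simp)
  refine (norm_sum_le_of_le _ h1).trans ?_
  rw [Finset.sum_const, nsmul_eq_mul]
  refine mul_le_mul_of_nonneg_right ?_ (by positivity)
  rw [Finset.offDiag_card, sq]
  exact_mod_cast Nat.sub_le _ _

namespace IsGermSpectrum

variable (hs : p.IsGermSpectrum cstar s)
include hs

theorem germFun_one : p.germFun s (fun _ => 1) = p.P := by
  simp [germFun, resolutionSum, hs.sum_eq]

theorem germFun_id : p.germFun s (fun x => x) = p.SP := by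
  rw [← p.SP_mul_P, ← hs.sum_eq, Finset.mul_sum]
  exact Finset.sum_congr rfl fun γ _ => (p.SP_mul_germProj γ).symm

theorem germFun_mul_P (f : ℝ → ℝ) : p.germFun s f * p.P = p.germFun s f := by
  rw [← hs.germFun_one, germFun_mul_germFun]; simp

theorem P_mul_germFun (f : ℝ → ℝ) : p.P * p.germFun s f = p.germFun s f := by
  rw [← hs.germFun_one, germFun_mul_germFun]; simp

theorem offDiagSum_mul_P (k : ℝ → ℝ → ℝ) : p.offDiagSum s k * p.P = p.offDiagSum s k := by
  rw [← hs.germFun_one, offDiagSum_mul_germFun]; simp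

theorem P_mul_offDiagSum (k : ℝ → ℝ → ℝ) : p.P * p.offDiagSum s k = p.offDiagSum s k := by
  rw [← hs.germFun_one, germFun_mul_offDiagSum]; simp

theorem pos_of_mem {γ : ℝ} (hγ : γ ∈ s) : 0 < γ := hs.pos.trans_le (hs.ge γ hγ)

theorem sum_norm_sq (u : H) : ∑ γ ∈ s, ‖p.germProj γ u‖ ^ 2 = ‖p.P u‖ ^ 2 := by
  have key : ∀ {Q : H →L[ℂ] H}, IsStarProjection Q → ⟪u, Q u⟫_ℂ = ((‖Q u‖ ^ 2 : ℝ) : ℂ) := by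
    intro Q hQ
    have h1 : Q u = Q (Q u) := (congrArg (fun T : H →L[ℂ] H => T u) hQ.isIdempotentElem.eq).symm
    rw [← inner_self_eq_ofReal]
    conv_lhs => rw [h1]
    exact (hQ.isSelfAdjoint.isSymmetric u (Q u)).symm
  have h1 := key p.isStarProjection_P
  rw [← hs.sum_eq, sum_apply, inner_sum] at h1
  simp only [key (p.isStarProjection_germProj _)] at h1
  rw [← Complex.ofReal_sum] at h1
  rw [Complex.ofReal_injective h1, ← hs.sum_eq, sum_apply]

theorem inner_germFun (f : ℝ → ℝ) (u : H) :
    ⟪u, p.germFun s f u⟫_ℂ = ((∑ γ ∈ s, f γ * ‖p.germProj γ u‖ ^ 2 : ℝ) : ℂ) := by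
  rw [germFun, resolutionSum, sum_apply, inner_sum, Complex.ofReal_sum]
  refine Finset.sum_congr rfl fun γ _ => ?_
  have h1 : p.germProj γ u = p.germProj γ (p.germProj γ u) :=
    (congrArg (fun T : H →L[ℂ] H => T u) (p.germProj_mul_self γ)).symm
  rw [smul_apply, inner_smul_right, Complex.ofReal_mul, ← inner_self_eq_ofReal]
  conv_lhs => rw [h1]
  congr 1
  exact ((p.isStarProjection_germProj γ).isSelfAdjoint.isSymmetric u (p.germProj γ u)).symm

/-- A lower bound for functions of the germ. -/
theorem germFun_ge {f : ℝ → ℝ} {a : ℝ} (hf : ∀ γ ∈ s, a ≤ f γ) (u : H) :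
    a * ‖p.P u‖ ^ 2 ≤ (⟪u, p.germFun s f u⟫_ℂ).re := by
  rw [hs.inner_germFun, Complex.ofReal_re, ← hs.sum_norm_sq, Finset.mul_sum]
  exact Finset.sum_le_sum fun γ hγ => mul_le_mul_of_nonneg_right (hf γ hγ) (sq_nonneg _)

theorem germFun_nonneg {f : ℝ → ℝ} (hf : ∀ γ ∈ s, 0 ≤ f γ) : 0 ≤ p.germFun s f := by
  rw [ContinuousLinearMap.nonneg_iff_isPositive, ContinuousLinearMap.isPositive_def']
  refine ⟨p.isSelfAdjoint_germFun s f, fun u => ?_⟩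
  have h1 : (p.germFun s f).reApplyInnerSelf u = (⟪u, p.germFun s f u⟫_ℂ).re := by
    rw [ContinuousLinearMap.reApplyInnerSelf, inner_re_symm]; rfl
  rw [h1]
  have := hs.germFun_ge hf u
  rwa [zero_mul] at this

theorem sqrtSP_eq : p.sqrtSP = p.germFun s Real.sqrt := by
  refine CFC.sqrt_unique ?_ (hs.germFun_nonneg fun γ _ => Real.sqrt_nonneg γ)
  rw [germFun_mul_germFun, ← hs.germFun_id]
  refine Finset.sum_congr rfl fun γ hγ => ?_
  simp only [Real.mul_self_sqrt (hs.pos_of_mem hγ).le]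

theorem sqrtGerm_eq (t : ℝ) : p.sqrtGerm t = ((|t| : ℝ) : ℂ) • p.sqrtSP := by
  have h1 : ((|t| : ℝ) : ℂ) • p.sqrtSP = p.germFun s fun x => |t| * √x := by
    rw [hs.sqrtSP_eq, germFun, germFun, resolutionSum, resolutionSum, Finset.smul_sum]
    simp only [smul_smul, Complex.ofReal_mul]
  rw [h1]
  refine CFC.sqrt_unique ?_ (hs.germFun_nonneg fun γ _ => by positivity)
  rw [germFun_mul_germFun, ← hs.germFun_id, germFun, germFun, resolutionSum, resolutionSum,
    Finset.smul_sum]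
  refine Finset.sum_congr rfl fun γ hγ => ?_
  rw [smul_smul]
  congr 1
  have h2 : |t| * √γ * (|t| * √γ) = t ^ 2 * γ := by
    rw [mul_mul_mul_comm, Real.mul_self_sqrt (hs.pos_of_mem hγ).le, ← sq, sq_abs]
  rw [h2]; push_cast; rfl

/-- Functions of `S P` are determined by the spectral resolution of the germ. -/
theorem cfc_SP_mul_P (f : ℝ → ℝ) : cfc f p.SP = p.germFun s f + (f 0 : ℂ) • (1 - p.P) := by
  have h0 : (0 : ℝ) ∉ s := fun h0 => (hs.pos_of_mem h0).false
  -- The resolution is completed to one of the identity by giving 1 - P the eigenvalue 0, which is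
  -- not in s as the germ is positive.
  let Q : ℝ → H →L[ℂ] H := fun γ => if γ = 0 then 1 - p.P else p.germProj γ
  have hQ0 : Q 0 = 1 - p.P := if_pos rfl
  have hQ : ∀ γ ∈ s, Q γ = p.germProj γ := fun γ hγ => if_neg fun h => h0 (by rwa [h] at hγ)
  have hsum : ∀ g : ℝ → ℝ, resolutionSum (insert 0 s) Q g
      = p.germFun s g + (g 0 : ℂ) • (1 - p.P) := by
    intro g
    rw [resolutionSum, Finset.sum_insert h0, hQ0, add_comm]
    congr 1
    exact Finset.sum_congr rfl fun γ hγ => by rw [hQ γ hγ]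
  have hstar : ∀ i ∈ insert 0 s, IsStarProjection (Q i) := by
    intro i hi
    rcases Finset.mem_insert.1 hi with rfl | hi
    · rw [hQ0]; exact p.isStarProjection_P.one_sub
    · rw [hQ i hi]; exact p.isStarProjection_germProj i
  have hort : ∀ i ∈ insert 0 s, ∀ j ∈ insert 0 s, i ≠ j → Q i * Q j = 0 := by
    intro i hi j hj hij
    rcases Finset.mem_insert.1 hi with rfl | hi <;> rcases Finset.mem_insert.1 hj with rfl | hj
    · exact absurd rfl hij
    · rw [hQ0, hQ j hj, sub_mul, one_mul, P_mul_germProj, sub_self]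
    · rw [hQ0, hQ i hi, mul_sub, mul_one, germProj_mul_P, sub_self]
    · rw [hQ i hi, hQ j hj, germProj_mul_germProj hij]
  have hone : ∑ i ∈ insert 0 s, Q i = 1 := by
    have := hsum fun _ => 1
    rw [hs.germFun_one] at this
    simpa [resolutionSum] using this
  have h1 := cfc_resolutionSum hstar hort hone f
  rw [hsum, hsum, hs.germFun_id] at h1
  simpa using h1

theorem invSqrtSP_eq : p.invSqrtSP = p.germFun s fun x => (√x)⁻¹ := by
  rw [invSqrtSP, hs.cfc_SP_mul_P]; simp

/-- The inverse of SP + r is ∑(γ + r)⁻¹P_γ + r⁻¹(1 - P), and P kills the last term. -/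
theorem Ξ_eq {r : ℝ} (hr : 0 < r) : p.Ξ r = p.germFun s fun x => (x + r)⁻¹ := by
  have hpos : ∀ γ ∈ s, γ + r ≠ 0 := fun γ hγ => by have := hs.pos_of_mem hγ; positivity
  set W := p.germFun s (fun x => (x + r)⁻¹) with hW
  have hrc : (r : ℂ) ≠ 0 := Complex.ofReal_ne_zero.2 hr.ne'
  have hPW : p.P * W = W := hs.P_mul_germFun _
  have hWP : W * p.P = W := hs.germFun_mul_P _
  have h1 : p.SP * W + (r : ℂ) • W = p.P := by
    have h2 : (r : ℂ) • W = p.germFun s (fun _ => r) * W := by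
      rw [hW, germFun_mul_germFun, germFun, germFun, resolutionSum, resolutionSum, Finset.smul_sum]
      simp only [smul_smul, Complex.ofReal_mul]
    rw [h2, ← hs.germFun_id, hW, germFun_mul_germFun, germFun_mul_germFun, ← hs.germFun_one,
      germFun, germFun, germFun, resolutionSum, resolutionSum, resolutionSum,
      ← Finset.sum_add_distrib]
    refine Finset.sum_congr rfl fun γ hγ => ?_
    rw [← add_smul, ← Complex.ofReal_add, ← add_mul, mul_inv_cancel₀ (hpos γ hγ)]
  have h1' : W * p.SP + (r : ℂ) • W = p.P := by
    have := congrArg star h1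
    rwa [star_add, star_mul, star_smul, (p.isSelfAdjoint_germFun s _).star_eq,
      p.isSelfAdjoint_SP.star_eq, star_P, Complex.star_def, Complex.conj_ofReal] at this
  have hSP := p.SP_mul_P
  have hPS := p.P_mul_SP
  let U : (H →L[ℂ] H)ˣ := ⟨p.SP + (r : ℂ) • 1, W + (r : ℂ)⁻¹ • (1 - p.P), by
    simp only [mul_add, add_mul, smul_mul_assoc, mul_smul_comm, mul_sub, mul_one, one_mul, hSP,
      smul_add, smul_sub, smul_smul, mul_inv_cancel₀ hrc,
      inv_mul_cancel₀ hrc, one_smul]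
    linear_combination (norm := module) h1, by
    simp only [mul_add, add_mul, smul_mul_assoc, mul_smul_comm, sub_mul, mul_one, one_mul, hPS,
      smul_add, smul_sub, smul_smul, mul_inv_cancel₀ hrc,
      inv_mul_cancel₀ hrc, one_smul]
    linear_combination (norm := module) h1'⟩
  have h3 : Ring.inverse (p.SP + (r : ℂ) • (1 : H →L[ℂ] H)) = W + (r : ℂ)⁻¹ • (1 - p.P) :=
    Ring.inverse_unit U
  have h4 : p.Ξ r = Ring.inverse (p.SP + (r : ℂ) • (1 : H →L[ℂ] H)) * p.P := rfl
  rw [h4, h3, add_mul, hWP, smul_mul_assoc, sub_mul, one_mul, P_mul_P, sub_self, smul_zero,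
    add_zero]

theorem N₀_eq : p.N₀ = ∑ γ ∈ s, p.germProj γ * p.N * p.germProj γ := by
  rw [N₀, finsum_eq_sum_of_support_subset]
  · rfl
  · intro γ hγ
    by_contra h0
    refine hγ ?_
    change p.germProj γ ∘L p.N ∘L p.germProj γ = 0
    rw [germProj_of_notMem fun h1 => h0 ((hs.mem_iff γ).2 h1)]
    simp

end IsGermSpectrum

end OperatorPencil

/-! ## The second-order coefficient `G` -/

section ResolventIntegrals

open Filter Topology

/-- An antiderivative is 2a^{-1/2} arctan((r/a)^{1/2}); positivity of the integrand gives
integrability from its limit. -/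
theorem integral_inv_sqrt_mul_inv_add {a : ℝ} (ha : 0 < a) :
    IntegrableOn (fun r : ℝ => (√r)⁻¹ * (a + r)⁻¹) (Set.Ioi 0) ∧
      ∫ r in Set.Ioi (0 : ℝ), (√r)⁻¹ * (a + r)⁻¹ = Real.pi / √a := by
  have hsa : 0 < √a := Real.sqrt_pos.2 ha
  let g : ℝ → ℝ := fun r => 2 / √a * Real.arctan (√r / √a)
  have hg0 : g 0 = 0 := by simp [g]
  have hcont : ContinuousWithinAt g (Set.Ici 0) 0 := by
    have : Continuous g := by fun_prop
    exact this.continuousWithinAt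
  have hderiv : ∀ r ∈ Set.Ioi (0 : ℝ), HasDerivAt g ((√r)⁻¹ * (a + r)⁻¹) r := by
    intro r hr
    have hr0 : (0 : ℝ) < r := hr
    have hsr : 0 < √r := Real.sqrt_pos.2 hr0
    have h1 := (((Real.hasDerivAt_sqrt hr0.ne').div_const √a).arctan).const_mul (2 / √a)
    refine h1.congr_deriv ?_
    rw [div_pow, Real.sq_sqrt hr0.le, Real.sq_sqrt ha.le]
    have h2 : √a * √a = a := Real.mul_self_sqrt ha.le
    field_simp
    rw [sq, h2]
  have hlim : Tendsto g atTop (𝓝 (Real.pi / √a)) := by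
    have h1 : Tendsto (fun r : ℝ => √r / √a) atTop atTop :=
      Real.tendsto_sqrt_atTop.atTop_div_const hsa
    have h2 := ((Real.tendsto_arctan_atTop.mono_right nhdsWithin_le_nhds).comp h1).const_mul
      (2 / √a)
    rwa [show 2 / √a * (Real.pi / 2) = Real.pi / √a by ring] at h2
  have hpos : ∀ r ∈ Set.Ioi (0 : ℝ), 0 ≤ (√r)⁻¹ * (a + r)⁻¹ := by
    intro r hr
    have hr0 : (0 : ℝ) < r := hr
    positivity
  refine ⟨integrableOn_Ioi_deriv_of_nonneg hcont hderiv hpos hlim, ?_⟩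
  rw [integral_Ioi_of_hasDerivAt_of_nonneg hcont hderiv hpos hlim, hg0, sub_zero]

/-- The scalar integrand of the operator `𝓘_*`. -/
def resolventKernel (x y r : ℝ) : ℝ :=
  (√r)⁻¹ * ((x + r)⁻¹ + (y + r)⁻¹ - r * ((x + r)⁻¹ * (y + r)⁻¹))

/-- For x ≠ y partial fractions write the kernel as r^{-1/2} times the combination of (x + r)⁻¹ and
(y + r)⁻¹ with coefficients -y/(x - y) and x/(x - y). Only distinct eigenvalues are needed, since
N_* has no diagonal blocks. -/
theorem integral_resolventKernel {x y : ℝ} (hx : 0 < x) (hy : 0 < y) (hxy : x ≠ y) :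
    IntegrableOn (resolventKernel x y) (Set.Ioi 0) ∧
      ∫ r in Set.Ioi (0 : ℝ), resolventKernel x y r
        = Real.pi * ((√x)⁻¹ + (√y)⁻¹ - (√x + √y)⁻¹) := by
  obtain ⟨hix, hex⟩ := integral_inv_sqrt_mul_inv_add hx
  obtain ⟨hiy, hey⟩ := integral_inv_sqrt_mul_inv_add hy
  have hsub : x - y ≠ 0 := sub_ne_zero.2 hxy
  have heq : Set.EqOn (fun r => -y / (x - y) * ((√r)⁻¹ * (x + r)⁻¹)
      + x / (x - y) * ((√r)⁻¹ * (y + r)⁻¹)) (resolventKernel x y) (Set.Ioi 0) := by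
    intro r hr
    have hr0 : (0 : ℝ) < r := hr
    have hsr : 0 < √r := Real.sqrt_pos.2 hr0
    have h1 : x + r ≠ 0 := by positivity
    have h2 : y + r ≠ 0 := by positivity
    simp only [resolventKernel]
    field_simp
    ring
  have hint := (hix.const_mul (-y / (x - y))).add (hiy.const_mul (x / (x - y)))
  refine ⟨IntegrableOn.congr_fun hint heq measurableSet_Ioi, ?_⟩
  rw [← setIntegral_congr_fun measurableSet_Ioi heq,
    integral_add (hix.const_mul _) (hiy.const_mul _), integral_const_mul, integral_const_mul,
    hex, hey]
  have hsx : 0 < √x := Real.sqrt_pos.2 hx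
  have hsy : 0 < √y := Real.sqrt_pos.2 hy
  have h1 : x = √x ^ 2 := (Real.sq_sqrt hx.le).symm
  have h2 : y = √y ^ 2 := (Real.sq_sqrt hy.le).symm
  have h3 : √x - √y ≠ 0 := fun h0 => hsub (by rw [h1, h2, sub_eq_zero.1 h0, sub_self])
  have h4 : x - y = (√x - √y) * (√x + √y) := by
    nth_rewrite 1 [h1]; nth_rewrite 1 [h2]; ring
  rw [h4]
  nth_rewrite 1 [h2]; nth_rewrite 4 [h1]
  field_simp
  ring

end ResolventIntegrals

namespace OperatorPencil

open Filter Topology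

variable {H : Type*} [NormedAddCommGroup H] [InnerProductSpace ℂ H] [CompleteSpace H]
variable {K : Type*} [NormedAddCommGroup K] [InnerProductSpace ℂ K] [CompleteSpace K]
variable {p : OperatorPencil H K} {δ t₀ cstar t : ℝ} {s : Finset ℝ}

namespace IsGermSpectrum

variable (hs : p.IsGermSpectrum cstar s)
include hs

theorem germFun_mul_N₀ (f : ℝ → ℝ) : p.germFun s f * p.N₀ = p.N₀ * p.germFun s f := by
  rw [hs.N₀_eq, Finset.mul_sum, Finset.sum_mul]
  refine Finset.sum_congr rfl fun γ hγ => ?_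
  rw [← mul_assoc, ← mul_assoc, germFun_mul_germProj hγ, mul_assoc (p.germProj γ * p.N),
    germProj_mul_germFun hγ]
  simp only [smul_mul_assoc, mul_smul_comm]

theorem N₀_mul_P : p.N₀ * p.P = p.N₀ := by
  rw [hs.N₀_eq, Finset.sum_mul]
  simp only [mul_assoc, germProj_mul_P]

theorem P_mul_N₀ : p.P * p.N₀ = p.N₀ := by
  rw [← hs.germFun_one, hs.germFun_mul_N₀, hs.germFun_one, hs.N₀_mul_P]

theorem isSelfAdjoint_N₀ : IsSelfAdjoint p.N₀ := by
  rw [hs.N₀_eq]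
  refine isSelfAdjoint_sum s fun γ _ => ?_
  rw [IsSelfAdjoint, star_mul, star_mul, star_germProj, p.isSelfAdjoint_N.star_eq, mul_assoc]

/-- The form of N₀ at u is the sum of the forms of N at the orthogonal vectors P_γu, so the passage
to diagonal blocks does not increase the norm. -/
theorem norm_N₀_le : ‖p.N₀‖ ≤ ‖p.N‖ := by
  refine hs.isSelfAdjoint_N₀.norm_le_of_inner (norm_nonneg _) fun u => ?_
  have h1 : ∀ γ, ⟪u, (p.germProj γ * p.N * p.germProj γ) u⟫_ℂ
      = ⟪p.germProj γ u, p.N (p.germProj γ u)⟫_ℂ := fun γ =>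
    ((p.isStarProjection_germProj γ).isSelfAdjoint.isSymmetric u (p.N (p.germProj γ u))).symm
  rw [hs.N₀_eq, sum_apply, inner_sum]
  have h2 : ∀ γ ∈ s, ‖⟪u, (p.germProj γ * p.N * p.germProj γ) u⟫_ℂ‖
      ≤ ‖p.N‖ * ‖p.germProj γ u‖ ^ 2 := by
    intro γ _
    rw [h1]
    refine (norm_inner_le_norm _ _).trans ?_
    have := mul_le_mul_of_nonneg_left (p.N.le_opNorm (p.germProj γ u))
      (norm_nonneg (p.germProj γ u))
    linarith
  refine (norm_sum_le_of_le _ h2).trans ?_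
  rw [← Finset.mul_sum, hs.sum_norm_sq]
  exact mul_le_mul_of_nonneg_left (pow_le_pow_left₀ (norm_nonneg _) (p.norm_P_apply_le u) 2)
    (norm_nonneg _)

theorem norm_Nstar_le : ‖p.Nstar‖ ≤ 2 * ‖p.N‖ := by
  rw [Nstar]
  refine (norm_sub_le_of_le le_rfl hs.norm_N₀_le).trans (by linarith)

theorem sum_sum_germProj (hNP : p.N * p.P = p.N) (hPN : p.P * p.N = p.N) :
    p.N = ∑ x ∈ s ×ˢ s, p.germProj x.1 * p.N * p.germProj x.2 := by
  rw [Finset.sum_product]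
  simp only [← Finset.mul_sum, hs.sum_eq, mul_assoc]
  rw [← Finset.sum_mul, hs.sum_eq, hNP, hPN]

theorem Nstar_eq (hNP : p.N * p.P = p.N) (hPN : p.P * p.N = p.N) :
    p.Nstar = p.offDiagSum s fun _ _ => 1 := by
  have h1 := hs.sum_sum_germProj hNP hPN
  rw [← Finset.diag_union_offDiag, Finset.sum_union (Finset.disjoint_diag_offDiag s),
    Finset.sum_diag, ← hs.N₀_eq] at h1
  rw [Nstar, offDiagSum, sub_eq_iff_eq_add']
  simpa using h1

/-- On the block P_xNP_y both resolvents are scalars, so the operator integral reduces to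
`integral_resolventKernel` blockwise. -/
theorem Istar_eq (hNP : p.N * p.P = p.N) (hPN : p.P * p.N = p.N) :
    p.Istar = -p.offDiagSum s fun x y => (√x)⁻¹ + (√y)⁻¹ - (√x + √y)⁻¹ := by
  have h1 : Set.EqOn (fun r : ℝ => ((√r : ℂ)⁻¹) •
      (p.Ξ r ∘L p.Nstar + p.Nstar ∘L p.Ξ r - (r : ℂ) • (p.Ξ r ∘L p.Nstar ∘L p.Ξ r)))
      (fun r => p.offDiagSum s fun x y => resolventKernel x y r) (Set.Ioi 0) := by
    intro r hr
    change ((√r : ℂ)⁻¹) • (p.Ξ r * p.Nstar + p.Nstar * p.Ξ r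
      - (r : ℂ) • (p.Ξ r * (p.Nstar * p.Ξ r))) = _
    rw [hs.Ξ_eq hr, hs.Nstar_eq hNP hPN, germFun_mul_offDiagSum, offDiagSum_mul_germFun,
      germFun_mul_offDiagSum, offDiagSum_add]
    simp only [offDiagSum, resolventKernel, Finset.smul_sum, ← Finset.sum_sub_distrib]
    refine Finset.sum_congr rfl fun x _ => ?_
    rw [smul_smul, ← sub_smul, smul_smul]
    congr 1
    push_cast
    ring
  have h2 : ∀ x ∈ s.offDiag, Integrable (fun r : ℝ => (resolventKernel x.1 x.2 r : ℂ) •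
      (p.germProj x.1 * p.N * p.germProj x.2)) (volume.restrict (Set.Ioi 0)) := by
    intro x hx
    obtain ⟨h1, h2, h3⟩ := Finset.mem_offDiag.1 hx
    exact (integral_resolventKernel (hs.pos_of_mem h1) (hs.pos_of_mem h2) h3).1.ofReal.smul_const _
  rw [Istar, setIntegral_congr_fun measurableSet_Ioi h1]
  simp only [offDiagSum]
  rw [integral_finsetSum _ h2, Finset.smul_sum]
  congr 1
  refine Finset.sum_congr rfl fun x hx => ?_
  obtain ⟨h1, h2, h3⟩ := Finset.mem_offDiag.1 hx
  rw [integral_smul_const, integral_complex_ofReal,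
    (integral_resolventKernel (hs.pos_of_mem h1) (hs.pos_of_mem h2) h3).2, smul_smul,
    Complex.ofReal_mul, inv_mul_cancel_left₀ (Complex.ofReal_ne_zero.2 Real.pi_ne_zero)]

/-- The norm bound for solutions of the Sylvester equation with the square root of the germ. -/
theorem norm_le_of_sylvester [FiniteDimensional ℂ p.𝔑] {X : H →L[ℂ] H} (hXP : X * p.P = X)
    (hPX : p.P * X = X) : 2 * √cstar * ‖X‖ ≤ ‖p.sqrtSP * X + X * p.sqrtSP‖ := by
  have hge : ∀ u, √cstar * ‖p.P u‖ ^ 2 ≤ (⟪u, p.sqrtSP u⟫_ℂ).re := fun u => by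
    rw [hs.sqrtSP_eq]
    exact hs.germFun_ge (fun γ hγ => Real.sqrt_le_sqrt (hs.ge γ hγ)) u
  refine _root_.norm_le_of_sylvester (L := p.𝔑) p.P_mem p.isStarProjection_P.norm_le hXP
    (fun u => ?_) (fun u hu => ?_) rfl
  · have h1 : p.P (X u) = X u := congrArg (fun T : H →L[ℂ] H => T u) hPX
    have := hge (X u)
    rwa [h1] at this
  · have := hge u
    rwa [P_eq_self hu] at this

end IsGermSpectrum

/-- The part of the coefficient `G` which solves the equation `√S Y + Y √S = N`. -/
def germCorrection (p : OperatorPencil H K) : H →L[ℂ] H :=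
  (2⁻¹ : ℂ) • (p.N₀ * p.invSqrtSP) + (p.invSqrtSP * p.Nstar + p.Nstar * p.invSqrtSP + p.Istar)

namespace IsGermSpectrum

variable (hs : p.IsGermSpectrum cstar s)
include hs

/-- The kernels x^{-1/2} + y^{-1/2} of the two explicit terms cancel those in 𝓘_* and leave (√x +
√y)⁻¹. -/
theorem sum_eq_offDiagSum (hNP : p.N * p.P = p.N) (hPN : p.P * p.N = p.N) :
    p.invSqrtSP * p.Nstar + p.Nstar * p.invSqrtSP + p.Istar
      = p.offDiagSum s fun x y => (√x + √y)⁻¹ := by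
  rw [hs.Istar_eq hNP hPN, hs.Nstar_eq hNP hPN, hs.invSqrtSP_eq, germFun_mul_offDiagSum,
    offDiagSum_mul_germFun, offDiagSum_add, ← sub_eq_add_neg, offDiagSum_sub]
  exact offDiagSum_congr fun x _ y _ _ => by ring

theorem germCorrection_eq (hNP : p.N * p.P = p.N) (hPN : p.P * p.N = p.N) :
    p.germCorrection = (2⁻¹ : ℂ) • (p.N₀ * p.invSqrtSP)
      + p.offDiagSum s fun x y => (√x + √y)⁻¹ := by
  rw [germCorrection, hs.sum_eq_offDiagSum hNP hPN]

theorem G_eq (hNP : p.N * p.P = p.N) :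
    p.G = p.Z * p.sqrtSP + p.sqrtSP * star p.Z + p.germCorrection := by
  have h1 : p.Nstar * p.P = p.Nstar := by rw [Nstar, sub_mul, hNP, hs.N₀_mul_P]
  have h2 : p.G = p.Z * p.sqrtSP + p.sqrtSP * star p.Z + (2⁻¹ : ℂ) • (p.N₀ * p.invSqrtSP)
    + p.invSqrtSP * (p.Nstar * p.P) + p.Nstar * p.invSqrtSP + p.Istar := rfl
  rw [h2, h1, germCorrection]
  abel

theorem offDiagSum_sylvester (hNP : p.N * p.P = p.N) (hPN : p.P * p.N = p.N) :
    p.sqrtSP * (p.offDiagSum s fun x y => (√x + √y)⁻¹)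
      + (p.offDiagSum s fun x y => (√x + √y)⁻¹) * p.sqrtSP = p.Nstar := by
  rw [hs.Nstar_eq hNP hPN, hs.sqrtSP_eq, germFun_mul_offDiagSum, offDiagSum_mul_germFun,
    offDiagSum_add]
  refine offDiagSum_congr fun x hx y hy _ => ?_
  have h1 := Real.sqrt_pos.2 (hs.pos_of_mem hx)
  have h2 := Real.sqrt_pos.2 (hs.pos_of_mem hy)
  field_simp

/-- On off-diagonal blocks the kernel (√x + √y)⁻¹ inverts the Sylvester operator. N₀ commutes with
√S, so ½N₀S^{-1/2} does the same for the diagonal ones. -/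
theorem germCorrection_sylvester (hNP : p.N * p.P = p.N) (hPN : p.P * p.N = p.N) :
    p.sqrtSP * p.germCorrection + p.germCorrection * p.sqrtSP = p.N := by
  have h1 := hs.offDiagSum_sylvester hNP hPN
  have h2 : p.sqrtSP * p.invSqrtSP = p.P := by
    rw [hs.sqrtSP_eq, hs.invSqrtSP_eq, germFun_mul_germFun, ← hs.germFun_one]
    refine Finset.sum_congr rfl fun γ hγ => ?_
    simp only [mul_inv_cancel₀ (Real.sqrt_pos.2 (hs.pos_of_mem hγ)).ne']
  have h3 : p.invSqrtSP * p.sqrtSP = p.P := by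
    rw [← h2, hs.sqrtSP_eq, hs.invSqrtSP_eq, germFun_mul_germFun, germFun_mul_germFun]
    simp only [mul_comm]
  have h4 : p.sqrtSP * p.N₀ = p.N₀ * p.sqrtSP := by rw [hs.sqrtSP_eq, hs.germFun_mul_N₀]
  have h5 : p.sqrtSP * (p.N₀ * p.invSqrtSP) = p.N₀ := by
    rw [← mul_assoc, h4, mul_assoc, h2, hs.N₀_mul_P]
  have h6 : p.N₀ * p.invSqrtSP * p.sqrtSP = p.N₀ := by rw [mul_assoc, h3, hs.N₀_mul_P]
  rw [hs.germCorrection_eq hNP hPN, mul_add, add_mul, mul_smul_comm, smul_mul_assoc, h5, h6]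
  have h7 : p.N = p.N₀ + p.Nstar := by rw [Nstar]; abel
  conv_rhs => rw [h7, ← h1]
  module

theorem germCorrection_mul_P (hNP : p.N * p.P = p.N) (hPN : p.P * p.N = p.N) :
    p.germCorrection * p.P = p.germCorrection := by
  rw [hs.germCorrection_eq hNP hPN, add_mul, hs.offDiagSum_mul_P, smul_mul_assoc, mul_assoc,
    hs.invSqrtSP_eq, hs.germFun_mul_P]

theorem P_mul_germCorrection (hNP : p.N * p.P = p.N) (hPN : p.P * p.N = p.N) :
    p.P * p.germCorrection = p.germCorrection := by
  rw [hs.germCorrection_eq hNP hPN, mul_add, hs.P_mul_offDiagSum, mul_smul_comm, ← mul_assoc,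
    hs.P_mul_N₀]

theorem norm_germCorrection_le [FiniteDimensional ℂ p.𝔑] (hNP : p.N * p.P = p.N)
    (hPN : p.P * p.N = p.N) : 2 * √cstar * ‖p.germCorrection‖ ≤ ‖p.N‖ := by
  have := hs.norm_le_of_sylvester (hs.germCorrection_mul_P hNP hPN)
    (hs.P_mul_germCorrection hNP hPN)
  rwa [hs.germCorrection_sylvester hNP hPN] at this

theorem norm_invSqrtSP_le : ‖p.invSqrtSP‖ ≤ (√cstar)⁻¹ := by
  have h0 := Real.sqrt_pos.2 hs.pos
  rw [hs.invSqrtSP_eq]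
  refine (p.isSelfAdjoint_germFun s _).norm_le_of_inner (by positivity) fun u => ?_
  rw [hs.inner_germFun, Complex.norm_real, Real.norm_of_nonneg
    (Finset.sum_nonneg fun γ _ => by positivity)]
  calc ∑ γ ∈ s, (√γ)⁻¹ * ‖p.germProj γ u‖ ^ 2
      ≤ ∑ γ ∈ s, (√cstar)⁻¹ * ‖p.germProj γ u‖ ^ 2 := by
        refine Finset.sum_le_sum fun γ hγ => ?_
        have := inv_anti₀ h0 (Real.sqrt_le_sqrt (hs.ge γ hγ))
        gcongr
    _ = (√cstar)⁻¹ * ‖p.P u‖ ^ 2 := by rw [← Finset.mul_sum, hs.sum_norm_sq]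
    _ ≤ _ := by
        gcongr
        exact p.norm_P_apply_le u

/-- 𝓘_* is the Sylvester solution with right side N_*, of norm at most ½c_*^{-1/2}‖N_*‖, minus two
products of norm at most c_*^{-1/2}‖N_*‖ each; hence 5/2. -/
theorem norm_Istar_le [FiniteDimensional ℂ p.𝔑] (hNP : p.N * p.P = p.N)
    (hPN : p.P * p.N = p.N) : ‖p.Istar‖ ≤ 5 / 2 * (√cstar)⁻¹ * ‖p.Nstar‖ := by
  have h0 := Real.sqrt_pos.2 hs.pos
  set X := p.offDiagSum s fun x y => (√x + √y)⁻¹ with hX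
  have h1 : p.Istar = X - (p.invSqrtSP * p.Nstar + p.Nstar * p.invSqrtSP) := by
    rw [hX, ← hs.sum_eq_offDiagSum hNP hPN]; abel
  have h2 := hs.norm_le_of_sylvester (hs.offDiagSum_mul_P _) (hs.P_mul_offDiagSum _)
    (X := X)
  rw [hX, hs.offDiagSum_sylvester hNP hPN, ← hX] at h2
  have h3 : ‖X‖ ≤ 1 / 2 * (√cstar)⁻¹ * ‖p.Nstar‖ := by
    rw [mul_assoc, inv_mul_eq_div, mul_div_assoc', le_div_iff₀ h0]
    linarith
  rw [h1]
  refine (norm_sub_le_of_le h3 (norm_add_le_of_le (norm_mul_le_of_le hs.norm_invSqrtSP_le le_rfl)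
    (norm_mul_le_of_le le_rfl hs.norm_invSqrtSP_le))).trans (le_of_eq ?_)
  ring

end IsGermSpectrum

theorem Assumptions.norm_Istar_le (h : p.Assumptions δ t₀ cstar) :
    ‖p.Istar‖ ≤ 5 / 2 * (√(2 * δ))⁻¹ * (√cstar)⁻¹ * ‖p.X₁‖ ^ 3 := by
  obtain ⟨s, hs⟩ := h.exists_isGermSpectrum
  have := h.ker_finite
  have hδ := h.δ_pos
  have h1 := hs.norm_Istar_le h.N_mul_P h.P_mul_N
  have h2 := hs.norm_Nstar_le
  have h3 := h.norm_N_le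
  have h4 : √(8 * δ) = 2 * √(2 * δ) := by
    rw [show 8 * δ = 2 ^ 2 * (2 * δ) by ring, Real.sqrt_mul (by positivity),
      Real.sqrt_sq (by norm_num)]
  have h5 : 0 < √(2 * δ) := Real.sqrt_pos.2 (by linarith)
  rw [h4] at h3
  have h6 : ‖p.Nstar‖ ≤ (√(2 * δ))⁻¹ * ‖p.X₁‖ ^ 3 := by
    calc ‖p.Nstar‖ ≤ 2 * ((2 * √(2 * δ))⁻¹ * ‖p.X₁‖ ^ 3) := by linarith
      _ = _ := by field_simp
  calc ‖p.Istar‖ ≤ 5 / 2 * (√cstar)⁻¹ * ‖p.Nstar‖ := h1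
    _ ≤ 5 / 2 * (√cstar)⁻¹ * ((√(2 * δ))⁻¹ * ‖p.X₁‖ ^ 3) := by gcongr
    _ = _ := by ring

end OperatorPencil

/-! ## The approximation of `A(t)^{1/2} F(t)` -/

namespace OperatorPencil

open Filter Topology

variable {H : Type*} [NormedAddCommGroup H] [InnerProductSpace ℂ H] [CompleteSpace H]
variable {K : Type*} [NormedAddCommGroup K] [InnerProductSpace ℂ K] [CompleteSpace K]
variable {p : OperatorPencil H K} {δ t₀ cstar t : ℝ} {s : Finset ℝ}

namespace IsGermSpectrum

variable (hs : p.IsGermSpectrum cstar s)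
include hs

theorem sqrtSP_mul_P : p.sqrtSP * p.P = p.sqrtSP := by rw [hs.sqrtSP_eq, hs.germFun_mul_P]

theorem P_mul_sqrtSP : p.P * p.sqrtSP = p.sqrtSP := by rw [hs.sqrtSP_eq, hs.P_mul_germFun]

theorem isSelfAdjoint_sqrtSP : IsSelfAdjoint p.sqrtSP := by
  rw [hs.sqrtSP_eq]; exact p.isSelfAdjoint_germFun s _

theorem sqrtSP_mul_self : p.sqrtSP * p.sqrtSP = p.SP := by
  rw [hs.sqrtSP_eq, germFun_mul_germFun, ← hs.germFun_id]
  refine Finset.sum_congr rfl fun γ hγ => ?_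
  simp only [Real.mul_self_sqrt (hs.pos_of_mem hγ).le]

theorem sqrtSP_ge {u : H} (hu : u ∈ p.𝔑) : √cstar * ‖u‖ ^ 2 ≤ (⟪u, p.sqrtSP u⟫_ℂ).re := by
  have := hs.germFun_ge (fun γ hγ => Real.sqrt_le_sqrt (hs.ge γ hγ)) u
  rwa [P_eq_self hu, ← hs.sqrtSP_eq] at this

theorem sqrtGerm_mul_P (t : ℝ) : p.sqrtGerm t * p.P = p.sqrtGerm t := by
  rw [hs.sqrtGerm_eq, smul_mul_assoc, hs.sqrtSP_mul_P]

theorem P_mul_sqrtGerm (t : ℝ) : p.P * p.sqrtGerm t = p.sqrtGerm t := by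
  rw [hs.sqrtGerm_eq, mul_smul_comm, hs.P_mul_sqrtSP]

theorem isSelfAdjoint_sqrtGerm (t : ℝ) : IsSelfAdjoint (p.sqrtGerm t) := by
  rw [hs.sqrtGerm_eq]
  exact IsSelfAdjoint.smul (Complex.conj_ofReal _) hs.isSelfAdjoint_sqrtSP

theorem sqrtGerm_mul_self (t : ℝ) : p.sqrtGerm t * p.sqrtGerm t = ((t : ℂ) ^ 2) • p.SP := by
  rw [hs.sqrtGerm_eq, smul_mul_smul_comm, hs.sqrtSP_mul_self, ← Complex.ofReal_mul, abs_mul_abs_self,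
    Complex.ofReal_mul, sq]

/-- The weight t|t| is the right one for g: multiplied by the factor |t| of V₀ it gives t³, with the
sign of t. -/
theorem sqrtGerm_mul_germCorrection (hNP : p.N * p.P = p.N) (hPN : p.P * p.N = p.N) (t : ℝ) :
    p.sqrtGerm t * (((t * |t| : ℝ) : ℂ) • p.germCorrection)
      + (((t * |t| : ℝ) : ℂ) • p.germCorrection) * p.sqrtGerm t = ((t : ℂ) ^ 3) • p.N := by
  have h1 : ((|t| : ℝ) : ℂ) * ((t * |t| : ℝ) : ℂ) = (t : ℂ) ^ 3 := by
    rw [← Complex.ofReal_mul, show |t| * (t * |t|) = t * (|t| * |t|) by ring, abs_mul_abs_self]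
    push_cast; ring
  rw [hs.sqrtGerm_eq, smul_mul_smul_comm, smul_mul_smul_comm, h1, mul_comm ((t * |t| : ℝ) : ℂ), h1,
    ← smul_add, hs.germCorrection_sylvester hNP hPN]

end IsGermSpectrum

namespace Assumptions

variable (h : p.Assumptions δ t₀ cstar) (hs : p.IsGermSpectrum cstar s)
include h

theorem sqrt_cstar_pos : 0 < √cstar := Real.sqrt_pos.2 h.cstar_pos

theorem one_le_div_sqrt : 1 ≤ ‖p.X₁‖ / √cstar := by
  rw [one_le_div h.sqrt_cstar_pos]
  exact Real.sqrt_le_iff.2 ⟨norm_nonneg _, h.cstar_le⟩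

include hs

theorem norm_sqrtGerm_le (t : ℝ) : ‖p.sqrtGerm t‖ ≤ |t| * ‖p.X₁‖ := by
  rw [← sq_le_sq₀ (norm_nonneg _) (by positivity), sq, ← CStarRing.norm_star_mul_self,
    (hs.isSelfAdjoint_sqrtGerm t).star_eq, hs.sqrtGerm_mul_self]
  exact h.norm_smul_SP_le t

/-- V ≥ √c_*|t| on the range of F by the spectral lower bound for A(t), and V₀ satisfies the same
bound on 𝔑 because the germ is at least c_*. -/
theorem sylvester_bound (ht : |t| ≤ t₀) (X : H →L[ℂ] H) (hFX : p.F δ t * X = X)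
    (hXP : X * p.P = X) :
    2 * (√cstar * |t|) * ‖X‖ ≤ ‖p.sqrtAF δ t * X + X * p.sqrtGerm t‖ := by
  have := h.ker_finite
  refine norm_le_of_sylvester (L := p.𝔑) p.P_mem p.isStarProjection_P.norm_le hXP
    (fun u => ?_) (fun u hu => ?_) rfl
  · have h1 : p.F δ t (X u) = X u := congrArg (fun T : H →L[ℂ] H => T u) hFX
    have := h.sqrtAF_ge ht (X u)
    rwa [h1] at this
  · rw [hs.sqrtGerm_eq, smul_apply, inner_smul_right, Complex.re_ofReal_mul]
    have := mul_le_mul_of_nonneg_left (hs.sqrtSP_ge hu) (abs_nonneg t)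
    linarith

theorem norm_sqrtAF_sq_sub_le' (ht : |t| ≤ t₀) :
    ‖p.sqrtAF δ t * p.sqrtAF δ t - p.sqrtGerm t * p.sqrtGerm t
      - (p.sqrtGerm t * (((t * |t| : ℝ) : ℂ) • p.germCorrection)
        + (((t * |t| : ℝ) : ℂ) • p.germCorrection) * p.sqrtGerm t)
      - ((t : ℂ) • p.Z) * (p.sqrtGerm t * p.sqrtGerm t)
      - (p.sqrtGerm t * p.sqrtGerm t) * star ((t : ℂ) • p.Z)‖
      ≤ 2200 * (|t| * ‖p.X₁‖) ^ 2 * p.smallness δ t ^ 2 := by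
  rw [hs.sqrtGerm_mul_germCorrection h.N_mul_P h.P_mul_N, hs.sqrtGerm_mul_self]
  exact h.norm_sqrtAF_sq_sub_le ht

theorem norm_F_mul_sub_mul_P_le (ht : |t| ≤ t₀) (ht0 : t ≠ 0) :
    ‖p.F δ t * (p.sqrtAF δ t - p.sqrtGerm t) * p.P‖
      ≤ 1102 * (|t| * ‖p.X₁‖) * p.smallness δ t * (‖p.X₁‖ / √cstar) := by
  have h0 := h.sqrt_cstar_pos
  refine norm_sqrt_sub_le (g := ((t * |t| : ℝ) : ℂ) • p.germCorrection) (a := √cstar * |t|)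
    (p.isStarProjection_F δ t)
    p.isStarProjection_P (by positivity) (by field_simp)
    (p.smallness_nonneg δ t) (h.smallness_le_one ht) (h.norm_smul_Z_le t)
    (p.F_mul_sqrtAF δ t) (p.sqrtAF_mul_F δ t) (hs.sqrtGerm_mul_P t) (hs.P_mul_sqrtGerm t)
    (h.norm_sqrtGerm_le hs t) ?_ (h.norm_sqrtAF_sq_sub_le' hs ht) (h.sylvester_bound hs ht)
  rw [hs.sqrtGerm_mul_germCorrection h.N_mul_P h.P_mul_N]
  exact h.norm_smul_N_le t

theorem norm_smul_germCorrection_le (t : ℝ) :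
    ‖((t * |t| : ℝ) : ℂ) • p.germCorrection‖
      ≤ (|t| * ‖p.X₁‖) * p.smallness δ t * (‖p.X₁‖ / √cstar) := by
  have := h.ker_finite
  have h0 := h.sqrt_cstar_pos
  rcases eq_or_ne t 0 with rfl | ht0
  · simp
  have h1 := hs.norm_germCorrection_le h.N_mul_P h.P_mul_N
  have h2 := h.norm_smul_N_le t
  rw [norm_smul, norm_pow, Complex.norm_real, Real.norm_eq_abs] at h2
  rw [norm_smul, Complex.norm_real, Real.norm_eq_abs, abs_mul, abs_abs]
  have hpos : 0 < |t| := abs_pos.2 ht0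
  refine le_of_mul_le_mul_left (a := |t| * √cstar) ?_ (by positivity)
  calc |t| * √cstar * (|t| * |t| * ‖p.germCorrection‖)
      = |t| ^ 3 * (√cstar * ‖p.germCorrection‖) := by ring
    _ ≤ |t| ^ 3 * ‖p.N‖ := by
        have : 0 ≤ √cstar * ‖p.germCorrection‖ := by positivity
        gcongr
        linarith
    _ ≤ _ := h2
    _ = _ := by field_simp

theorem norm_sqrtAF_sub_le (ht : |t| ≤ t₀) (ht0 : t ≠ 0) :
    ‖p.sqrtAF δ t - p.sqrtGerm t - ((t : ℂ) • p.Z) * p.sqrtGerm t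
      - p.sqrtGerm t * star ((t : ℂ) • p.Z) - ((t * |t| : ℝ) : ℂ) • p.germCorrection‖
      ≤ 5000 * (|t| * ‖p.X₁‖) * p.smallness δ t ^ 2 * (‖p.X₁‖ / √cstar) ^ 3 := by
  have h0 := h.sqrt_cstar_pos
  refine norm_sqrt_sub_sub_le (a := √cstar * |t|)
    (p.isStarProjection_F δ t) p.isStarProjection_P (by positivity) (by field_simp)
    h.one_le_div_sqrt
    (p.smallness_nonneg δ t) (h.smallness_le_one ht) (h.P_mul_smul_Z t) (h.smul_Z_mul_P t)
    (h.norm_smul_Z_le t)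
    (p.F_mul_sqrtAF δ t) (p.sqrtAF_mul_F δ t) (hs.sqrtGerm_mul_P t) (hs.P_mul_sqrtGerm t)
    ?_ ?_ (h.norm_sqrtAF_le ht) (h.norm_sqrtGerm_le hs t) (h.norm_smul_germCorrection_le hs t)
    (h.norm_F_sub_approxProj_le ht) (h.norm_one_sub_F_mul_P_le t)
    (h.norm_one_sub_F_mul_approxProj_le t) (h.norm_sqrtAF_sq_sub_le' hs ht)
    (h.norm_F_mul_sub_mul_P_le hs ht ht0) (h.sylvester_bound hs ht)
  · rw [mul_smul_comm, hs.P_mul_germCorrection h.N_mul_P h.P_mul_N]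
  · rw [smul_mul_assoc, hs.germCorrection_mul_P h.N_mul_P h.P_mul_N]

/-- This identifies the approximant L of `norm_sqrt_sub_sub_le` with |t|S^{1/2}P + t|t|G; the
Z-terms of G are tZV₀ and V₀(tZ)^*. -/
theorem sqrtGerm_add_eq (t : ℝ) :
    ((|t| : ℝ) : ℂ) • p.sqrtSP + ((t * |t| : ℝ) : ℂ) • p.G
      = p.sqrtGerm t + ((t : ℂ) • p.Z) * p.sqrtGerm t + p.sqrtGerm t * star ((t : ℂ) • p.Z)
        + ((t * |t| : ℝ) : ℂ) • p.germCorrection := by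
  rw [hs.G_eq h.N_mul_P, hs.sqrtGerm_eq, smul_mul_smul_comm, star_smul, smul_mul_smul_comm,
    Complex.star_def, Complex.conj_ofReal, smul_add, smul_add, Complex.ofReal_mul,
    mul_comm ((|t| : ℝ) : ℂ)]
  abel

omit hs in
theorem rpow_neg_three_half : cstar ^ (-(3 / 2) : ℝ) = (√cstar)⁻¹ ^ 3 := by
  rw [Real.sqrt_eq_rpow, ← Real.rpow_neg h.cstar_pos.le, ← Real.rpow_natCast,
    ← Real.rpow_mul h.cstar_pos.le]
  norm_num

-- Since mθ²κ³ = ‖X₁‖⁶δ⁻¹c_*^{-3/2}|t|³, the error is the middle term of C₁₀, the other two being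
-- nonnegative.
omit hs in
theorem le_constC10 {β₁₀ β₁₁ β₁₂ : ℝ} (hβ₁₀ : 0 ≤ β₁₀) (hβ₁₂ : 0 ≤ β₁₂) (t : ℝ) :
    β₁₁ * (|t| * ‖p.X₁‖) * p.smallness δ t ^ 2 * (‖p.X₁‖ / √cstar) ^ 3
      ≤ constC10 β₁₀ β₁₁ β₁₂ δ ‖p.X₁‖ cstar * |t| ^ 3 := by
  have hδ := h.δ_pos
  have hc := h.cstar_pos
  have h1 : p.smallness δ t ^ 2 = |t| ^ 2 * ‖p.X₁‖ ^ 2 * δ⁻¹ := by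
    rw [smallness, div_pow, Real.sq_sqrt hδ.le, mul_pow, div_eq_mul_inv]
  rw [constC10, h.rpow_neg_three_half, h1]
  have h2 : 0 ≤ β₁₀ * ‖p.X₁‖ ^ 4 * δ⁻¹ * cstar ^ (-(1 / 2) : ℝ) := by positivity
  have h3 : 0 ≤ β₁₂ * ‖p.X₁‖ ^ 8 * δ⁻¹ * cstar ^ (-(5 / 2) : ℝ) := by positivity
  calc _ = (β₁₁ * ‖p.X₁‖ ^ 6 * δ⁻¹ * (√cstar)⁻¹ ^ 3) * |t| ^ 3 := by
        rw [div_eq_mul_inv]; ring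
    _ ≤ _ := by gcongr; linarith

/-- The second-order approximation of `A(t)^{1/2} F(t)`. -/
theorem norm_sqrtAF_sub_G_le {β₁₀ β₁₂ : ℝ} (hβ₁₀ : 0 ≤ β₁₀) (hβ₁₂ : 0 ≤ β₁₂) (ht : |t| ≤ t₀) :
    ‖p.sqrtAF δ t - ((|t| : ℝ) : ℂ) • p.sqrtSP - ((t * |t| : ℝ) : ℂ) • p.G‖
      ≤ constC10 β₁₀ 5000 β₁₂ δ ‖p.X₁‖ cstar * |t| ^ 3 := by
  -- The Sylvester constant a = √c_*|t| degenerates at t = 0, where V itself vanishes.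
  rcases eq_or_ne t 0 with rfl | ht0
  · have h1 := h.norm_sqrtAF_le ht
    simpa using h1
  · refine le_trans (le_of_eq ?_)
      ((h.norm_sqrtAF_sub_le hs ht ht0).trans (h.le_constC10 hβ₁₀ hβ₁₂ t))
    congr 1
    rw [sub_sub, h.sqrtGerm_add_eq hs]
    abel

end Assumptions

end OperatorPencil

/-! ## Comparison of cosines -/

section Cosine

variable {H : Type*} [NormedAddCommGroup H] [InnerProductSpace ℂ H] [CompleteSpace H]

open NormedSpace

theorem norm_exp_smul_I_smul_le {V : H →L[ℂ] H} (hV : IsSelfAdjoint V) (r : ℝ) :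
    ‖exp (r • (Complex.I • V))‖ ≤ 1 := by
  have hrV : IsSelfAdjoint (r • V) := IsSelfAdjoint.smul (IsSelfAdjoint.all r) hV
  have h1 : exp (r • (Complex.I • V)) = (selfAdjoint.expUnitary ⟨r • V, hrV⟩ : H →L[ℂ] H) := by
    rw [selfAdjoint.expUnitary_coe, smul_comm]
  have h2 := Unitary.coe_star_mul_self (selfAdjoint.expUnitary ⟨r • V, hrV⟩)
  rw [← h1] at h2
  have h3 : ‖exp (r • (Complex.I • V))‖ * ‖exp (r • (Complex.I • V))‖ ≤ 1 := by
    rw [← CStarRing.norm_star_mul_self, h2]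
    exact ContinuousLinearMap.norm_id_le
  nlinarith [norm_nonneg (exp (r • (Complex.I • V)))]

/-- Euler's formula: it reduces the cosine to unitary exponentials, for which Duhamel's formula is
available. -/
theorem cfc_cos_eq {V : H →L[ℂ] H} (hV : IsSelfAdjoint V) (r : ℝ) :
    cfc (fun x : ℝ => Real.cos (r * x)) V
      = (2⁻¹ : ℂ) • (exp (r • (Complex.I • V)) + exp ((-r) • (Complex.I • V))) := by
  have key : ∀ a : ℝ, exp (a • (Complex.I • V))
      = cfc (fun z : ℂ => Complex.exp (a * Complex.I * z)) V := by
    intro a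
    have h1 : a • (Complex.I • V) = ((a : ℂ) * Complex.I) • V := by
      rw [mul_smul, Complex.coe_smul]
    have h2 : IsStarNormal (((a : ℂ) * Complex.I) • V) := by
      have := hV.isStarNormal
      exact IsStarNormal.smul _ _
    rw [h1, ← CFC.complex_exp_eq_normedSpace_exp h2]
    exact (cfc_comp_const_mul ((a : ℂ) * Complex.I) Complex.exp V (by fun_prop)
      hV.isStarNormal).symm
  rw [key, key, ← cfc_add .., ← cfc_smul .., cfc_real_eq_complex ..]
  refine cfc_congr fun z hz => ?_
  have hz' : z = z.re := hV.mem_spectrum_eq_re hz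
  rw [hz']
  simp only [Complex.ofReal_re, smul_eq_mul, Complex.ofReal_cos, Complex.cos, Complex.ofReal_mul]
  rw [div_eq_inv_mul]
  congr 3 <;> push_cast <;> ring

/-- Duhamel's estimate for the intertwining of the exponentials. -/
theorem norm_exp_mul_sub_le {V V₀ : H →L[ℂ] H} (hV : IsSelfAdjoint V) (hV₀ : IsSelfAdjoint V₀)
    (L : H →L[ℂ] H) (r : ℝ) :
    ‖exp (r • (Complex.I • V)) * L - L * exp (r • (Complex.I • V₀))‖ ≤ |r| * ‖V * L - L * V₀‖ := by
  let W := Complex.I • V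
  let W₀ := Complex.I • V₀
  -- The derivative of e^{uW}Le^{-uW₀} is e^{uW}(WL - LW₀)e^{-uW₀}, of norm at most ‖VL - LV₀‖ by
  -- unitarity.
  let f : ℝ → H →L[ℂ] H := fun u => exp (u • W) * L * exp (u • (-W₀))
  have hd : ∀ u, HasDerivAt f (exp (u • W) * (W * L - L * W₀) * exp (u • (-W₀))) u := by
    intro u
    have h1 := ((hasDerivAt_exp_smul_const (𝕂 := ℝ) W u).mul_const L).mul
      (hasDerivAt_exp_smul_const' (𝕂 := ℝ) (-W₀) u)
    refine h1.congr_deriv ?_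
    noncomm_ring
  have hbound : ∀ u : ℝ, ‖exp (u • W) * (W * L - L * W₀) * exp (u • (-W₀))‖ ≤ ‖V * L - L * V₀‖ := by
    intro u
    have h1 : u • (-W₀) = (-u) • (Complex.I • V₀) := by rw [smul_neg, neg_smul]
    have h2 : W * L - L * W₀ = Complex.I • (V * L - L * V₀) := by
      change (Complex.I • V) * L - L * (Complex.I • V₀) = _
      rw [smul_mul_assoc, mul_smul_comm, smul_sub]
    rw [h1, h2]
    refine (norm_mul_le_of_le (norm_mul_le_of_le (norm_exp_smul_I_smul_le hV u) le_rfl)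
      (norm_exp_smul_I_smul_le hV₀ (-u))).trans ?_
    rw [norm_smul, Complex.norm_I]
    linarith
  have h1 : ‖f r - f 0‖ ≤ ‖V * L - L * V₀‖ * ‖r - 0‖ :=
    convex_univ.norm_image_sub_le_of_norm_hasDerivWithin_le
      (fun u _ => (hd u).hasDerivWithinAt) (fun u _ => hbound u) (Set.mem_univ _) (Set.mem_univ _)
  have h2 : exp (r • W) * L - L * exp (r • W₀) = (f r - f 0) * exp (r • W₀) := by
    have h3 : exp (r • (-W₀)) * exp (r • W₀) = 1 := by
      have hc : Commute (r • (-W₀)) (r • W₀) := by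
        rw [smul_neg]; exact (Commute.refl _).neg_left
      let +nondep : NormedAlgebra ℚ (H →L[ℂ] H) := .restrictScalars ℚ ℂ (H →L[ℂ] H)
      rw [← exp_add_of_commute hc, smul_neg, neg_add_cancel, exp_zero]
    have h4 : f 0 = L := by simp [f]
    rw [h4, sub_mul, mul_assoc (exp (r • W) * L), h3, mul_one]
  change ‖exp (r • W) * L - L * exp (r • W₀)‖ ≤ _
  rw [h2]
  refine (norm_mul_le_of_le h1 (norm_exp_smul_I_smul_le hV₀ r)).trans (le_of_eq ?_)
  rw [sub_zero, Real.norm_eq_abs]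
  ring

theorem norm_cos_mul_sub_le {V V₀ : H →L[ℂ] H} (hV : IsSelfAdjoint V) (hV₀ : IsSelfAdjoint V₀)
    (L : H →L[ℂ] H) (r : ℝ) :
    ‖cfc (fun x : ℝ => Real.cos (r * x)) V * L - L * cfc (fun x : ℝ => Real.cos (r * x)) V₀‖
      ≤ |r| * ‖V * L - L * V₀‖ := by
  have h1 := norm_exp_mul_sub_le hV hV₀ L r
  have h2 := norm_exp_mul_sub_le hV hV₀ L (-r)
  rw [abs_neg] at h2
  rw [cfc_cos_eq hV, cfc_cos_eq hV₀, smul_mul_assoc, mul_smul_comm, ← smul_sub, add_mul, mul_add,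
    add_sub_add_comm, norm_smul]
  have h3 : ‖(2⁻¹ : ℂ)‖ = 2⁻¹ := by simp
  have h4 := norm_add_le_of_le h1 h2
  rw [h3]
  linarith

theorem norm_cfc_cos_le (V : H →L[ℂ] H) (r : ℝ) :
    ‖cfc (fun x : ℝ => Real.cos (r * x)) V‖ ≤ 1 :=
  norm_cfc_le zero_le_one fun _ _ => Real.abs_cos_le_one _

/-- The smoothing factor `ε^{3/2} (t² + ε²)^{-3/4}`. -/
theorem mul_smoothing_le {E a b t ε τ : ℝ} (ha : 0 ≤ a) (hb : 0 ≤ b) (hε : 0 < ε) (hE2 : E ≤ 2)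
    (hE : E ≤ a * |t| + |ε⁻¹ * τ| * (b * |t| ^ 3)) :
    E * (ε ^ (3 / 2 : ℝ) * (t ^ 2 + ε ^ 2) ^ (-(3 / 4) : ℝ)) ≤ (max 2 a + b * |τ|) * ε := by
  set w := ε ^ (3 / 2 : ℝ) * (t ^ 2 + ε ^ 2) ^ (-(3 / 4) : ℝ) with hw
  set q := t ^ 2 + ε ^ 2 with hq
  have hq0 : 0 < q := by positivity
  have hw0 : 0 < w := by positivity
  have hw4 : w ^ 4 = ε ^ 6 / q ^ 3 := by
    have e1 : (ε ^ (3 / 2 : ℝ)) ^ 4 = ε ^ 6 := by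
      rw [← Real.rpow_natCast, ← Real.rpow_mul hε.le]
      norm_num
    have e2 : (q ^ (-(3 / 4) : ℝ)) ^ 4 = (q ^ 3)⁻¹ := by
      rw [← Real.rpow_natCast, ← Real.rpow_mul hq0.le,
        show (-(3 / 4) * ((4 : ℕ) : ℝ) : ℝ) = -3 by norm_num, Real.rpow_neg hq0.le]
      norm_num
    rw [hw, mul_pow, e1, e2, div_eq_mul_inv]
  have ht2 : t ^ 2 ≤ q := by rw [hq]; nlinarith
  have hε2 : ε ^ 2 ≤ q := by rw [hq]; nlinarith
  have ht6 : t ^ 6 ≤ q ^ 3 := by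
    calc t ^ 6 = (t ^ 2) ^ 3 := by ring
      _ ≤ q ^ 3 := by gcongr
  have h1 : |t| * w ≤ ε := by
    refine le_of_pow_le_pow_left₀ (n := 4) (by norm_num) hε.le ?_
    rw [mul_pow, hw4, mul_div_assoc', div_le_iff₀ (by positivity)]
    have h2 : |t| ^ 4 = t ^ 2 * t ^ 2 := by rw [← sq_abs t]; ring
    rw [h2]
    calc t ^ 2 * t ^ 2 * ε ^ 6 = ε ^ 4 * (t ^ 2 * t ^ 2 * ε ^ 2) := by ring
      _ ≤ ε ^ 4 * (q * q * q) := by gcongr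
      _ = _ := by ring
  have hτ : 0 ≤ b * |τ| := by positivity
  -- If ε ≤ |t|³, the factor itself is at most ε and the trivial bound E ≤ 2 suffices. Otherwise the
  -- factor turns both |t| and ε⁻¹|t|³ into at most ε.
  rcases le_total ε (|t| ^ 3) with h | h
  · have h2 : w ≤ ε := by
      refine le_of_pow_le_pow_left₀ (n := 4) (by norm_num) hε.le ?_
      rw [hw4, div_le_iff₀ (by positivity)]
      have h3 : ε ^ 2 ≤ t ^ 6 := by
        calc ε ^ 2 ≤ (|t| ^ 3) ^ 2 := by gcongr
          _ = (|t| ^ 2) ^ 3 := by ring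
          _ = t ^ 6 := by rw [sq_abs]; ring
      calc ε ^ 6 = ε ^ 4 * ε ^ 2 := by ring
        _ ≤ ε ^ 4 * q ^ 3 := by gcongr; exact h3.trans ht6
    calc E * w ≤ 2 * w := by gcongr
      _ ≤ 2 * ε := by gcongr
      _ ≤ _ := by
        refine mul_le_mul_of_nonneg_right ?_ hε.le
        have := le_max_left 2 a
        linarith
  · have h2 : ε⁻¹ * |t| ^ 3 * w ≤ ε := by
      refine le_of_pow_le_pow_left₀ (n := 4) (by norm_num) hε.le ?_
      rw [mul_pow, hw4, mul_pow, mul_div_assoc', div_le_iff₀ (by positivity)]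
      have h3 : (|t| ^ 3) ^ 4 = t ^ 6 * t ^ 6 := by
        rw [show (|t| ^ 3) ^ 4 = (|t| ^ 2) ^ 6 by ring, sq_abs]; ring
      have h4 : t ^ 6 ≤ ε ^ 2 := by
        calc t ^ 6 = (t ^ 2) ^ 3 := by ring
          _ = (|t| ^ 3) ^ 2 := by rw [← sq_abs]; ring
          _ ≤ ε ^ 2 := by gcongr
      rw [h3, show ε⁻¹ ^ 4 * (t ^ 6 * t ^ 6) * ε ^ 6 = ε ^ 2 * (t ^ 6 * t ^ 6) by field_simp]
      have h5 : 0 ≤ t ^ 6 := by positivity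
      calc ε ^ 2 * (t ^ 6 * t ^ 6) ≤ ε ^ 2 * (ε ^ 2 * q ^ 3) := by gcongr
        _ = _ := by ring
    calc E * w ≤ (a * |t| + |ε⁻¹ * τ| * (b * |t| ^ 3)) * w := by gcongr
      _ = a * (|t| * w) + b * |τ| * (ε⁻¹ * |t| ^ 3 * w) := by
        rw [abs_mul, abs_inv, abs_of_pos hε]; ring
      _ ≤ a * ε + b * |τ| * ε := by gcongr
      _ ≤ _ := by
        rw [← add_mul]
        refine mul_le_mul_of_nonneg_right ?_ hε.le
        have := le_max_right 2 a
        linarith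

end Cosine

/-! ## The operator cosine at the threshold -/

namespace OperatorPencil

open Filter Topology

variable {H : Type*} [NormedAddCommGroup H] [InnerProductSpace ℂ H] [CompleteSpace H]
variable {K : Type*} [NormedAddCommGroup K] [InnerProductSpace ℂ K] [CompleteSpace K]
variable {p : OperatorPencil H K} {δ t₀ cstar t : ℝ} {s : Finset ℝ}

theorem norm_cosSqrtA_le (p : OperatorPencil H K) (r t : ℝ) : ‖p.cosSqrtA r t‖ ≤ 1 :=
  (spectralMeasure (p.A t)).norm_integral_cos_le r

theorem norm_cosSqrtGerm_le (p : OperatorPencil H K) (r t : ℝ) : ‖p.cosSqrtGerm r t‖ ≤ 1 :=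
  norm_cfc_cos_le _ r

theorem cosSqrtA_mul_F (p : OperatorPencil H K) (δ r t : ℝ) :
    p.cosSqrtA r t * p.F δ t
      = cfc (fun x : ℝ => Real.cos (r * x)) (p.sqrtAF δ t) * p.F δ t :=
  (spectralMeasure (p.A t)).integral_cos_mul_E δ r

/-- The solution of the commutator equation `S M - M S = N_*`. -/
def germCommutant (p : OperatorPencil H K) (s : Finset ℝ) : H →L[ℂ] H :=
  p.offDiagSum s fun x y => (x - y)⁻¹

namespace IsGermSpectrum

variable (hs : p.IsGermSpectrum cstar s)
include hs

/-- Since (√x - √y)/(x - y) = (√x + √y)⁻¹, the commutator reproduces the off-diagonal kernel. The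
diagonal part of Y is no commutator, which is where N₀ = 0 enters. -/
theorem germCommutant_commutator (hNP : p.N * p.P = p.N) (hPN : p.P * p.N = p.N)
    (hN₀ : p.N₀ = 0) :
    p.sqrtSP * p.germCommutant s - p.germCommutant s * p.sqrtSP = p.germCorrection := by
  rw [hs.germCorrection_eq hNP hPN, hN₀, zero_mul, smul_zero, zero_add, hs.sqrtSP_eq,
    germCommutant, germFun_mul_offDiagSum, offDiagSum_mul_germFun, offDiagSum_sub]
  refine offDiagSum_congr fun x hx y hy hxy => ?_
  have h1 := Real.sqrt_pos.2 (hs.pos_of_mem hx)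
  have h2 := Real.sqrt_pos.2 (hs.pos_of_mem hy)
  have h3 : x - y = (√x + √y) * (√x - √y) := by
    have e1 := Real.mul_self_sqrt (hs.pos_of_mem hx).le
    have e2 := Real.mul_self_sqrt (hs.pos_of_mem hy).le
    linear_combination -e1 + e2
  have h4 : √x - √y ≠ 0 := fun h0 => hxy (by rw [h0, mul_zero] at h3; linarith)
  rw [h3]
  field_simp

theorem norm_germCommutant_le {b : ℝ} (hb : 0 ≤ b)
    (hk : ∀ x ∈ s, ∀ y ∈ s, x ≠ y → p.germProj x * p.N * p.germProj y ≠ 0 → |(x - y)⁻¹| ≤ b) :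
    ‖p.germCommutant s‖ ≤ (p.n : ℝ) ^ 2 * (b * ‖p.N‖) := by
  refine (norm_offDiagSum_le hb hk).trans ?_
  have := hs.card_le
  gcongr

end IsGermSpectrum

namespace Assumptions

variable (h : p.Assumptions δ t₀ cstar) (hs : p.IsGermSpectrum cstar s)
include h hs

/-- By the second-order expansion, F(V - V₀)P equals F(zV₀ + g) up to O(|t|³). The commutator of V₀
with tM removes g, and FzV₀ is small because z maps into 𝔑ᗮ, which F nearly annihilates. -/
theorem norm_intertwining_le (ht : |t| ≤ t₀) (hN₀ : p.N₀ = 0) :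
    ‖p.sqrtAF δ t * (p.F δ t * (p.P - (t : ℂ) • p.germCommutant s))
        - p.F δ t * (p.P - (t : ℂ) • p.germCommutant s) * p.sqrtGerm t‖
      ≤ 2 * (|t| * ‖p.X₁‖) * p.smallness δ t ^ 2
        + 5000 * (|t| * ‖p.X₁‖) * p.smallness δ t ^ 2 * (‖p.X₁‖ / √cstar) ^ 3
        + 1102 * (|t| * ‖p.X₁‖) * p.smallness δ t * (‖p.X₁‖ / √cstar)
          * (|t| * ‖p.germCommutant s‖) := by
  have h0 := h.sqrt_cstar_pos
  have hθ := p.smallness_nonneg δ t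
  rcases eq_or_ne t 0 with rfl | ht0
  · have h1 := h.norm_sqrtAF_le ht
    have h2 := h.norm_sqrtGerm_le hs 0
    rw [abs_zero, zero_mul, mul_zero, norm_le_zero_iff] at h1
    rw [abs_zero, zero_mul, norm_le_zero_iff] at h2
    rw [h1, h2, zero_mul, mul_zero, sub_zero, norm_zero]
    simp
  set F := p.F δ t with hF
  set V := p.sqrtAF δ t with hV
  set V₀ := p.sqrtGerm t with hV₀
  set z := (t : ℂ) • p.Z with hz
  set M := (t : ℂ) • p.germCommutant s with hM
  set g := ((t * |t| : ℝ) : ℂ) • p.germCorrection with hg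
  set Φ := V - V₀ - z * V₀ - V₀ * star z - g with hΦ
  have hFV : F * V = V := p.F_mul_sqrtAF δ t
  have hVF : V * F = V := p.sqrtAF_mul_F δ t
  have hV₀P : V₀ * p.P = V₀ := hs.sqrtGerm_mul_P t
  have hPV₀ : p.P * V₀ = V₀ := hs.P_mul_sqrtGerm t
  have hPz : p.P * z = 0 := h.P_mul_smul_Z t
  have hzsP : star z * p.P = 0 := by
    have := congrArg star hPz
    rwa [star_mul, star_P, star_zero] at this
  have hPM : p.P * M = M := by rw [hM, mul_smul_comm, germCommutant, hs.P_mul_offDiagSum]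
  have hgP : g * p.P = g := by
    rw [hg, smul_mul_assoc, hs.germCorrection_mul_P h.N_mul_P h.P_mul_N]
  have hcomm : V₀ * M - M * V₀ = g := by
    rw [hV₀, hM, hg, hs.sqrtGerm_eq, smul_mul_smul_comm, smul_mul_smul_comm,
      mul_comm (t : ℂ), ← smul_sub, hs.germCommutant_commutator h.N_mul_P h.P_mul_N hN₀,
      ← Complex.ofReal_mul, mul_comm]
  have hMn : ‖M‖ ≤ |t| * ‖p.germCommutant s‖ := by
    rw [hM, norm_smul, Complex.norm_real, Real.norm_eq_abs]
  -- The three terms are the part of F on 𝔑ᗮ, the remainder Φ of the square root, and the error made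
  -- by letting V₀ replace V next to M; each is O(|t|³).
  have key : V * (F * (p.P - M)) - F * (p.P - M) * V₀
      = F * (1 - p.P) * z * V₀ + F * Φ * p.P - F * (V - V₀) * p.P * M := by
    have hPM' : F * (V - V₀) * p.P * M = F * (V - V₀) * M := by rw [mul_assoc _ p.P M, hPM]
    have hFg : F * (V₀ * M) - F * (M * V₀) = F * g := by rw [← mul_sub, hcomm]
    rw [hPM', hΦ]
    simp only [mul_sub, sub_mul, mul_assoc, mul_one, hPz, hzsP, hV₀P, hPV₀, hgP, hFV,
      mul_mul_of_mul_eq hVF, mul_mul_of_mul_eq hFV, mul_mul_of_mul_eq hPz, zero_mul, mul_zero,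
      sub_zero]
    rw [← hFg]
    abel
  have hF1 : ‖F * (1 - p.P)‖ ≤ 2 * p.smallness δ t := by
    have h1 := h.norm_one_sub_P_mul_F_le ht
    rwa [← norm_star, star_mul, star_sub, star_one, star_P,
      (p.isStarProjection_F δ t).isSelfAdjoint.star_eq] at h1
  rw [key]
  refine (norm_sub_le_of_le (norm_add_le_of_le (norm_mul_le_of_le (norm_mul_le_of_le hF1
    (h.norm_smul_Z_le t)) (h.norm_sqrtGerm_le hs t)) (norm_mul_le_of_le (norm_mul_le_of_le
    (p.isStarProjection_F δ t).norm_le (h.norm_sqrtAF_sub_le hs ht ht0))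
    p.isStarProjection_P.norm_le))
    (norm_mul_le_of_le (h.norm_F_mul_sub_mul_P_le hs ht ht0) hMn)).trans (le_of_eq ?_)
  ring

/-- Replacing P by the intertwiner L on both sides costs 2‖P - L‖ = O(|t|) independently of r; only
the intertwining defect is multiplied by |r|. As L has range in Ran F, cos(rA(t)^{1/2}) acts on it
as the cosine of V. -/
theorem norm_cos_sub_le (ht : |t| ≤ t₀) (hN₀ : p.N₀ = 0) (r : ℝ) :
    ‖p.cosSqrtA r t * p.P - p.cosSqrtGerm r t * p.P‖
      ≤ 2 * (p.smallness δ t + |t| * ‖p.germCommutant s‖)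
        + |r| * (2 * (|t| * ‖p.X₁‖) * p.smallness δ t ^ 2
        + 5000 * (|t| * ‖p.X₁‖) * p.smallness δ t ^ 2 * (‖p.X₁‖ / √cstar) ^ 3
        + 1102 * (|t| * ‖p.X₁‖) * p.smallness δ t * (‖p.X₁‖ / √cstar)
          * (|t| * ‖p.germCommutant s‖)) := by
  set L := p.F δ t * (p.P - (t : ℂ) • p.germCommutant s) with hL
  set C := p.cosSqrtA r t with hC
  set C₀ := p.cosSqrtGerm r t with hC₀
  set CV := cfc (fun x : ℝ => Real.cos (r * x)) (p.sqrtAF δ t) with hCV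
  have hFL : p.F δ t * L = L := by
    rw [hL, ← mul_assoc, (p.isStarProjection_F δ t).isIdempotentElem.eq]
  have hCL : C * L = CV * L := by
    rw [← hFL, ← mul_assoc, hC, p.cosSqrtA_mul_F, mul_assoc]
  have hcommP : C₀ * p.P = p.P * C₀ := by
    have h1 : Commute (p.sqrtGerm t) p.P := by
      change p.sqrtGerm t * p.P = p.P * p.sqrtGerm t
      rw [hs.sqrtGerm_mul_P, hs.P_mul_sqrtGerm]
    exact Commute.cfc_real h1 _
  have hPL : ‖p.P - L‖ ≤ p.smallness δ t + |t| * ‖p.germCommutant s‖ := by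
    have h1 : p.P - L = (1 - p.F δ t) * p.P + p.F δ t * ((t : ℂ) • p.germCommutant s) := by
      rw [hL]; noncomm_ring
    rw [h1]
    refine (norm_add_le_of_le (h.norm_one_sub_F_mul_P_le t) (norm_mul_le_of_le
      (p.isStarProjection_F δ t).norm_le le_rfl)).trans (le_of_eq ?_)
    rw [norm_smul, Complex.norm_real, Real.norm_eq_abs, one_mul]
  have key : C * p.P - C₀ * p.P = C * (p.P - L) + (CV * L - L * C₀) - (p.P - L) * C₀ := by
    rw [hcommP, mul_sub, sub_mul, hCL]
    abel
  have hD := (norm_cos_mul_sub_le (p.isSelfAdjoint_sqrtAF δ t) (hs.isSelfAdjoint_sqrtGerm t) L r).trans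
    (mul_le_mul_of_nonneg_left (h.norm_intertwining_le hs ht hN₀) (abs_nonneg r))
  rw [key]
  refine (norm_sub_le_of_le (norm_add_le_of_le (norm_mul_le_of_le (p.norm_cosSqrtA_le r t) hPL) hD)
    (norm_mul_le_of_le hPL (p.norm_cosSqrtGerm_le r t))).trans (le_of_eq ?_)
  ring

/-- The smoothed estimate for the operator cosine, in terms of bounds for the commutant. -/
theorem norm_cos_sub_mul_smoothing_le (ht : |t| ≤ t₀) (hN₀ : p.N₀ = 0) {c₁₃ c₁₄ : ℝ}
    (h₁₃0 : 0 ≤ c₁₃) (h₁₄0 : 0 ≤ c₁₄)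
    (h₁₃ : 1102 * ‖p.X₁‖ ^ 3 * (√δ)⁻¹ * (√cstar)⁻¹ * ‖p.germCommutant s‖ ≤ c₁₃)
    (h₁₄ : 2 * ‖p.germCommutant s‖ ≤ c₁₄) {ε τ : ℝ} (hε : 0 < ε) :
    ‖p.cosSqrtA (ε⁻¹ * τ) t * p.P - p.cosSqrtGerm (ε⁻¹ * τ) t * p.P‖ *
        (ε ^ (3 / 2 : ℝ) * (t ^ 2 + ε ^ 2) ^ (-(3 / 4) : ℝ))
      ≤ (max 2 (2 * constC1 6 δ ‖p.X₁‖ + c₁₄)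
          + (constC11 6 1 5000 1 δ ‖p.X₁‖ cstar + c₁₃) * |τ|) * ε := by
  have hδ := h.δ_pos
  have hc := h.cstar_pos
  have h0 := h.sqrt_δ_pos
  refine mul_smoothing_le ?_ ?_ hε ?_ ?_
  · unfold constC1; positivity
  · unfold constC11 constC10; positivity
  · refine (norm_sub_le_of_le (norm_mul_le_of_le (p.norm_cosSqrtA_le _ t)
      p.isStarProjection_P.norm_le) (norm_mul_le_of_le (p.norm_cosSqrtGerm_le _ t)
      p.isStarProjection_P.norm_le)).trans (by norm_num)
  refine (h.norm_cos_sub_le hs ht hN₀ (ε⁻¹ * τ)).trans (add_le_add ?_ ?_)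
  · have h1 : p.smallness δ t = (√δ)⁻¹ * ‖p.X₁‖ * |t| := by
      rw [smallness, div_eq_mul_inv]; ring
    have h2 : 0 ≤ (√δ)⁻¹ * ‖p.X₁‖ * |t| := by positivity
    have h3 := mul_le_mul_of_nonneg_right h₁₄ (abs_nonneg t)
    rw [h1, constC1]
    nlinarith
  · refine mul_le_mul_of_nonneg_left ?_ (abs_nonneg _)
    have h1 := h.le_constC10 (β₁₀ := 1) (β₁₁ := 5000) (β₁₂ := 1) zero_le_one zero_le_one t
    have h2 : 2 * (|t| * ‖p.X₁‖) * p.smallness δ t ^ 2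
        ≤ (√8)⁻¹ * 6 * ‖p.X₁‖ ^ 3 * δ⁻¹ * |t| ^ 3 := by
      have h3 : p.smallness δ t ^ 2 = |t| ^ 2 * ‖p.X₁‖ ^ 2 * δ⁻¹ := by
        rw [smallness, div_pow, Real.sq_sqrt hδ.le, mul_pow, div_eq_mul_inv]
      -- This fixes β₁ = 6: the term 2mθ² has to fit into 8^{-1/2}β₁‖X₁‖³δ⁻¹|t|³.
      have h4 : 2 ≤ (√8)⁻¹ * 6 := by
        have h5 : √8 ≤ 3 := Real.sqrt_le_iff.2 ⟨by norm_num, by norm_num⟩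
        rw [inv_mul_eq_div, le_div_iff₀ (by positivity)]
        linarith
      rw [h3]
      calc 2 * (|t| * ‖p.X₁‖) * (|t| ^ 2 * ‖p.X₁‖ ^ 2 * δ⁻¹)
          = 2 * (‖p.X₁‖ ^ 3 * δ⁻¹ * |t| ^ 3) := by ring
        _ ≤ (√8)⁻¹ * 6 * (‖p.X₁‖ ^ 3 * δ⁻¹ * |t| ^ 3) := by gcongr
        _ = _ := by ring
    have h3 : 1102 * (|t| * ‖p.X₁‖) * p.smallness δ t * (‖p.X₁‖ / √cstar)
        * (|t| * ‖p.germCommutant s‖) ≤ c₁₃ * |t| ^ 3 := by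
      calc _ = 1102 * ‖p.X₁‖ ^ 3 * (√δ)⁻¹ * (√cstar)⁻¹ * ‖p.germCommutant s‖ * |t| ^ 3 := by
            rw [smallness, div_eq_mul_inv, div_eq_mul_inv]; ring
        _ ≤ _ := by gcongr
    have h4 : constC11 6 1 5000 1 δ ‖p.X₁‖ cstar
        = (√8)⁻¹ * 6 * ‖p.X₁‖ ^ 3 * δ⁻¹ + constC10 1 5000 1 δ ‖p.X₁‖ cstar := rfl
    rw [h4]
    linarith

omit hs in
/-- The case `N = 0`. -/
theorem norm_cos_sub_le_of_N_eq_zero (hN : p.N = 0) {ε : ℝ} (τ : ℝ) (hε : 0 < ε)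
    (ht : |t| ≤ t₀) :
    ‖p.cosSqrtA (ε⁻¹ * τ) t * p.P - p.cosSqrtGerm (ε⁻¹ * τ) t * p.P‖ *
        (ε ^ (3 / 2 : ℝ) * (t ^ 2 + ε ^ 2) ^ (-(3 / 4) : ℝ))
      ≤ (max 2 (2 * constC1 6 δ ‖p.X₁‖) + constC11 6 1 5000 1 δ ‖p.X₁‖ cstar * |τ|) * ε := by
  obtain ⟨s, hs⟩ := h.exists_isGermSpectrum
  have hN₀ : p.N₀ = 0 := by
    have := hs.norm_N₀_le
    rwa [hN, norm_zero, norm_le_zero_iff] at this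
  have hM : p.germCommutant s = 0 := by
    simp [germCommutant, offDiagSum, hN]
  have := h.norm_cos_sub_mul_smoothing_le hs (t := t) (τ := τ) ht hN₀ (le_refl 0) (le_refl 0)
    (by simp [hM]) (by simp [hM]) hε
  simpa using this

omit hs in
/-- The case `N₀ = 0`. -/
theorem norm_cos_sub_le_of_N₀_eq_zero (hN₀ : p.N₀ = 0) {c : ℝ}
    (hc : IsLeast (p.gaps cstar) c ∨ (p.gaps cstar = ∅ ∧ 0 < c)) {ε : ℝ} (τ : ℝ) (hε : 0 < ε)
    (ht : |t| ≤ t₀) :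
    ‖p.cosSqrtA (ε⁻¹ * τ) t * p.P - p.cosSqrtGerm (ε⁻¹ * τ) t * p.P‖ *
        (ε ^ (3 / 2 : ℝ) * (t ^ 2 + ε ^ 2) ^ (-(3 / 4) : ℝ))
      ≤ (max 2 (2 * constC1 6 δ ‖p.X₁‖ + constC14 2 p.n δ ‖p.X₁‖ cstar c)
          + (constC11 6 1 5000 1 δ ‖p.X₁‖ cstar + constC13 1102 p.n δ ‖p.X₁‖ cstar c) * |τ|)
          * ε := by
  obtain ⟨s, hs⟩ := h.exists_isGermSpectrum
  have hδ := h.δ_pos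
  have hcs := h.cstar_pos
  have h0 := h.sqrt_δ_pos
  have hx := h.X₁_pos
  have hn : 0 < p.n := by
    have := h.ker_finite
    exact Module.finrank_pos_iff.2 (Submodule.nontrivial_iff_ne_bot.2 h.ker_ne_bot)
  have hn1 : (1 : ℝ) ≤ p.n := by exact_mod_cast hn
  have hhalf : cstar ^ (-(1 / 2) : ℝ) = (√cstar)⁻¹ := by
    rw [Real.sqrt_eq_rpow, ← Real.rpow_neg hcs.le]
  rcases hc with hc | ⟨hgaps, hc⟩
  · have hcpos : 0 < c ∧ c ≤ cstar := by
      obtain ⟨γ, -, γ', -, hne, -, hmin⟩ := hc.1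
      rw [hmin]
      refine ⟨lt_min hcs ?_, min_le_left _ _⟩
      have := abs_pos.2 (sub_ne_zero.2 hne.symm)
      positivity
    obtain ⟨hc0, hccs⟩ := hcpos
    have hcx : c ≤ ‖p.X₁‖ ^ 2 := hccs.trans h.cstar_le
    -- The factor n⁻¹ in the definition of c° turns the gap into nc°, so one of the two powers of n
    -- from counting pairs is recovered.
    have hk : ∀ x ∈ s, ∀ y ∈ s, x ≠ y → p.germProj x * p.N * p.germProj y ≠ 0 →
        |(x - y)⁻¹| ≤ ((p.n : ℝ) * c)⁻¹ := by
      intro x hx y hy hne hnz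
      have h1 : c ≤ min cstar ((p.n : ℝ)⁻¹ * |y - x|) :=
        hc.2 ⟨x, (hs.mem_iff x).1 hx, y, (hs.mem_iff y).1 hy, hne,
          by rw [mul_assoc] at hnz; exact hnz, rfl⟩
      have h2 := h1.trans (min_le_right _ _)
      rw [inv_mul_eq_div, le_div_iff₀ (by positivity)] at h2
      rw [abs_inv, abs_sub_comm]
      exact inv_anti₀ (by positivity) (by linarith)
    have hM := hs.norm_germCommutant_le (by positivity) hk
    have hM' : ‖p.germCommutant s‖ ≤ p.n * ((√δ)⁻¹ * ‖p.X₁‖ ^ 3) * c⁻¹ := by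
      have h1 : (√(8 * δ))⁻¹ ≤ (√δ)⁻¹ := inv_anti₀ h0 (Real.sqrt_le_sqrt (by linarith))
      calc _ ≤ (p.n : ℝ) ^ 2 * (((p.n : ℝ) * c)⁻¹ * ((√δ)⁻¹ * ‖p.X₁‖ ^ 3)) := by
            refine hM.trans ?_
            gcongr
            exact h.norm_N_le.trans (by gcongr)
        _ = _ := by field_simp
    -- The bound on M gives C₁₃ and C₁₄ with lower powers; the factors n, ‖X₁‖²/c° and
    -- ‖X₁‖c_*^{-1/2}, all at least 1, bring it to the stated form.
    have hc1 : 1 ≤ ‖p.X₁‖ ^ 2 * c⁻¹ := by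
      rw [← div_eq_mul_inv, one_le_div hc0]; exact hcx
    have hκ : 1 ≤ ‖p.X₁‖ * (√cstar)⁻¹ := by
      rw [← div_eq_mul_inv]; exact h.one_le_div_sqrt
    have hscs := h.sqrt_cstar_pos
    refine h.norm_cos_sub_mul_smoothing_le hs ht hN₀ ?_ ?_ ?_ ?_ hε
    · unfold constC13; positivity
    · unfold constC14; positivity
    · rw [constC13, hhalf]
      calc 1102 * ‖p.X₁‖ ^ 3 * (√δ)⁻¹ * (√cstar)⁻¹ * ‖p.germCommutant s‖
          ≤ 1102 * ‖p.X₁‖ ^ 3 * (√δ)⁻¹ * (√cstar)⁻¹ * (p.n * ((√δ)⁻¹ * ‖p.X₁‖ ^ 3) * c⁻¹) := by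
            gcongr
        _ = 1 * 1 * (1102 * p.n * δ⁻¹ * (√cstar)⁻¹ * ‖p.X₁‖ ^ 6 * c⁻¹) := by
            have : (√δ)⁻¹ * (√δ)⁻¹ = δ⁻¹ := by rw [← mul_inv, Real.mul_self_sqrt hδ.le]
            rw [← this]; ring
        _ ≤ p.n * (‖p.X₁‖ ^ 2 * c⁻¹)
            * (1102 * p.n * δ⁻¹ * (√cstar)⁻¹ * ‖p.X₁‖ ^ 6 * c⁻¹) := by gcongr
        _ = _ := by rw [← inv_pow]; ring
    · rw [constC14, hhalf]
      calc 2 * ‖p.germCommutant s‖ ≤ 2 * (p.n * ((√δ)⁻¹ * ‖p.X₁‖ ^ 3) * c⁻¹) := by gcongr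
        _ = 1 * 1 * (2 * (p.n * ((√δ)⁻¹ * ‖p.X₁‖ ^ 3) * c⁻¹)) := by ring
        _ ≤ p.n * (‖p.X₁‖ * (√cstar)⁻¹) * (2 * (p.n * ((√δ)⁻¹ * ‖p.X₁‖ ^ 3) * c⁻¹)) := by gcongr
        _ = _ := by ring
  · have hM : p.germCommutant s = 0 := by
      rw [← norm_le_zero_iff]
      refine (hs.norm_germCommutant_le (b := 0) le_rfl fun x hx y hy hne hnz => ?_).trans (by simp)
      have : min cstar ((p.n : ℝ)⁻¹ * |y - x|) ∈ p.gaps cstar :=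
        ⟨x, (hs.mem_iff x).1 hx, y, (hs.mem_iff y).1 hy, hne,
          by rw [mul_assoc] at hnz; exact hnz, rfl⟩
      rw [hgaps] at this
      exact absurd this (Set.notMem_empty _)
    refine h.norm_cos_sub_mul_smoothing_le hs ht hN₀ ?_ ?_ ?_ ?_ hε
    · unfold constC13; positivity
    · unfold constC14; positivity
    · rw [hM, norm_zero, mul_zero]; unfold constC13; positivity
    · rw [hM, norm_zero, mul_zero]; unfold constC14; positivity

end Assumptions

end OperatorPencil

/-! ## Analytic branches of eigenvalues and eigenvectors -/

section Branches

open Filter Topology Asymptotics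

/-- Comparison of the first-order expansions at zero. -/
theorem HasDerivAt.eq_of_isBigO_sq {E : Type*} [NormedAddCommGroup E] [NormedSpace ℝ E]
    {f : ℝ → E} {f' a b : E} (hf : HasDerivAt f f' 0)
    (h : (fun t : ℝ => f t - (a + t • b)) =O[𝓝[≠] 0] fun t => t ^ 2) : f 0 = a ∧ f' = b := by
  have hlin : HasDerivAt (fun t : ℝ => a + t • b) b 0 := by
    simpa using ((hasDerivAt_id (0 : ℝ)).smul_const b).const_add a
  have h0 : Tendsto (fun t : ℝ => t ^ 2) (𝓝[≠] 0) (𝓝 0) := by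
    have : Tendsto (fun t : ℝ => t ^ 2) (𝓝 0) (𝓝 (0 ^ 2)) := (continuous_pow 2).tendsto 0
    rw [zero_pow two_ne_zero] at this
    exact this.mono_left nhdsWithin_le_nhds
  have hsub := hf.sub hlin
  have h1 : Tendsto (fun t : ℝ => f t - (a + t • b)) (𝓝[≠] 0) (𝓝 (f 0 - (a + (0 : ℝ) • b))) :=
    hsub.continuousAt.tendsto.mono_left nhdsWithin_le_nhds
  have h2 := tendsto_nhds_unique h1 (h.trans_tendsto h0)
  rw [zero_smul, add_zero, sub_eq_zero] at h2
  refine ⟨h2, ?_⟩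
  have h3 : Tendsto (fun t : ℝ => t⁻¹ • (f t - (a + t • b))) (𝓝[≠] 0) (𝓝 0) := by
    have h4 : (fun t : ℝ => t⁻¹ • (f t - (a + t • b))) =O[𝓝[≠] 0] fun t : ℝ => t⁻¹ * t ^ 2 :=
      (isBigO_refl (fun t : ℝ => t⁻¹) _).smul h
    have h5 : Tendsto (fun t : ℝ => t⁻¹ * t ^ 2) (𝓝[≠] 0) (𝓝 0) := by
      refine (tendsto_id.mono_left nhdsWithin_le_nhds).congr' ?_
      filter_upwards [self_mem_nhdsWithin] with t ht
      have : t ≠ 0 := ht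
      simp only [id]
      field_simp
    exact h4.trans_tendsto h5
  have h4 : Tendsto (fun t : ℝ => t⁻¹ • (f t - (a + t • b))) (𝓝[≠] 0) (𝓝 (f' - b)) := by
    have := hsub.tendsto_slope_zero
    simpa [h2] using this
  exact sub_eq_zero.1 (tendsto_nhds_unique h4 h3)

theorem AnalyticAt.isBigO_sub_cubic {f : ℝ → ℝ} (hf : AnalyticAt ℝ f 0) (h0 : f 0 = 0)
    (h1 : deriv f 0 = 0) :
    (fun t : ℝ => f t - (iteratedDeriv 2 f 0 / 2 * t ^ 2 + iteratedDeriv 3 f 0 / 6 * t ^ 3))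
      =O[𝓝 0] fun t => t ^ 4 := by
  refine ((hf.hasFPowerSeriesAt.isBigO_sub_partialSum_pow 4).congr_left fun t => ?_).trans
    (IsBigO.of_norm_left ?_)
  -- The factorials 2 and 6 of the Taylor coefficients are those of `γcoeff` and `μcoeff`.
  · simp [FormalMultilinearSeries.partialSum, Finset.sum_range_succ, h0, h1, Nat.factorial]
    ring
  · exact (isBigO_refl _ _).congr_left fun t => by simp [Even.pow_abs ⟨2, rfl⟩]

variable {H : Type*} [NormedAddCommGroup H] [InnerProductSpace ℂ H]

/-- The map is conjugate-linear in its second argument, so it is bilinear over ℝ only; this suffices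
as t is real. -/
theorem isBoundedBilinearMap_rankOne :
    IsBoundedBilinearMap ℝ fun q : H × H => InnerProductSpace.rankOne ℂ q.1 q.2 where
  add_left x y z := by rw [map_add, add_apply]
  smul_left c x y := by
    rw [← Complex.coe_smul, map_smul]; ext u; simp
  add_right x y z := by rw [map_add]
  smul_right c x y := by
    rw [← Complex.coe_smul, map_smulₛₗ, Complex.conj_ofReal]; ext u; simp
  bound := ⟨1, one_pos, fun x y => by rw [InnerProductSpace.norm_rankOne, one_mul]⟩

theorem HasDerivAt.rankOne_self {φ : ℝ → H} {ψ : H} (hφ : HasDerivAt φ ψ 0) :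
    HasDerivAt (fun t => InnerProductSpace.rankOne ℂ (φ t) (φ t))
      (InnerProductSpace.rankOne ℂ (φ 0) ψ + InnerProductSpace.rankOne ℂ ψ (φ 0)) 0 := by
  have h := (isBoundedBilinearMap_rankOne (H := H)).hasFDerivAt (φ 0, φ 0)
  exact h.comp_hasDerivAt (0 : ℝ) (hφ.prodMk hφ)

theorem Orthonormal.sum_inner_smul_eq {ι : Type*} [Fintype ι] {v : ι → H} (hv : Orthonormal ℂ v)
    {x : H} (hx : x ∈ Submodule.span ℂ (Set.range v)) : ∑ i, ⟪v i, x⟫_ℂ • v i = x := by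
  classical
  induction hx using Submodule.span_induction with
  | mem x hx =>
    obtain ⟨j, rfl⟩ := hx
    simp [orthonormal_iff_ite.1 hv]
  | zero => simp
  | add x y _ _ h1 h2 => simp only [inner_add_right, add_smul, Finset.sum_add_distrib, h1, h2]
  | smul a x _ h1 => simp only [inner_smul_right, mul_smul, ← Finset.smul_sum, h1]

/-- F fixes the basis vectors and is selfadjoint, so the coefficients of Fu in the basis are those
of u. -/
theorem IsStarProjection.eq_sum_rankOne [CompleteSpace H] {ι : Type*} [Fintype ι] {v : ι → H}
    {F : H →L[ℂ] H} (hF : IsStarProjection F) (hv : Orthonormal ℂ v)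
    (hs : Submodule.span ℂ (Set.range v) = LinearMap.range (F : H →ₗ[ℂ] H)) :
    F = ∑ i, InnerProductSpace.rankOne ℂ (v i) (v i) := by
  ext u
  have h1 : F u ∈ Submodule.span ℂ (Set.range v) := by
    rw [hs]; exact ⟨u, rfl⟩
  rw [← hv.sum_inner_smul_eq h1, _root_.sum_apply]
  refine Finset.sum_congr rfl fun i _ => ?_
  have h2 : F (v i) = v i := by
    obtain ⟨w, hw⟩ : v i ∈ LinearMap.range (F : H →ₗ[ℂ] H) := hs ▸ Submodule.subset_span ⟨i, rfl⟩
    rw [← hw]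
    exact congrArg (fun T : H →L[ℂ] H => T w) hF.isIdempotentElem.eq
  have h3 : ⟪v i, F u⟫_ℂ = ⟪F (v i), u⟫_ℂ := (hF.isSelfAdjoint.isSymmetric (v i) u).symm
  rw [h3, h2, InnerProductSpace.rankOne_apply]

end Branches

/-! ### Expansions of F(t) and A(t)F(t) along the branches. -/

namespace OperatorPencil

open Filter Topology Asymptotics InnerProductSpace

variable {H : Type*} [NormedAddCommGroup H] [InnerProductSpace ℂ H] [CompleteSpace H]
variable {K : Type*} [NormedAddCommGroup K] [InnerProductSpace ℂ K] [CompleteSpace K]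
variable {p : OperatorPencil H K} {δ t₀ cstar r t : ℝ}
variable {lam : Fin p.n → ℝ → ℝ} {φ : Fin p.n → ℝ → H}

namespace IsBranches

variable (hb : p.IsBranches δ r lam φ)
include hb

theorem F_eq_sum (ht : t ∈ Set.Icc (-r) r) :
    p.F δ t = ∑ l, rankOne ℂ (φ l t) (φ l t) :=
  (p.isStarProjection_F δ t).eq_sum_rankOne (hb.orthonormal t ht) (hb.span_eq t ht)

theorem F_apply (ht : t ∈ Set.Icc (-r) r) (l : Fin p.n) : p.F δ t (φ l t) = φ l t := by
  rw [hb.F_eq_sum ht, _root_.sum_apply]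
  simp [orthonormal_iff_ite.1 (hb.orthonormal t ht)]

theorem sqrtAF_mul_self_apply (ht : t ∈ Set.Icc (-r) r) (l : Fin p.n) :
    (p.sqrtAF δ t * p.sqrtAF δ t) (φ l t) = (lam l t : ℂ) • φ l t := by
  obtain ⟨hd, hA⟩ := hb.eigen l t ht
  have hF := hb.F_apply ht l
  have hd' : (spectralMeasure (p.A t)).E (Set.Icc 0 δ) (φ l t) ∈ (p.A t).domain := by
    change p.F δ t (φ l t) ∈ _
    rwa [hF]
  have h1 := (p.isGramMeasure t).spec.apply_E measurableSet_Icc (M := δ)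
    (fun x hx => by rw [abs_of_nonneg hx.1]; exact hx.2) (φ l t) hd'
  rw [← (spectralMeasure (p.A t)).sqrtPart_mul_self] at h1
  refine h1.symm.trans ?_
  rw [← hA]
  congr 1
  exact Subtype.ext hF

theorem sqrtAF_mul_self_eq_sum (ht : t ∈ Set.Icc (-r) r) :
    p.sqrtAF δ t * p.sqrtAF δ t = ∑ l, (lam l t : ℂ) • rankOne ℂ (φ l t) (φ l t) := by
  rw [show p.sqrtAF δ t * p.sqrtAF δ t = p.sqrtAF δ t * p.sqrtAF δ t * p.F δ t by
    rw [mul_assoc, p.sqrtAF_mul_F], hb.F_eq_sum ht, Finset.mul_sum]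
  refine Finset.sum_congr rfl fun l _ => ?_
  have h1 := hb.sqrtAF_mul_self_apply ht l
  ext u
  have h2 : (p.sqrtAF δ t * p.sqrtAF δ t * rankOne ℂ (φ l t) (φ l t)) u
      = (p.sqrtAF δ t * p.sqrtAF δ t) (⟪φ l t, u⟫_ℂ • φ l t) := rfl
  rw [h2, map_smul, h1, smul_comm]
  rfl

theorem eventually_mem (hr : 0 < r) : ∀ᶠ t : ℝ in 𝓝 0, t ∈ Set.Icc (-r) r :=
  Icc_mem_nhds (by linarith) hr

theorem hasDerivAt_lam (hr : 0 < r) (l : Fin p.n) : HasDerivAt (lam l) (deriv (lam l) 0) 0 :=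
  (hb.analytic_lam l 0 ⟨by linarith, hr.le⟩).differentiableAt.hasDerivAt

theorem hasDerivAt_φ (hr : 0 < r) (l : Fin p.n) : HasDerivAt (φ l) (deriv (φ l) 0) 0 :=
  (hb.analytic_φ l 0 ⟨by linarith, hr.le⟩).differentiableAt.hasDerivAt

variable (h : p.Assumptions δ t₀ cstar) (hr : 0 < r) (hrt : r ≤ t₀)
include h hr hrt

theorem eventually_abs_le : ∀ᶠ t : ℝ in 𝓝 0, t ∈ Set.Icc (-r) r ∧ |t| ≤ t₀ := by
  filter_upwards [hb.eventually_mem hr] with t ht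
  exact ⟨ht, (abs_le.2 ht).trans hrt⟩

/-- The branches are eigenvalues of V², and ‖V‖ ≤ 3|t|‖X₁‖. This makes the expansion of λ_l start at
t². -/
theorem lam_isBigO (l : Fin p.n) : lam l =O[𝓝 0] fun t => t ^ 2 := by
  refine IsBigO.of_bound (9 * ‖p.X₁‖ ^ 2) ?_
  filter_upwards [hb.eventually_abs_le h hr hrt] with t ⟨ht, ht'⟩
  have h1 := congrArg norm (hb.sqrtAF_mul_self_apply ht l)
  have h2 : ‖φ l t‖ = 1 := (hb.orthonormal t ht).1 l
  rw [norm_smul, h2, mul_one, Complex.norm_real] at h1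
  rw [← h1]
  have h3 := (p.sqrtAF δ t * p.sqrtAF δ t).le_of_opNorm_le
    (norm_mul_le_of_le (h.norm_sqrtAF_le ht') (h.norm_sqrtAF_le ht')) (φ l t)
  rw [h2, mul_one] at h3
  refine h3.trans (le_of_eq ?_)
  rw [Real.norm_eq_abs, abs_pow]
  ring

theorem lam_zero (l : Fin p.n) : lam l 0 = 0 ∧ deriv (lam l) 0 = 0 := by
  refine (hb.hasDerivAt_lam hr l).eq_of_isBigO_sq ?_
  simpa using (hb.lam_isBigO h hr hrt l).mono nhdsWithin_le_nhds

/-- UU^* equals P + t(Z + Z^*) up to t²ZZ^*, so F has this first-order expansion. The sum over the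
branches is differentiable at 0, and the two expansions must agree. -/
theorem sum_rankOne_eq : ∑ l, rankOne ℂ (φ l 0) (φ l 0) = p.P ∧
    ∑ l, (rankOne ℂ (φ l 0) (deriv (φ l) 0) + rankOne ℂ (deriv (φ l) 0) (φ l 0))
      = p.Z + star p.Z := by
  have h1 : HasDerivAt (fun t => ∑ l, rankOne ℂ (φ l t) (φ l t)) _ 0 :=
    HasDerivAt.fun_sum fun l _ => (hb.hasDerivAt_φ hr l).rankOne_self
  refine h1.eq_of_isBigO_sq (IsBigO.of_bound
    (48 * (‖p.X₁‖ / √δ) ^ 2 + ‖p.Z * star p.Z‖) ?_)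
  filter_upwards [(hb.eventually_abs_le h hr hrt).filter_mono nhdsWithin_le_nhds] with t ⟨ht, ht'⟩
  rw [← hb.F_eq_sum ht]
  have h2 := h.norm_F_sub_approxProj_le ht'
  have h3 : p.F δ t - (p.P + t • (p.Z + star p.Z))
      = (p.F δ t - p.approxProj t * star (p.approxProj t)) + ((t : ℂ) ^ 2) • (p.Z * star p.Z) := by
    have hP : star p.P = p.P := p.isStarProjection_P.isSelfAdjoint
    have hPZ : p.P * star p.Z = star p.Z := by
      have := congrArg star h.Z_mul_P
      rwa [star_mul, hP] at this
    rw [approxProj, star_add, hP, star_smul, ← Complex.coe_smul]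
    simp only [Complex.star_def, Complex.conj_ofReal, add_mul, mul_add, smul_mul_assoc,
      mul_smul_comm, smul_smul, h.Z_mul_P, hPZ, p.isStarProjection_P.isIdempotentElem.eq, smul_add,
      pow_two]
    abel
  rw [h3]
  refine (norm_add_le_of_le h2 (norm_smul _ _).le).trans (le_of_eq ?_)
  rw [smallness, norm_pow, Complex.norm_real, norm_pow]
  simp only [Real.norm_eq_abs]
  ring

/-- A(t)F(t) divided by t² is compared with SP + t(N + ZSP + SPZ^*) to first order. -/
theorem sum_smul_rankOne_eq : ∑ l, (γcoeff (lam l) : ℂ) • rankOne ℂ (φ l 0) (φ l 0) = p.SP ∧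
    ∑ l, ((μcoeff (lam l) : ℂ) • rankOne ℂ (φ l 0) (φ l 0) + (γcoeff (lam l) : ℂ) •
      (rankOne ℂ (φ l 0) (deriv (φ l) 0) + rankOne ℂ (deriv (φ l) 0) (φ l 0)))
      = p.N + p.Z * p.SP + p.SP * star p.Z := by
  -- Here λ_l/t² is replaced by its first-order polynomial γ_l + μ_lt, which is defined at t = 0;
  -- the error is O(t²).
  have h1 : HasDerivAt (fun t : ℝ => ∑ l, (γcoeff (lam l) + μcoeff (lam l) * t) •
      rankOne ℂ (φ l t) (φ l t)) (∑ l, ((γcoeff (lam l) + μcoeff (lam l) * 0) •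
      (rankOne ℂ (φ l 0) (deriv (φ l) 0) + rankOne ℂ (deriv (φ l) 0) (φ l 0)) +
      (μcoeff (lam l)) • rankOne ℂ (φ l 0) (φ l 0))) 0 := by
    refine HasDerivAt.fun_sum fun l _ => ?_
    refine HasDerivAt.fun_smul ?_ (hb.hasDerivAt_φ hr l).rankOne_self
    simpa using ((hasDerivAt_id (0 : ℝ)).const_mul (μcoeff (lam l))).const_add (γcoeff (lam l))
  have hB : (fun t : ℝ => p.sqrtAF δ t * p.sqrtAF δ t
      - t ^ 2 • (p.SP + t • (p.N + p.Z * p.SP + p.SP * star p.Z))) =O[𝓝 0] fun t => t ^ 4 := by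
    refine IsBigO.of_bound (2200 * ‖p.X₁‖ ^ 2 * (‖p.X₁‖ / √δ) ^ 2) ?_
    filter_upwards [hb.eventually_abs_le h hr hrt] with t ⟨ht, ht'⟩
    have h2 := h.norm_sqrtAF_sq_sub_le ht'
    have h3 : p.sqrtAF δ t * p.sqrtAF δ t
        - t ^ 2 • (p.SP + t • (p.N + p.Z * p.SP + p.SP * star p.Z))
        = p.sqrtAF δ t * p.sqrtAF δ t - ((t : ℂ) ^ 2) • p.SP - ((t : ℂ) ^ 3) • p.N
      - ((t : ℂ) • p.Z) * (((t : ℂ) ^ 2) • p.SP)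
      - (((t : ℂ) ^ 2) • p.SP) * star ((t : ℂ) • p.Z) := by
      rw [← Complex.coe_smul, ← Complex.coe_smul, star_smul]
      simp only [Complex.star_def, Complex.conj_ofReal, smul_mul_assoc, mul_smul_comm, smul_smul,
        smul_add, Complex.ofReal_pow, ← pow_succ, ← pow_succ']
      abel
    rw [h3]
    refine h2.trans (le_of_eq ?_)
    rw [smallness, norm_pow, Real.norm_eq_abs]
    ring
  have hL : (fun t : ℝ => ∑ l, (lam l t - (γcoeff (lam l) * t ^ 2 + μcoeff (lam l) * t ^ 3)) •
      rankOne ℂ (φ l t) (φ l t)) =O[𝓝 0] fun t => t ^ 4 := by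
    refine IsBigO.fun_sum fun l _ => ?_
    have h2 := AnalyticAt.isBigO_sub_cubic (hb.analytic_lam l 0 ⟨by linarith, hr.le⟩)
      (hb.lam_zero h hr hrt l).1 (hb.lam_zero h hr hrt l).2
    have h3 : (fun t : ℝ => rankOne ℂ (φ l t) (φ l t)) =O[𝓝 0] fun _ => (1 : ℝ) :=
      (hb.hasDerivAt_φ hr l).rankOne_self.continuousAt.isBigO_one ℝ
    exact (h2.smul h3).congr_right fun t => by simp
  have h4 := h1.eq_of_isBigO_sq (a := p.SP) (b := p.N + p.Z * p.SP + p.SP * star p.Z) (by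
    have h5 := (isBigO_refl (fun t : ℝ => (t ^ 2)⁻¹) (𝓝[≠] 0)).smul
      ((hB.sub hL).mono nhdsWithin_le_nhds)
    refine h5.congr' ?_ ?_
    · filter_upwards [self_mem_nhdsWithin,
        (hb.eventually_mem hr).filter_mono nhdsWithin_le_nhds] with t ht0 ht
      have ht0 : t ≠ 0 := ht0
      rw [hb.sqrtAF_mul_self_eq_sum ht, inv_smul_eq_iff₀ (pow_ne_zero 2 ht0), smul_sub,
        sub_right_comm, Finset.smul_sum, ← Finset.sum_sub_distrib]
      congr 1
      refine Finset.sum_congr rfl fun l _ => ?_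
      rw [Complex.coe_smul, ← sub_smul, smul_smul]
      congr 1
      ring
    · filter_upwards [self_mem_nhdsWithin] with t ht0
      have ht0 : t ≠ 0 := ht0
      simp only [smul_eq_mul]
      field_simp)
  simp only [Complex.coe_smul]
  refine ⟨?_, ?_⟩
  · simpa using h4.1
  · rw [← h4.2]
    refine Finset.sum_congr rfl fun l _ => ?_
    rw [mul_zero, add_zero, add_comm]

end IsBranches

end OperatorPencil

/-! ### Identification of N₀ and N_* through the branches. -/

namespace OperatorPencil

open InnerProductSpace

variable {H : Type*} [NormedAddCommGroup H] [InnerProductSpace ℂ H] [CompleteSpace H]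
variable {K : Type*} [NormedAddCommGroup K] [InnerProductSpace ℂ K] [CompleteSpace K]
variable {p : OperatorPencil H K} {δ t₀ cstar r : ℝ}
variable {lam : Fin p.n → ℝ → ℝ} {φ : Fin p.n → ℝ → H}

theorem mul_rankOne (T : H →L[ℂ] H) (x y : H) : T * rankOne ℂ x y = rankOne ℂ (T x) y :=
  comp_rankOne x y T

theorem rankOne_mul (T : H →L[ℂ] H) (x y : H) : rankOne ℂ x y * T = rankOne ℂ x (star T y) := by
  ext u
  change ⟪y, T u⟫_ℂ • x = ⟪ContinuousLinearMap.adjoint T y, u⟫_ℂ • x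
  rw [ContinuousLinearMap.adjoint_inner_left]

namespace IsBranches

variable (hb : p.IsBranches δ r lam φ) (h : p.Assumptions δ t₀ cstar) (hr : 0 < r) (hrt : r ≤ t₀)
include hb h hr hrt

/-- Since ψ_l = ω̃_l + Zω_l and ∑ω_l ⊗ ω_l = P, the Z-parts sum to ZP + PZ^* = Z + Z^*, the whole
first-order coefficient of F. -/
theorem sum_rankOne_ωtilde : ∑ l, (rankOne ℂ (φ l 0) (p.ωtilde (φ l))
    + rankOne ℂ (p.ωtilde (φ l)) (φ l 0)) = 0 := by
  obtain ⟨h1, h2⟩ := hb.sum_rankOne_eq h hr hrt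
  have h3 : p.P * star p.Z = star p.Z := by
    have := congrArg star h.Z_mul_P
    rwa [star_mul, p.isStarProjection_P.isSelfAdjoint.star_eq] at this
  calc _ = ∑ l, (rankOne ℂ (φ l 0) (deriv (φ l) 0) + rankOne ℂ (deriv (φ l) 0) (φ l 0))
        - p.Z * (∑ l, rankOne ℂ (φ l 0) (φ l 0)) - (∑ l, rankOne ℂ (φ l 0) (φ l 0)) * star p.Z := by
        rw [Finset.mul_sum, Finset.sum_mul, ← Finset.sum_sub_distrib, ← Finset.sum_sub_distrib]
        refine Finset.sum_congr rfl fun l _ => ?_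
        rw [mul_rankOne, rankOne_mul, star_star, ωtilde]
        simp only [map_sub, sub_apply]
        abel
    _ = 0 := by rw [h1, h2, h.Z_mul_P, h3]; abel

/-- Replacing ψ_l by ω̃_l subtracts exactly ZSP + SPZ^*, because ∑γ_l ω_l ⊗ ω_l = SP. -/
theorem N_eq_sum : p.N = ∑ l, (μcoeff (lam l) : ℂ) • rankOne ℂ (φ l 0) (φ l 0)
    + ∑ l, (γcoeff (lam l) : ℂ) • (rankOne ℂ (φ l 0) (p.ωtilde (φ l))
      + rankOne ℂ (p.ωtilde (φ l)) (φ l 0)) := by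
  obtain ⟨h1, h2⟩ := hb.sum_smul_rankOne_eq h hr hrt
  calc p.N = p.N + p.Z * p.SP + p.SP * star p.Z - p.Z * p.SP - p.SP * star p.Z := by abel
    _ = _ := by
        rw [← h2, ← h1, Finset.mul_sum, Finset.sum_mul, ← Finset.sum_add_distrib,
          ← Finset.sum_sub_distrib, ← Finset.sum_sub_distrib]
        refine Finset.sum_congr rfl fun l _ => ?_
        rw [mul_smul_comm, smul_mul_assoc, mul_rankOne, rankOne_mul, star_star, ωtilde]
        simp only [map_sub, sub_apply, smul_add, smul_sub]
        abel

theorem mem_germEigenspace (l : Fin p.n) : φ l 0 ∈ p.germEigenspace (γcoeff (lam l)) := by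
  have h0 : (0 : ℝ) ∈ Set.Icc (-r) r := ⟨by linarith, hr.le⟩
  have ho := orthonormal_iff_ite.1 (hb.orthonormal 0 h0)
  rw [OperatorPencil.mem_germEigenspace]
  constructor
  · have h1 : p.P (φ l 0) = φ l 0 := by
      rw [← (hb.sum_rankOne_eq h hr hrt).1, _root_.sum_apply]
      simp [ho]
    rw [← h1]
    exact p.P_mem _
  · rw [← (hb.sum_smul_rankOne_eq h hr hrt).1, _root_.sum_apply]
    simp [ho]

theorem germProj_apply (γ : ℝ) (l : Fin p.n) :
    p.germProj γ (φ l 0) = if γ = γcoeff (lam l) then φ l 0 else 0 := by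
  split_ifs with hγ
  · exact germProj_eq_self (hγ ▸ hb.mem_germEigenspace h hr hrt l)
  · exact germProj_eq_zero hγ (hb.mem_germEigenspace h hr hrt l)

/-- In the γ-block only the l with γ_l = γ survive, so γ comes out of the sum of the ω̃-terms as a
scalar, and what remains is zero by `sum_rankOne_ωtilde`. -/
theorem germProj_mul_N_mul_germProj (γ : ℝ) : p.germProj γ * p.N * p.germProj γ
    = p.germProj γ * ∑ l, (μcoeff (lam l) : ℂ) • rankOne ℂ (φ l 0) (φ l 0) := by
  have hγ := hb.germProj_apply h hr hrt γ
  have h1 : p.germProj γ * (∑ l, (γcoeff (lam l) : ℂ) • (rankOne ℂ (φ l 0) (p.ωtilde (φ l))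
      + rankOne ℂ (p.ωtilde (φ l)) (φ l 0))) * p.germProj γ = 0 := by
    calc _ = (γ : ℂ) • (p.germProj γ * (∑ l, (rankOne ℂ (φ l 0) (p.ωtilde (φ l))
          + rankOne ℂ (p.ωtilde (φ l)) (φ l 0))) * p.germProj γ) := by
          simp only [Finset.mul_sum, Finset.sum_mul, Finset.smul_sum]
          refine Finset.sum_congr rfl fun l _ => ?_
          simp only [mul_smul_comm, smul_mul_assoc, mul_add, add_mul, mul_rankOne, rankOne_mul,
            star_germProj, hγ]
          split_ifs with h2
          · rw [h2]
          · simp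
      _ = 0 := by rw [hb.sum_rankOne_ωtilde h hr hrt, mul_zero, zero_mul, smul_zero]
  rw [hb.N_eq_sum h hr hrt, mul_add, add_mul, h1, add_zero]
  simp only [Finset.mul_sum, Finset.sum_mul]
  refine Finset.sum_congr rfl fun l _ => ?_
  simp only [mul_smul_comm, smul_mul_assoc, mul_rankOne, rankOne_mul, star_germProj, hγ]
  split_ifs
  · rfl
  · simp

theorem N₀_eq_sum : p.N₀ = ∑ l, (μcoeff (lam l) : ℂ) • rankOne ℂ (φ l 0) (φ l 0) := by
  obtain ⟨s, hs⟩ := h.exists_isGermSpectrum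
  rw [hs.N₀_eq, Finset.sum_congr rfl fun γ _ => hb.germProj_mul_N_mul_germProj h hr hrt γ,
    ← Finset.sum_mul, hs.sum_eq, Finset.mul_sum]
  refine Finset.sum_congr rfl fun l _ => ?_
  rw [mul_smul_comm, mul_rankOne,
    P_eq_self (OperatorPencil.mem_germEigenspace.1 (hb.mem_germEigenspace h hr hrt l)).1]

theorem Nstar_eq_sum : p.Nstar = ∑ l, (γcoeff (lam l) : ℂ) •
    (rankOne ℂ (φ l 0) (p.ωtilde (φ l)) + rankOne ℂ (p.ωtilde (φ l)) (φ l 0)) := by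
  rw [Nstar, hb.N₀_eq_sum h hr hrt, hb.N_eq_sum h hr hrt, add_sub_cancel_left]

end IsBranches

end OperatorPencil

end

theorem mainTheorem8 :
    ∃ β₁ β₂ β₁₀ β₁₁ β₁₂ β₁₃ β₁₄ : ℝ,
      (1 ≤ β₁ ∧ 1 ≤ β₂ ∧ 1 ≤ β₁₀ ∧ 1 ≤ β₁₁ ∧ 1 ≤ β₁₂ ∧ 1 ≤ β₁₃ ∧ 1 ≤ β₁₄) ∧
      ∀ (H : Type*) [NormedAddCommGroup H] [InnerProductSpace ℂ H] [CompleteSpace H]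
        (K : Type*) [NormedAddCommGroup K] [InnerProductSpace ℂ K] [CompleteSpace K]
        (p : OperatorPencil H K) (δ t₀ cstar : ℝ), p.Assumptions δ t₀ cstar →
      -- the second-order approximation of `A(t)^{1/2} F(t)`
      ((∀ t : ℝ, |t| ≤ t₀ →
          ‖p.sqrtAF δ t - ((|t| : ℝ) : ℂ) • p.sqrtSP - ((t * |t| : ℝ) : ℂ) • p.G‖
            ≤ constC10 β₁₀ β₁₁ β₁₂ δ ‖p.X₁‖ cstar * |t| ^ 3) ∧
        ‖p.Istar‖ ≤ 5 / 2 * (Real.sqrt (2 * δ))⁻¹ * (Real.sqrt cstar)⁻¹ * ‖p.X₁‖ ^ 3) ∧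
      -- the expressions of `N₀` and `N_*` through the analytic branches
      (∀ (r : ℝ) (lam : Fin p.n → ℝ → ℝ) (φ : Fin p.n → ℝ → H), 0 < r → r ≤ t₀ →
        p.IsBranches δ r lam φ →
          p.N₀ = ∑ l, (OperatorPencil.μcoeff (lam l) : ℂ) •
            InnerProductSpace.rankOne ℂ (φ l 0) (φ l 0) ∧
          p.Nstar = ∑ l, (OperatorPencil.γcoeff (lam l) : ℂ) •
            (InnerProductSpace.rankOne ℂ (φ l 0) (p.ωtilde (φ l)) +
              InnerProductSpace.rankOne ℂ (p.ωtilde (φ l)) (φ l 0))) ∧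
      -- the case `N = 0`
      (p.N = 0 → ∀ ε τ t : ℝ, 0 < ε → |t| ≤ t₀ →
        ‖p.cosSqrtA (ε⁻¹ * τ) t ∘L p.P - p.cosSqrtGerm (ε⁻¹ * τ) t ∘L p.P‖ *
            (ε ^ (3 / 2 : ℝ) * (t ^ 2 + ε ^ 2) ^ (-(3 / 4) : ℝ))
          ≤ (max 2 (2 * constC1 β₁ δ ‖p.X₁‖) +
              constC11 β₁ β₁₀ β₁₁ β₁₂ δ ‖p.X₁‖ cstar * |τ|) * ε) ∧
      -- the case `N₀ = 0`
      (p.N₀ = 0 → ∀ c t₀₀ : ℝ,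
        (IsLeast (p.gaps cstar) c ∨ (p.gaps cstar = ∅ ∧ 0 < c)) →
        t₀₀ ≤ t₀ → t₀₀ ≤ (4 * β₂)⁻¹ * Real.sqrt δ * (‖p.X₁‖ ^ 3)⁻¹ * c →
        ∀ ε τ t : ℝ, 0 < ε → |t| ≤ t₀₀ →
        ‖p.cosSqrtA (ε⁻¹ * τ) t ∘L p.P - p.cosSqrtGerm (ε⁻¹ * τ) t ∘L p.P‖ *
            (ε ^ (3 / 2 : ℝ) * (t ^ 2 + ε ^ 2) ^ (-(3 / 4) : ℝ))
          ≤ (max 2 (2 * constC1 β₁ δ ‖p.X₁‖ + constC14 β₁₄ p.n δ ‖p.X₁‖ cstar c) +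
              (constC11 β₁ β₁₀ β₁₁ β₁₂ δ ‖p.X₁‖ cstar +
                constC13 β₁₃ p.n δ ‖p.X₁‖ cstar c) * |τ|) * ε) := by
  -- 6 gives 6/√8 ≥ 2; 5000 and 1102 come from the second- and first-order comparisons of the square
  -- roots; 2 comes from replacing P by the intertwiner on both sides.
  refine ⟨6, 1, 1, 5000, 1, 1102, 2, by norm_num, fun H _ _ _ K _ _ _ p δ t₀ cstar h =>
    ⟨⟨fun t ht => ?_, h.norm_Istar_le⟩,
      fun r lam φ hr hrt hb => ⟨hb.N₀_eq_sum h hr hrt, hb.Nstar_eq_sum h hr hrt⟩,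
      fun hN ε τ t hε ht => h.norm_cos_sub_le_of_N_eq_zero hN τ hε ht,
      fun hN₀ c t₀₀ hc ht₀ _ ε τ t hε ht =>
        h.norm_cos_sub_le_of_N₀_eq_zero hN₀ hc τ hε (ht.trans ht₀)⟩⟩
  obtain ⟨s, hs⟩ := h.exists_isGermSpectrum
  exact h.norm_sqrtAF_sub_G_le hs zero_le_one zero_le_one ht
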